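/- Let $M,N\ge 0$ and $p\ge 1$ be integers. For $a=1,\dots,M+N$ put $[a]=0$ if $a\le M$ and $[a]=1$ otherwise; a quantity indexed by $ab$ has parity $[a]+[b]$. View $gl(Mp|Np)$ as $gl(p)\otimes gl(M|N)$, with generators $J^{AB}$, $A=(a,i)$, $B=(b,k)$, $1\le i,k\le p$, $[A]=[a]$, and extend $$\{J^{AB},J^{CD}\}=\delta^{CB}J^{AD}-(-1)^{([A]+[B])([C]+[D])}\delta^{AD}J^{CB}$$ to the free supercommutative algebra over $\mathbb C$ on the $J^{AB}$ as a graded Poisson bracket. Let $e_-=\sum_i E_{i+1,i}$, $2e_+=\sum_i i(p-i)E_{i,i+1}$ in $gl(p)$, and let $M_{jm}$ ($0\le j\le p-1$, $-j\le m\le j$) be the basis of $gl(p)$ with $M_{jj}=(2e_+)^j$, $M_{j,m-1}=[e_-,M_{jm}]$. Put $\mathbb J^{AB}=(-1)^{[A]}J^{AB}$ and impose the second class constraints $$\mathbb J=e_-\otimes 1+\sum_{a,b}\sum_{j=0}^{p-1}(-1)^{[a]}\,W_j^{ab}\,M_{jj}\otimes E_{ab},$$ i.e. for all $a,b$, all $j$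 and all $m<j$ the $(j,m)$ coordinate of the $(a,b)$ block of $\mathbb J-e_-\otimes 1$ vanishes; call these coordinates (with the sign $(-1)^{[a]}$ removed) $\varphi_\alpha$. The superalgebra $\mathcal W_p(M|N)=\mathcal W(gl(Mp|Np),(M+N)gl(p))$ is the free supercommutative algebra generated by the $W_j^{ab}$, $0\le j\le p-1$, equipped with the Dirac bracket $$\{X,Y\}_*=\{X,Y\}-\sum_{\alpha,\beta}\{X,\varphi_\alpha\}(\Delta^{-1})_{\alpha\beta}\{\varphi_\beta,Y\},\qquad \Delta_{\alpha\beta}=\{\varphi_\alpha,\varphi_\beta\},$$ where $W_j^{ab}$ is regarded as the corresponding $(j,j)$ coordinate and the constraints are applied after the brackets on the right have been computed. Below, $\{\,,\}$ denotes this Dirac bracket. **Proposition.** For all $M,N$ the matrix $\Delta$, taken on the constraint surface, is invertible. For each sign $\pm$ there is exactly one system of complex numbers ${}^{\pm}\alpha^{n,j}_{\vec s}$ (depending only on $p$; $j\ge 0$, $1\le n\le j+1$, $\vec s=(s_1,\dots,s_n)$ with $0\le s_i\le p-1$ and $|\vec s|=\sum_i s_i=j+1-n$) such that, for all $M,N$,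 the elements $${}^{\pm}\bar W_j^{ab}=\sum_{n=1}^{j+1}\ \sum_{|\vec s|=j+1-n}{}^{\pm}\alpha^{n,j}_{\vec s}\sum_{i_1,\dots,i_{n-1}=1}^{M+N}(-1)^{[i_1]+\dots+[i_{n-1}]}\,W_{s_1}^{ai_1}W_{s_2}^{i_1i_2}\cdots W_{s_n}^{i_{n-1}b}$$ of $\mathcal W_p(M|N)$ satisfy, for all $a,b,c,d$ (with $W_1^{ab}=0$ if $p=1$), $$\bar W_0^{ab}:={}^{\pm}\bar W_0^{ab}=pW_0^{ab},\qquad {}^{\pm}\bar W_1^{ab}=\pm\tfrac{p(p^2-1)}6W_1^{ab}+\tfrac{p(p\pm1)}2\sum_e(-1)^{[e]}W_0^{ae}W_0^{eb},$$ for all $j\ge1$ $$\{{}^{\pm}\bar W_1^{ab},{}^{\pm}\bar W_j^{cd}\}=\delta^{cb}\,{}^{\pm}\bar W_{j+1}^{ad}-(-1)^{([a]+[b])([c]+[d])}\delta^{ad}\,{}^{\pm}\bar W_{j+1}^{cb}+(-1)^{[c]([a]+[b])+[a][b]}\big(\bar W_0^{cb}\,{}^{\pm}\bar W_j^{ad}-{}^{\pm}\bar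 W_j^{cb}\,\bar W_0^{ad}\big),$$ and for all $j\ge0$ $$\{\bar W_0^{ab},{}^{\pm}\bar W_j^{cd}\}=\delta^{cb}\,{}^{\pm}\bar W_j^{ad}-(-1)^{([a]+[b])([c]+[d])}\delta^{ad}\,{}^{\pm}\bar W_j^{cb}.$$ Moreover ${}^{\pm}\alpha^{1,j}_{j}=(\pm1)^j(j!)^2\binom{p+j}{2j+1}$ for $0\le j<p$, and ${}^{-}\alpha^{j+1,j}_{(0,\dots,0)}=\binom p{j+1}$, ${}^{+}\alpha^{j+1,j}_{(0,\dots,0)}=\binom{p+j}{j+1}$ for $j\ge0$. For all $M,N$ and both signs: 1. ${}^{\pm}\bar W_j^{ab}$ is a polynomial of degree at most $j+1$ in the $W$'s, and of degree exactly $j+1$ for the sign $+$ and all $j$, and for the sign $-$ and all $j<p$. 2. The ${}^{\pm}\bar W_j^{ab}$ with $0\le j\le p-1$ form a basis of generators of $\mathcal W_p(M|N)$: the map $W_j^{ab}\mapsto{}^{\pm}\bar W_j^{ab}$ extends to an algebra automorphism. The ${}^{\pm}\bar W_j^{ab}$ with $j\ge p$ are polynomials in these. 3. For all $j\ge0$,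 $${}^{\pm}\bar W_j^{ab}=\sum_{n=1}^{j+1}(-1)^{j+1+n}\sum_{|\vec s|=j+1-n}\ \sum_{i_1,\dots,i_{n-1}}(-1)^{[i_1]+\dots+[i_{n-1}]}\;{}^{\mp}\bar W_{s_1}^{ai_1}\cdots{}^{\mp}\bar W_{s_n}^{i_{n-1}b}.$$ 4. For all $j\ge p$ and all $a,b$: ${}^{-}\bar W_j^{ab}=0$ and ${}^{+}\bar W_j^{ab}\ne0$. -/

import Mathlib

namespace WSuper

noncomputable section

section SuperPolynomials

variable {X : Type} (par : X → ℕ)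

/-- Graded commutativity of the generators: `x y = (-1)^{[x][y]} y x`. -/
inductive SuperComm : FreeAlgebra ℂ X → FreeAlgebra ℂ X → Prop
  | comm (x y : X) : SuperComm (FreeAlgebra.ι ℂ x * FreeAlgebra.ι ℂ y)
      ((-1 : ℂ) ^ (par x * par y) • (FreeAlgebra.ι ℂ y * FreeAlgebra.ι ℂ x))

/-- The free supercommutative algebra over `ℂ` (the algebra of superpolynomials) on generators
`x : X`, where `x` is even or odd according to the parity of the number `par x`. -/
def SuperPoly : Type := RingQuot (SuperComm par)

instance : Ring (SuperPoly par) := inferInstanceAs (Ring (RingQuot (SuperComm par)))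

instance : Algebra ℂ (SuperPoly par) := inferInstanceAs (Algebra ℂ (RingQuot (SuperComm par)))

/-- The generator `x`. -/
def gen (x : X) : SuperPoly par :=
  RingQuot.mkAlgHom ℂ (SuperComm par) (FreeAlgebra.ι ℂ x)

lemma gen_mul_gen (x y : X) :
    gen par x * gen par y = (-1 : ℂ) ^ (par x * par y) • (gen par y * gen par x) := by
  have h := RingQuot.mkAlgHom_rel ℂ (SuperComm.comm (par := par) x y)
  rw [map_smul, map_mul, map_mul] at h
  exact h

/-- The algebra homomorphism with prescribed graded-commuting values on the generators. -/
def liftHom {B : Type} [Ring B] [Algebra ℂ B] (g : X → B)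
    (hg : ∀ x y, g x * g y = (-1 : ℂ) ^ (par x * par y) • (g y * g x)) : SuperPoly par →ₐ[ℂ] B :=
  RingQuot.liftAlgHom ℂ ⟨FreeAlgebra.lift ℂ g, by
    rintro _ _ ⟨x, y⟩
    simpa using hg x y⟩

lemma liftHom_gen {B : Type} [Ring B] [Algebra ℂ B] (g : X → B)
    (hg : ∀ x y, g x * g y = (-1 : ℂ) ^ (par x * par y) • (g y * g x)) (x : X) :
    liftHom par g hg (gen par x) = g x := by
  unfold liftHom gen
  erw [RingQuot.liftAlgHom_mkAlgHom_apply]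
  simp

lemma superPoly_induction {P : SuperPoly par → Prop} (hc : ∀ r : ℂ, P (algebraMap ℂ _ r))
    (hg : ∀ x, P (gen par x)) (hm : ∀ f g, P f → P g → P (f * g))
    (ha : ∀ f g, P f → P g → P (f + g)) (f : SuperPoly par) : P f := by
  obtain ⟨f, rfl⟩ := RingQuot.mkAlgHom_surjective ℂ (SuperComm par) f
  induction f with
  | grade0 r =>
    have h : RingQuot.mkAlgHom ℂ (SuperComm par) (algebraMap ℂ (FreeAlgebra ℂ X) r) =
        algebraMap ℂ (SuperPoly par) r := AlgHom.commutes _ r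
    rw [h]
    exact hc r
  | grade1 x => exact hg x
  | mul f g hf hg' => rw [map_mul]; exact hm _ _ hf hg'
  | add f g hf hg' => rw [map_add]; exact ha _ _ hf hg'

/-- The automorphism `σ_y`, acting on homogeneous `f` as `f ↦ (-1)^{[y][f]} f`. -/
def signAut (y : X) : SuperPoly par →ₐ[ℂ] SuperPoly par :=
  liftHom par (fun x => (-1 : ℂ) ^ (par y * par x) • gen par x) (by
    intro x z
    simp only [smul_mul_smul_comm, gen_mul_gen par x z, smul_smul]
    congr 1
    ring)

variable [DecidableEq X]

lemma leftDeriv_aux (y x z : X) :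
    (!![(-1 : ℂ) ^ (par y * par x) • gen par x, if x = y then 1 else 0; 0, gen par x] :
        Matrix (Fin 2) (Fin 2) (SuperPoly par)) *
      !![(-1 : ℂ) ^ (par y * par z) • gen par z, if z = y then 1 else 0; 0, gen par z] =
    (-1 : ℂ) ^ (par x * par z) •
      (!![(-1 : ℂ) ^ (par y * par z) • gen par z, if z = y then 1 else 0; 0, gen par z] *
      !![(-1 : ℂ) ^ (par y * par x) • gen par x, if x = y then 1 else 0; 0, gen par x]) := by
  have hs : ∀ n : ℕ, (-1 : ℂ) ^ n * (-1) ^ n = 1 := fun n => by rw [← mul_pow]; simp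
  have hxz := gen_mul_gen par x z
  rw [Matrix.mul_fin_two, Matrix.mul_fin_two]
  ext i j
  fin_cases i <;> fin_cases j
  · simp [hxz, smul_smul]
    congr 1
    ring
  · by_cases hx : x = y <;> by_cases hz : z = y <;>
      simp [hx, hz, smul_smul, hs, mul_comm (par y), add_comm]
  · simp
  · simpa using hxz

lemma rightDeriv_aux (y x z : X) :
    (!![gen par x, if x = y then 1 else 0; 0, (-1 : ℂ) ^ (par y * par x) • gen par x] :
        Matrix (Fin 2) (Fin 2) (SuperPoly par)) *
      !![gen par z, if z = y then 1 else 0; 0, (-1 : ℂ) ^ (par y * par z) • gen par z] =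
    (-1 : ℂ) ^ (par x * par z) •
      (!![gen par z, if z = y then 1 else 0; 0, (-1 : ℂ) ^ (par y * par z) • gen par z] *
      !![gen par x, if x = y then 1 else 0; 0, (-1 : ℂ) ^ (par y * par x) • gen par x]) := by
  have hs : ∀ n : ℕ, (-1 : ℂ) ^ n * (-1) ^ n = 1 := fun n => by rw [← mul_pow]; simp
  have hxz := gen_mul_gen par x z
  rw [Matrix.mul_fin_two, Matrix.mul_fin_two]
  ext i j
  fin_cases i <;> fin_cases j
  · simpa using hxz
  · by_cases hx : x = y <;> by_cases hz : z = y <;>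
      simp [hx, hz, smul_smul, hs, mul_comm (par y), add_comm]
  · simp
  · simp [hxz, smul_smul]
    congr 1
    ring

/-- `f ↦ !![σ_y f, ∂f/∂y; 0, f]`, which is multiplicative exactly because the left partial
derivative satisfies `∂(fg) = (∂f) g + (σ_y f) (∂g)`. -/
def leftHom (y : X) : SuperPoly par →ₐ[ℂ] Matrix (Fin 2) (Fin 2) (SuperPoly par) :=
  liftHom par (fun x => !![(-1 : ℂ) ^ (par y * par x) • gen par x, if x = y then 1 else 0;
    0, gen par x]) (leftDeriv_aux par y)

/-- `f ↦ !![f, f∂/∂y; 0, σ_y f]`, which is multiplicative exactly because the right partial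
derivative satisfies `(fg)∂ = f (g∂) + (f∂) (σ_y g)`. -/
def rightHom (y : X) : SuperPoly par →ₐ[ℂ] Matrix (Fin 2) (Fin 2) (SuperPoly par) :=
  liftHom par (fun x => !![gen par x, if x = y then 1 else 0;
    0, (-1 : ℂ) ^ (par y * par x) • gen par x]) (rightDeriv_aux par y)

/-- The left partial derivative with respect to the generator `y`. -/
def leftDeriv (y : X) (f : SuperPoly par) : SuperPoly par := leftHom par y f 0 1

/-- The right partial derivative with respect to the generator `y`. -/
def rightDeriv (y : X) (f : SuperPoly par) : SuperPoly par := rightHom par y f 0 1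

lemma leftHom_entries (y : X) (f : SuperPoly par) :
    leftHom par y f 0 0 = signAut par y f ∧ leftHom par y f 1 0 = 0 ∧ leftHom par y f 1 1 = f := by
  induction f using superPoly_induction with
  | hc r => simp [Matrix.algebraMap_matrix_apply]
  | hg x => simp [leftHom, signAut, liftHom_gen]
  | hm f g hf hg =>
    obtain ⟨h1, h2, h3⟩ := hf
    obtain ⟨k1, k2, k3⟩ := hg
    simp [Matrix.mul_apply, Fin.sum_univ_two, h1, h2, h3, k1, k2, k3]
  | ha f g hf hg =>
    obtain ⟨h1, h2, h3⟩ := hf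
    obtain ⟨k1, k2, k3⟩ := hg
    simp [h1, h2, h3, k1, k2, k3]

lemma rightHom_entries (y : X) (f : SuperPoly par) :
    rightHom par y f 0 0 = f ∧ rightHom par y f 1 0 = 0 ∧
      rightHom par y f 1 1 = signAut par y f := by
  induction f using superPoly_induction with
  | hc r => simp [Matrix.algebraMap_matrix_apply]
  | hg x => simp [rightHom, signAut, liftHom_gen]
  | hm f g hf hg =>
    obtain ⟨h1, h2, h3⟩ := hf
    obtain ⟨k1, k2, k3⟩ := hg
    simp [Matrix.mul_apply, Fin.sum_univ_two, h1, h2, h3, k1, k2, k3]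
  | ha f g hf hg =>
    obtain ⟨h1, h2, h3⟩ := hf
    obtain ⟨k1, k2, k3⟩ := hg
    simp [h1, h2, h3, k1, k2, k3]

lemma leftDeriv_gen (y x : X) : leftDeriv par y (gen par x) = if x = y then 1 else 0 := by
  simp [leftDeriv, leftHom, liftHom_gen]

lemma rightDeriv_gen (y x : X) : rightDeriv par y (gen par x) = if x = y then 1 else 0 := by
  simp [rightDeriv, rightHom, liftHom_gen]

lemma leftDeriv_mul (y : X) (f g : SuperPoly par) :
    leftDeriv par y (f * g) = leftDeriv par y f * g + signAut par y f * leftDeriv par y g := by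
  have h := leftHom_entries par y f
  have k := leftHom_entries par y g
  simp [leftDeriv, Matrix.mul_apply, Fin.sum_univ_two, h.1, k.2.2, add_comm]

lemma rightDeriv_mul (y : X) (f g : SuperPoly par) :
    rightDeriv par y (f * g) = f * rightDeriv par y g + rightDeriv par y f * signAut par y g := by
  have h := rightHom_entries par y f
  have k := rightHom_entries par y g
  simp [rightDeriv, Matrix.mul_apply, Fin.sum_univ_two, h.1, k.2.2]

/-- The graded Poisson bracket (graded biderivation) with prescribed brackets `br x y` of the
generators: `{f, g} = ∑_{x,y} (f∂/∂x) {x, y} (∂g/∂y)`. -/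
def poissonBracket [Fintype X] (br : X → X → SuperPoly par) (f g : SuperPoly par) :
    SuperPoly par :=
  ∑ x, ∑ y, rightDeriv par x f * br x y * leftDeriv par y g

lemma poissonBracket_gen [Fintype X] (br : X → X → SuperPoly par) (x y : X) :
    poissonBracket par br (gen par x) (gen par y) = br x y := by
  simp [poissonBracket, leftDeriv_gen, rightDeriv_gen]

/-- The superpolynomials of degree at most `d`. -/
def degreeLE (d : ℕ) : Submodule ℂ (SuperPoly par) :=
  Submodule.span ℂ {f | ∃ l : List X, l.length ≤ d ∧ f = (l.map (gen par)).prod}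

end SuperPolynomials

section PrincipalEmbedding

/-- The lowering matrix `e_-` of the principal `sl(2)` in `gl(p)`. -/
def lower (p : ℕ) : Matrix (Fin p) (Fin p) ℂ :=
  Matrix.of fun i k => if (i : ℕ) = k + 1 then 1 else 0

/-- The raising matrix `2 e_+ = ∑ i (p - i) E_{i,i+1}` (`i` counted from `1`), where
`[e_+, e_-] = e_0` and `[e_0, e_±] = ± e_±`. -/
def raise (p : ℕ) : Matrix (Fin p) (Fin p) ℂ :=
  Matrix.of fun i k => if (k : ℕ) = i + 1 then ((i : ℂ) + 1) * ((p : ℂ) - 1 - i) else 0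

/-- The basis `M_{jm}` of `gl(p)`, `0 ≤ j < p`, `-j ≤ m ≤ j`: `M_{jj} = (2 e_+)^j` and
`M_{j,m-1} = [e_-, M_{jm}]`. -/
def multiplet (p j : ℕ) (m : ℤ) : Matrix (Fin p) (Fin p) ℂ :=
  (fun A => lower p * A - A * lower p)^[((j : ℤ) - m).toNat] (raise p ^ j)

/-- The coordinate of index `(j,m)` of a matrix with entries in a complex algebra, in the basis
`M_{jm}`. As `tr (M_{jm} M_{kl}) = 0` unless `k = j` and `l = -m`, it is
`tr (A M_{j,-m}) / tr (M_{jm} M_{j,-m})`. -/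
def coord {B : Type} [Ring B] [Algebra ℂ B] (p j : ℕ) (m : ℤ) (A : Matrix (Fin p) (Fin p) B) : B :=
  ∑ i, ∑ k, (multiplet p j (-m) k i / (multiplet p j m * multiplet p j (-m)).trace) • A i k

end PrincipalEmbedding

section DiracReduction

/-- The grade `[a]` of an index `a` of `gl(M|N)`. -/
def grade (M N : ℕ) (a : Fin (M + N)) : ℕ := if (a : ℕ) < M then 0 else 1

/-- Indices of the generators of `gl(Mp|Np)`: pairs of indices `(a,i)`, `a` an index of `gl(M|N)`
and `i` an index of `gl(p)`. -/
abbrev JIndex (M N p : ℕ) : Type := (Fin (M + N) × Fin p) × (Fin (M + N) × Fin p)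

/-- Indices `(j,a,b)` of the generators `W_j^{ab}`, `0 ≤ j < p`. -/
abbrev WIndex (M N p : ℕ) : Type := Fin p × Fin (M + N) × Fin (M + N)

/-- The parity `[a] + [b]` of `J^{(a,i)(b,k)}`. -/
def parJ (M N p : ℕ) (x : JIndex M N p) : ℕ := grade M N x.1.1 + grade M N x.2.1

/-- The parity `[a] + [b]` of `W_j^{ab}`. -/
def parW (M N p : ℕ) (x : WIndex M N p) : ℕ := grade M N x.2.1 + grade M N x.2.2

/-- Superpolynomials in the generators of `gl(Mp|Np)`. -/
abbrev JAlg (M N p : ℕ) : Type := SuperPoly (parJ M N p)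

/-- The superalgebra `W_p(M|N)`: superpolynomials in the `W_j^{ab}`, to be equipped with the
Dirac bracket. -/
abbrev WAlg (M N p : ℕ) : Type := SuperPoly (parW M N p)

variable (M N p : ℕ)

/-- The Lie superbracket of the generators of `gl(Mp|Np)`:
`{J^{AB}, J^{CD}} = δ^{CB} J^{AD} - (-1)^{([A]+[B])([C]+[D])} δ^{AD} J^{CB}`. -/
def glBracket (x y : JIndex M N p) : JAlg M N p :=
  (if y.1 = x.2 then gen (parJ M N p) (x.1, y.2) else 0) -
    (-1 : ℂ) ^ (parJ M N p x * parJ M N p y) •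
      (if x.1 = y.2 then gen (parJ M N p) (y.1, x.2) else 0)

/-- The Poisson bracket on the superpolynomials in the generators of `gl(Mp|Np)`. -/
def bracketJ (f g : JAlg M N p) : JAlg M N p :=
  poissonBracket (parJ M N p) (glBracket M N p) f g

/-- The `p × p` block of index `(a,b)` of the matrix of generators. -/
def blockJ (a b : Fin (M + N)) : Matrix (Fin p) (Fin p) (JAlg M N p) :=
  Matrix.of fun i k => gen (parJ M N p) ((a, i), (b, k))

/-- The block of index `(a,b)` of the constant matrix `ε_- = e_- ⊗ 1`. The factor `(-1)^{[a]}` is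
the one between the coordinates of the matrix `𝕁` and the generators
`J^{(a,i)(b,k)} = (-1)^{[a]} 𝕁^{(a,i)(b,k)}`, which obey the standard brackets of `gl(Mp|Np)`. -/
def blockLower (a b : Fin (M + N)) : Matrix (Fin p) (Fin p) ℂ :=
  if a = b then (-1 : ℂ) ^ grade M N a • lower p else 0

/-- Indices of the constraints: `(j,m,a,b)` with `0 ≤ j < p` and `-j ≤ m < j`. -/
abbrev CIndex : Type :=
  ((j : Fin p) × Finset.Ico (-((j : ℕ) : ℤ)) ((j : ℕ) : ℤ)) × Fin (M + N) × Fin (M + N)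

/-- The constraints: the coordinates of index `(j,m)`, `m < j`, of the blocks of `𝕁 - ε_-`. -/
def constraint (c : CIndex M N p) : JAlg M N p :=
  coord p c.1.1 c.1.2 (blockJ M N p c.2.1 c.2.2 -
    (blockLower M N p c.2.1 c.2.2).map (algebraMap ℂ (JAlg M N p)))

lemma coord_blockJ_comm (j k : ℕ) (m l : ℤ) (a b c d : Fin (M + N)) :
    coord p j m (blockJ M N p a b) * coord p k l (blockJ M N p c d) =
      (-1 : ℂ) ^ ((grade M N a + grade M N b) * (grade M N c + grade M N d)) •
        (coord p k l (blockJ M N p c d) * coord p j m (blockJ M N p a b)) := by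
  have key : ∀ (r t : Fin p → Fin p → ℂ),
      (∑ i, ∑ k, r i k • gen (parJ M N p) ((a, i), (b, k))) *
        (∑ i, ∑ k, t i k • gen (parJ M N p) ((c, i), (d, k))) =
      (-1 : ℂ) ^ ((grade M N a + grade M N b) * (grade M N c + grade M N d)) •
        ((∑ i, ∑ k, t i k • gen (parJ M N p) ((c, i), (d, k))) *
          (∑ i, ∑ k, r i k • gen (parJ M N p) ((a, i), (b, k)))) := by
    intro r t
    simp only [← Fintype.sum_prod_type']
    rw [Finset.sum_mul_sum, Finset.sum_mul_sum, Finset.sum_comm, Finset.smul_sum]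
    refine Finset.sum_congr rfl fun u _ => ?_
    rw [Finset.smul_sum]
    refine Finset.sum_congr rfl fun v _ => ?_
    rw [smul_mul_smul_comm, smul_mul_smul_comm,
      gen_mul_gen (parJ M N p) ((a, v.1), (b, v.2)) ((c, u.1), (d, u.2)), smul_smul, smul_smul]
    congr 1
    simp only [parJ]
    ring
  exact key _ _

/-- `W_j^{ab}` as a linear function of the generators of `gl(Mp|Np)`: the highest weight
coordinate of index `(j,j)`. -/
def extend : WAlg M N p →ₐ[ℂ] JAlg M N p :=
  liftHom (parW M N p) (fun x => coord p x.1 ((x.1 : ℕ) : ℤ) (blockJ M N p x.2.1 x.2.2))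
    (fun _ _ => coord_blockJ_comm M N p _ _ _ _ _ _ _ _)

/-- The value of a generator on the constraint surface, that is the corresponding entry of
`ε_- + ∑_j W_j^{ab} M_{jj}`. -/
def restrictGen (x : JIndex M N p) : WAlg M N p :=
  algebraMap ℂ _ (blockLower M N p x.1.1 x.2.1 x.1.2 x.2.2) +
    ∑ j : Fin p, multiplet p j ((j : ℕ) : ℤ) x.1.2 x.2.2 • gen (parW M N p) (j, x.1.1, x.2.1)

lemma restrictGen_comm (x y : JIndex M N p) :
    restrictGen M N p x * restrictGen M N p y =
      (-1 : ℂ) ^ (parJ M N p x * parJ M N p y) • (restrictGen M N p y * restrictGen M N p x) := by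
  obtain ⟨⟨a, i⟩, ⟨b, k⟩⟩ := x
  obtain ⟨⟨c, i'⟩, ⟨d, k'⟩⟩ := y
  have even : ∀ (e : Fin (M + N)) (n : ℕ), (-1 : ℂ) ^ ((grade M N e + grade M N e) * n) = 1 :=
    fun e n => by rw [← two_mul, mul_assoc, pow_mul]; simp
  have hsum : ∀ (r t : Fin p → ℂ),
      (∑ j, r j • gen (parW M N p) (j, a, b)) * (∑ j, t j • gen (parW M N p) (j, c, d)) =
      (-1 : ℂ) ^ ((grade M N a + grade M N b) * (grade M N c + grade M N d)) •
        ((∑ j, t j • gen (parW M N p) (j, c, d)) * (∑ j, r j • gen (parW M N p) (j, a, b))) := by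
    intro r t
    rw [Finset.sum_mul_sum, Finset.sum_mul_sum, Finset.sum_comm, Finset.smul_sum]
    refine Finset.sum_congr rfl fun u _ => ?_
    rw [Finset.smul_sum]
    refine Finset.sum_congr rfl fun v _ => ?_
    rw [smul_mul_smul_comm, smul_mul_smul_comm,
      gen_mul_gen (parW M N p) (v, a, b) (u, c, d), smul_smul, smul_smul]
    congr 1
    simp only [parW]
    ring
  have hs := hsum (fun j => multiplet p j ((j : ℕ) : ℤ) i k)
    (fun j => multiplet p j ((j : ℕ) : ℤ) i' k')
  simp only [restrictGen, parJ]
  by_cases hab : a = b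
  · subst hab
    rw [even, one_smul] at hs ⊢
    exact Commute.add_left (Algebra.commute_algebraMap_left _ _)
      (Commute.add_right (Algebra.commute_algebraMap_right _ _) hs)
  · have e1 : blockLower M N p a b = 0 := by simp [blockLower, hab]
    by_cases hcd : c = d
    · subst hcd
      rw [mul_comm, even, one_smul] at hs ⊢
      simp only [e1, Matrix.zero_apply, map_zero, zero_add]
      rw [mul_add, add_mul, hs, Algebra.commutes]
    · have e2 : blockLower M N p c d = 0 := by simp [blockLower, hcd]
      simpa only [e1, e2, Matrix.zero_apply, map_zero, zero_add] using hs

/-- Applying the constraints: restriction of superpolynomials to the constraint surface. -/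
def restrict : JAlg M N p →ₐ[ℂ] WAlg M N p :=
  liftHom (parJ M N p) (restrictGen M N p) (restrictGen_comm M N p)

/-- The matrix `Δ_{αβ} = {φ_α, φ_β}` of the constraints, on the constraint surface. -/
def constraintMatrix : Matrix (CIndex M N p) (CIndex M N p) (WAlg M N p) :=
  Matrix.of fun α β => restrict M N p (bracketJ M N p (constraint M N p α) (constraint M N p β))

/-- The Dirac bracket on `W_p(M|N)`:
`{X,Y}_* = {X,Y} - ∑_{α,β} {X,φ_α} (Δ⁻¹)_{αβ} {φ_β,Y}`, the constraints being applied once the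
Poisson brackets have been computed. -/
def diracBracket (f g : WAlg M N p) : WAlg M N p :=
  restrict M N p (bracketJ M N p (extend M N p f) (extend M N p g)) -
    ∑ α, ∑ β, restrict M N p (bracketJ M N p (extend M N p f) (constraint M N p α)) *
      Ring.inverse (constraintMatrix M N p) α β *
      restrict M N p (bracketJ M N p (constraint M N p β) (extend M N p g))

end DiracReduction

section Families

variable (M N p : ℕ)

/-- The matrix of the generators `W_j^{ab}` of `W_p(M|N)`; there is none for `j ≥ p`, and the
matrix is then zero. -/
def Wgen (j : ℕ) : Matrix (Fin (M + N)) (Fin (M + N)) (WAlg M N p) :=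
  Matrix.of fun a b => if h : j < p then gen (parW M N p) (⟨j, h⟩, a, b) else 0

/-- The diagonal matrix of the signs `(-1)^{[a]}`. -/
def signMatrix : Matrix (Fin (M + N)) (Fin (M + N)) (WAlg M N p) :=
  Matrix.diagonal fun a => (-1) ^ grade M N a

/-- The graded product of matrices `X₁, …, X_n`, with entries
`∑_{i₁,…,i_{n-1}} (-1)^{[i₁]+…+[i_{n-1}]} X₁^{a i₁} X₂^{i₁ i₂} ⋯ X_n^{i_{n-1} b}`. -/
def gradedProd : List (Matrix (Fin (M + N)) (Fin (M + N)) (WAlg M N p)) →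
    Matrix (Fin (M + N)) (Fin (M + N)) (WAlg M N p)
  | [] => signMatrix M N p
  | [A] => A
  | A :: B :: L => A * signMatrix M N p * gradedProd (B :: L)

/-- Systems of numbers `α_s^{n+1,j}`, one for each sequence `s = (s₁,…,s_{n+1})` of integers
`0 ≤ s_i < p`; `j` is given by `j + 1 = (n + 1) + |s|`. -/
abbrev Coeffs (p : ℕ) : Type := (n : ℕ) → (Fin (n + 1) → Fin p) → ℂ

/-- `W̄_j = ∑_{n=1}^{j+1} ∑_{|s|=j+1-n} α_s^{n,j} W_{s₁} ⋯ W_{s_n}` (graded products), as a matrix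
of elements of `W_p(M|N)`. In the code the number of factors is `n + 1`. -/
def Wbar (α : Coeffs p) (j : ℕ) : Matrix (Fin (M + N)) (Fin (M + N)) (WAlg M N p) :=
  ∑ n ∈ Finset.range (j + 1), ∑ s : Fin (n + 1) → Fin p,
    if n + ∑ i, (s i : ℕ) = j then
      α n s • gradedProd M N p (List.ofFn fun i => Wgen M N p (s i)) else 0

/-- The initial values of `W̄_0`, `W̄_1` for the sign `ε`, and the brackets with `W̄_1` and with
`W̄_0`, in the algebra `W_p(M|N)`. -/
def IsYangianFamily (ε : ℤˣ) (α : Coeffs p) : Prop :=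
  (∀ a b, Wbar M N p α 0 a b = (p : ℂ) • Wgen M N p 0 a b) ∧
  (∀ a b, Wbar M N p α 1 a b =
    (((ε : ℤ) : ℂ) * (p * ((p : ℂ) ^ 2 - 1) / 6)) • Wgen M N p 1 a b +
      ((p : ℂ) * (p + ((ε : ℤ) : ℂ)) / 2) •
        ∑ e, (-1 : ℂ) ^ grade M N e • (Wgen M N p 0 a e * Wgen M N p 0 e b)) ∧
  (∀ j, 1 ≤ j → ∀ a b c d,
    diracBracket M N p (Wbar M N p α 1 a b) (Wbar M N p α j c d) =
      (if c = b then Wbar M N p α (j + 1) a d else 0) -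
        (-1 : ℂ) ^ ((grade M N a + grade M N b) * (grade M N c + grade M N d)) •
          (if a = d then Wbar M N p α (j + 1) c b else 0) +
        (-1 : ℂ) ^ (grade M N c * (grade M N a + grade M N b) + grade M N a * grade M N b) •
          (Wbar M N p α 0 c b * Wbar M N p α j a d - Wbar M N p α j c b * Wbar M N p α 0 a d)) ∧
  (∀ j a b c d,
    diracBracket M N p (Wbar M N p α 0 a b) (Wbar M N p α j c d) =
      (if c = b then Wbar M N p α j a d else 0) -
        (-1 : ℂ) ^ ((grade M N a + grade M N b) * (grade M N c + grade M N d)) •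
          (if a = d then Wbar M N p α j c b else 0))

end Families

end

end WSuper

namespace WSuper

noncomputable section

/-! ### Superpolynomials: parity, graded commutation and graded Leibniz rules -/

section SuperPolynomialTheory

variable {X : Type} (par : X → ℕ)

/-! The generators for the sign `+` are corner entries of powers of one matrix. Let `𝒥` be the
matrix of the `(-1)^{[B]} J^{AB}`. The brackets of entries of `𝒥^k` and `𝒥^l` are quadratic in
entries of powers of `𝒥` (`bracketJ_pow_pow`), a classical form of the Yangian relations. The
entries in the last row and first column with respect to `gl(p)` commute with all constraints of
negative weight (`bracketJ_pow_constraint`).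

The constraint matrix `Δ` vanishes where the weights add up to less than `-1`, and where they add up
to `-1` it is an antidiagonal of nonzero numbers, by the duality of the multiplets of the principal
`sl(2)`. So `Δ` is invertible and its inverse vanishes where the weights add up to more than `-1`
(`exists_inverse_constraintMatrix`). A correction term of the Dirac bracket of two corner entries
could only come from two nonnegative weights, where `Δ⁻¹` vanishes; hence their Dirac bracket is
just the restricted Poisson bracket (`diracBracket_restrict`). On the constraint surface `𝒥` becomes
`e_- + ∑ W_s (2e_+)^s`, whose corner entry vanishes in the powers below `p-1` and is `1` in the
power `p-1`; the powers `p-1+n` give matrices `T_n` with `T_0 = 1` obeying the Yangian relations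
(`diracBracket_plusGen`), and `^+W̄_j` is `T_{j+1}` up to signs.

For the sign `-`, the series `∑ t^n T_n` is inverted. Its inverse comes from a triangular linear
system with `e_- + ∑ t^{s+1} W_s (2e_+)^s` (`plusSeries_mul_detSeries`), which shows that it is a
polynomial of degree at most `p` in `t` (`coeff_detSeries_eq_zero`): this is the truncation of
`^-W̄_j` at `j = p`. Differentiating the identity "series times inverse is `1`" gives the brackets
for the sign `-` (`diracBracket_invGen_two`), and solving it recursively gives the mutual inversion
formula (`wordSum_alternating`).

All these elements are noncommutative polynomials in the matrices `W_s`, with coefficients indexed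
by words; the letter `s` has degree `s+1`, and `W̄_j` is the component of degree `j+1`. The stated
coefficients are those of one-letter words and of powers of the letter `0`. Nonzero one-letter
coefficients make the change of generators triangular (`exists_algEquiv`); nonzero coefficients of
powers of `0` give the exact degree, detected by a homomorphism to polynomials over the dual numbers
(`Wbar_notMem_degreeLE`). For uniqueness, the bracket with `W̄_1` determines the entries of
`W̄_{j+1}` off the diagonal, and evaluation at suitable nilpotent matrices in `W_p(n+1|0)` isolates
each word coefficient (`IsYangianFamily.unique`). -/

lemma superPoly_hom_ext {B : Type} [Ring B] [Algebra ℂ B] {f g : SuperPoly par →ₐ[ℂ] B}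
    (h : ∀ x, f (gen par x) = g (gen par x)) (y : SuperPoly par) : f y = g y := by
  induction y using superPoly_induction with
  | hc r => simp
  | hg x => exact h x
  | hm a b ha hb => simp [ha, hb]
  | ha a b ha hb => simp [ha, hb]

lemma neg_one_pow_mul_self (n : ℕ) : (-1 : ℂ) ^ n * (-1) ^ n = 1 := by
  rw [← mul_pow]; simp

lemma neg_one_pow_congr {m n : ℕ} (h : m % 2 = n % 2) : (-1 : ℂ) ^ m = (-1) ^ n := by
  rw [neg_one_pow_eq_pow_mod_two, h, ← neg_one_pow_eq_pow_mod_two]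

/-- The automorphism acting on homogeneous `f` as `f ↦ (-1)^{m[f]} f`. -/
def twist (m : ℕ) : SuperPoly par →ₐ[ℂ] SuperPoly par :=
  liftHom par (fun x => (-1 : ℂ) ^ (m * par x) • gen par x) (by
    intro x z
    simp only [smul_mul_smul_comm, gen_mul_gen par x z, smul_smul]
    congr 1
    ring)

lemma twist_gen (m : ℕ) (x : X) :
    twist par m (gen par x) = (-1 : ℂ) ^ (m * par x) • gen par x := liftHom_gen _ _ _ _

lemma signAut_eq_twist (y : X) : signAut par y = twist par (par y) := rfl

lemma twist_twist (m n : ℕ) (f : SuperPoly par) :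
    twist par m (twist par n f) = twist par (m + n) f := by
  refine superPoly_hom_ext par (f := (twist par m).comp (twist par n)) (g := twist par (m + n))
    (fun x => ?_) f
  simp only [AlgHom.comp_apply, twist_gen, map_smul, smul_smul]
  congr 1
  ring

lemma twist_even {m : ℕ} (hm : Even m) (f : SuperPoly par) : twist par m f = f := by
  refine superPoly_hom_ext par (f := twist par m) (g := AlgHom.id ℂ _) (fun x => ?_) f
  simp [twist_gen, (hm.mul_right (par x)).neg_one_pow]

lemma twist_congr {m n : ℕ} (h : m % 2 = n % 2) (f : SuperPoly par) :
    twist par m f = twist par n f := by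
  refine superPoly_hom_ext par (fun x => ?_) f
  simp only [twist_gen]
  rw [neg_one_pow_congr (m := m * par x) (n := n * par x) (by simp [Nat.mul_mod, h])]

lemma twist_self (m : ℕ) (f : SuperPoly par) : twist par m (twist par m f) = f := by
  rw [twist_twist, twist_even par (Even.add_self m)]

/-- Homogeneity of parity `n` (modulo `2`). -/
def Homog (n : ℕ) (f : SuperPoly par) : Prop := ∀ m, twist par m f = (-1 : ℂ) ^ (m * n) • f

variable {par}

lemma Homog.gen (x : X) : Homog par (par x) (gen par x) := fun m => twist_gen par m x

lemma Homog.algebraMap (r : ℂ) : Homog par 0 (algebraMap ℂ _ r) := fun m => by simp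

lemma Homog.one : Homog par 0 1 := fun m => by simp

lemma Homog.zero (n : ℕ) : Homog par n 0 := fun m => by simp

lemma Homog.congr {m n : ℕ} (h : m % 2 = n % 2) {f : SuperPoly par} (hf : Homog par m f) :
    Homog par n f := fun k => by
  rw [hf k, neg_one_pow_congr (m := k * m) (n := k * n) (by simp [Nat.mul_mod, h])]

lemma Homog.add {n : ℕ} {f g : SuperPoly par} (hf : Homog par n f) (hg : Homog par n g) :
    Homog par n (f + g) := fun m => by simp [hf m, hg m]

lemma Homog.smul {n : ℕ} {f : SuperPoly par} (r : ℂ) (hf : Homog par n f) :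
    Homog par n (r • f) := fun m => by rw [map_smul, hf m, smul_comm]

lemma Homog.sub {n : ℕ} {f g : SuperPoly par} (hf : Homog par n f) (hg : Homog par n g) :
    Homog par n (f - g) := fun m => by simp [hf m, hg m, smul_sub]

lemma Homog.sum {ι : Type} {s : Finset ι} {n : ℕ} {f : ι → SuperPoly par}
    (hf : ∀ i ∈ s, Homog par n (f i)) : Homog par n (∑ i ∈ s, f i) := fun m => by
  rw [map_sum, Finset.smul_sum]
  exact Finset.sum_congr rfl fun i hi => hf i hi m

lemma Homog.mul {m n : ℕ} {f g : SuperPoly par} (hf : Homog par m f) (hg : Homog par n g) :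
    Homog par (m + n) (f * g) := fun k => by
  rw [map_mul, hf k, hg k, smul_mul_smul_comm, ← pow_add, mul_add]

lemma gen_mul_eq (x : X) (g : SuperPoly par) :
    WSuper.gen par x * g = twist par (par x) g * WSuper.gen par x := by
  induction g using superPoly_induction with
  | hc r => simp [Algebra.commutes]
  | hg y => rw [gen_mul_gen, twist_gen, smul_mul_assoc]
  | hm a b ha hb => rw [← mul_assoc, ha, mul_assoc, hb, map_mul, mul_assoc]
  | ha a b ha hb => rw [mul_add, ha, hb, map_add, add_mul]

/-- The automorphism `twist` carries the sign, so only one of the two factors has to be homogeneous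
and the other never has to be split into its even and odd parts. -/
lemma Homog.mul_comm_twist {n : ℕ} {g : SuperPoly par} (hg : Homog par n g) (f : SuperPoly par) :
    f * g = g * twist par n f := by
  induction f using superPoly_induction with
  | hc r => simp [Algebra.commutes]
  | hg x => rw [gen_mul_eq, hg, twist_gen, mul_smul_comm, smul_mul_assoc, mul_comm n]
  | hm a b ha hb => rw [mul_assoc, hb, ← mul_assoc, ha, map_mul, mul_assoc]
  | ha a b ha hb => rw [add_mul, ha, hb, map_add, mul_add]

lemma Homog.comm_twist {n : ℕ} {g : SuperPoly par} (hg : Homog par n g) (f : SuperPoly par) :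
    g * f = twist par n f * g := by
  rw [hg.mul_comm_twist, twist_self]

lemma Homog.comm {m n : ℕ} {f g : SuperPoly par} (hf : Homog par m f) (hg : Homog par n g) :
    f * g = (-1 : ℂ) ^ (m * n) • (g * f) := by
  rw [hg.mul_comm_twist, hf n, mul_smul_comm, mul_comm m]

section Derivatives

variable [DecidableEq X]

variable (par) in
/-- The left partial derivative as a linear map. -/
def leftDerivₗ (y : X) : SuperPoly par →ₗ[ℂ] SuperPoly par where
  toFun := leftDeriv par y
  map_add' f g := by simp [leftDeriv]
  map_smul' r f := by simp [leftDeriv]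

variable (par) in
/-- The right partial derivative as a linear map. -/
def rightDerivₗ (y : X) : SuperPoly par →ₗ[ℂ] SuperPoly par where
  toFun := rightDeriv par y
  map_add' f g := by simp [rightDeriv]
  map_smul' r f := by simp [rightDeriv]

lemma leftDeriv_add (y : X) (f g : SuperPoly par) :
    leftDeriv par y (f + g) = leftDeriv par y f + leftDeriv par y g := (leftDerivₗ par y).map_add f g

lemma leftDeriv_smul (y : X) (r : ℂ) (f : SuperPoly par) :
    leftDeriv par y (r • f) = r • leftDeriv par y f := (leftDerivₗ par y).map_smul r f

lemma rightDeriv_add (y : X) (f g : SuperPoly par) :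
    rightDeriv par y (f + g) = rightDeriv par y f + rightDeriv par y g :=
  (rightDerivₗ par y).map_add f g

lemma rightDeriv_smul (y : X) (r : ℂ) (f : SuperPoly par) :
    rightDeriv par y (r • f) = r • rightDeriv par y f := (rightDerivₗ par y).map_smul r f

lemma leftDeriv_algebraMap (y : X) (r : ℂ) : leftDeriv par y (algebraMap ℂ _ r) = 0 := by
  simp [leftDeriv, Matrix.algebraMap_matrix_apply]

lemma rightDeriv_algebraMap (y : X) (r : ℂ) : rightDeriv par y (algebraMap ℂ _ r) = 0 := by
  simp [rightDeriv, Matrix.algebraMap_matrix_apply]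

lemma twist_leftDeriv (m : ℕ) (y : X) (f : SuperPoly par) :
    twist par m (leftDeriv par y f) =
      (-1 : ℂ) ^ (m * par y) • leftDeriv par y (twist par m f) := by
  induction f using superPoly_induction with
  | hc r => simp [leftDeriv_algebraMap]
  | hg x =>
    rw [twist_gen, leftDeriv_smul, leftDeriv_gen]
    split_ifs with h
    · rw [h, smul_smul, neg_one_pow_mul_self]; simp
    · simp
  | hm a b ha hb =>
    rw [leftDeriv_mul, map_add, map_mul, map_mul, ha, hb, map_mul, leftDeriv_mul, signAut_eq_twist,
      twist_twist, twist_twist, add_comm m]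
    simp [smul_add]
  | ha a b ha hb => simp only [leftDeriv_add, map_add, ha, hb, smul_add]

lemma twist_rightDeriv (m : ℕ) (y : X) (f : SuperPoly par) :
    twist par m (rightDeriv par y f) =
      (-1 : ℂ) ^ (m * par y) • rightDeriv par y (twist par m f) := by
  induction f using superPoly_induction with
  | hc r => simp [rightDeriv_algebraMap]
  | hg x =>
    rw [twist_gen, rightDeriv_smul, rightDeriv_gen]
    split_ifs with h
    · rw [h, smul_smul, neg_one_pow_mul_self]; simp
    · simp
  | hm a b ha hb =>
    rw [rightDeriv_mul, map_add, map_mul, map_mul, ha, hb, map_mul, rightDeriv_mul,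
      signAut_eq_twist, twist_twist, twist_twist, add_comm m]
    simp [smul_add]
  | ha a b ha hb => simp only [rightDeriv_add, map_add, ha, hb, smul_add]

lemma Homog.leftDeriv {n : ℕ} {f : SuperPoly par} (hf : Homog par n f) (y : X) :
    Homog par (n + par y) (leftDeriv par y f) := fun m => by
  rw [twist_leftDeriv, hf m, leftDeriv_smul, smul_smul, mul_add, pow_add, mul_comm]

lemma Homog.rightDeriv {n : ℕ} {f : SuperPoly par} (hf : Homog par n f) (y : X) :
    Homog par (n + par y) (rightDeriv par y f) := fun m => by
  rw [twist_rightDeriv, hf m, rightDeriv_smul, smul_smul, mul_add, pow_add, mul_comm]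

end Derivatives

section Bracket

variable [DecidableEq X] [Fintype X]

variable (par) in
/-- The Poisson bracket as a bilinear map. -/
def poissonBracketₗ (br : X → X → SuperPoly par) :
    SuperPoly par →ₗ[ℂ] SuperPoly par →ₗ[ℂ] SuperPoly par :=
  LinearMap.mk₂ ℂ (poissonBracket par br)
    (fun f g h => by
      simp only [poissonBracket, rightDeriv_add, add_mul, Finset.sum_add_distrib])
    (fun r f g => by
      simp only [poissonBracket, rightDeriv_smul, smul_mul_assoc, Finset.smul_sum])
    (fun f g h => by
      simp only [poissonBracket, leftDeriv_add, mul_add, Finset.sum_add_distrib])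
    (fun r f g => by
      simp only [poissonBracket, leftDeriv_smul, mul_smul_comm, Finset.smul_sum])

lemma poissonBracket_algebraMap_left (br : X → X → SuperPoly par) (r : ℂ) (g : SuperPoly par) :
    poissonBracket par br (algebraMap ℂ _ r) g = 0 := by
  simp [poissonBracket, rightDeriv_algebraMap]

lemma poissonBracket_algebraMap_right (br : X → X → SuperPoly par) (r : ℂ) (f : SuperPoly par) :
    poissonBracket par br f (algebraMap ℂ _ r) = 0 := by
  simp [poissonBracket, leftDeriv_algebraMap]

variable {br : X → X → SuperPoly par}

/-- In moving `g` past the right derivative of `f` and past `br x y`, the parities of `x` and `y`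
occur twice each and cancel modulo 2. What is left is the parity of `f`. -/
lemma poissonBracket_mul_right (hbr : ∀ x y, Homog par (par x + par y) (br x y)) {m : ℕ}
    {f : SuperPoly par} (hf : Homog par m f) (g h : SuperPoly par) :
    poissonBracket par br f (g * h) =
      poissonBracket par br f g * h + twist par m g * poissonBracket par br f h := by
  simp only [poissonBracket, Finset.sum_mul, Finset.mul_sum, ← Finset.sum_add_distrib]
  refine Finset.sum_congr rfl fun x _ => Finset.sum_congr rfl fun y _ => ?_
  have hA := (hf.rightDeriv x).mul (hbr x y)
  rw [leftDeriv_mul, mul_add, ← mul_assoc, ← mul_assoc, hA.comm_twist (signAut par y g),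
    signAut_eq_twist, twist_twist,
      twist_congr par (m := m + par x + (par x + par y) + par y) (n := m) (by omega)]
  simp only [mul_assoc]

lemma poissonBracket_mul_left (hbr : ∀ x y, Homog par (par x + par y) (br x y)) {k : ℕ}
    {h : SuperPoly par} (hh : Homog par k h) (f g : SuperPoly par) :
    poissonBracket par br (f * g) h =
      f * poissonBracket par br g h + poissonBracket par br f h * twist par k g := by
  simp only [poissonBracket, Finset.sum_mul, Finset.mul_sum, ← Finset.sum_add_distrib]
  refine Finset.sum_congr rfl fun x _ => Finset.sum_congr rfl fun y _ => ?_
  have hA := (hbr x y).mul (hh.leftDeriv y)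
  rw [rightDeriv_mul, add_mul, add_mul, signAut_eq_twist, mul_assoc (_ * _) (br x y),
    mul_assoc (_ * _) (br x y), mul_assoc (rightDeriv par x f) (twist _ _ _),
    hA.mul_comm_twist (twist par (par x) g), twist_twist,
      twist_congr par (m := par x + par y + (k + par y) + par x) (n := k) (by omega)]
  simp only [mul_assoc]

lemma Homog.poissonBracket (hbr : ∀ x y, Homog par (par x + par y) (br x y)) {m n : ℕ}
    {f g : SuperPoly par} (hf : Homog par m f) (hg : Homog par n g) :
    Homog par (m + n) (poissonBracket par br f g) :=
  Homog.sum fun x _ => Homog.sum fun y _ =>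
    (((hf.rightDeriv x).mul (hbr x y)).mul (hg.leftDeriv y)).congr (by omega)

end Bracket

end SuperPolynomialTheory

/-! ### The principal `sl(2)` and the basis dual to the multiplets -/

section PrincipalTheory

variable (p : ℕ)

/-- The commutator with the lowering matrix. -/
def adLower : Module.End ℂ (Matrix (Fin p) (Fin p) ℂ) :=
  LinearMap.mulLeft ℂ (lower p) - LinearMap.mulRight ℂ (lower p)

lemma adLower_apply (A : Matrix (Fin p) (Fin p) ℂ) : adLower p A = lower p * A - A * lower p := rfl

lemma adLower_mul (A B : Matrix (Fin p) (Fin p) ℂ) :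
    adLower p (A * B) = adLower p A * B + A * adLower p B := by
  simp only [adLower_apply]
  noncomm_ring

lemma multiplet_eq (j : ℕ) (m : ℤ) :
    multiplet p j m = (adLower p ^ ((j : ℤ) - m).toNat) (raise p ^ j) := by
  rw [Module.End.pow_apply]
  rfl

lemma multiplet_pred {j : ℕ} {m : ℤ} (h : m ≤ j) :
    multiplet p j (m - 1) = adLower p (multiplet p j m) := by
  rw [multiplet_eq, multiplet_eq, ← Module.End.mul_apply, ← pow_succ',
    show ((j : ℤ) - (m - 1)).toNat = ((j : ℤ) - m).toNat + 1 by omega]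

lemma multiplet_top (j : ℕ) : multiplet p j j = raise p ^ j := by
  simp [multiplet_eq]

/-- The entries of the powers of the raising matrix. -/
def rise (i s : ℕ) : ℂ := ∏ t ∈ Finset.range s, ((i + t : ℂ) + 1) * ((p : ℂ) - 1 - (i + t))

variable {p}

lemma rise_succ_left (i s : ℕ) :
    rise p i (s + 1) = ((i : ℂ) + 1) * ((p : ℂ) - 1 - i) * rise p (i + 1) s := by
  rw [rise, rise, Finset.prod_range_succ', mul_comm]
  congr 1
  · simp
  · refine Finset.prod_congr rfl fun t _ => ?_
    push_cast
    ring

lemma rise_eq_zero {i s : ℕ} (hi : i < p) (h : p ≤ i + s) : rise p i s = 0 := by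
  -- The last factor vanishes at `t = p-1-i`, which is in the range because `p ≤ i+s`.
  refine Finset.prod_eq_zero (i := p - 1 - i) (by simp; omega) ?_
  have : ((p - 1 - i : ℕ) : ℂ) = (p : ℂ) - 1 - i := by
    rw [Nat.cast_sub (by omega), Nat.cast_sub (by omega)]; simp
  rw [this]
  ring

lemma rise_eq_choose {i s : ℕ} (h : i + s < p) :
    rise p i s = (((s.factorial) ^ 2 * ((i + s).choose s * (p - 1 - i).choose s) : ℕ) : ℂ) := by
  have h1 : rise p i s = (((i + 1).ascFactorial s * (p - 1 - i).descFactorial s : ℕ) : ℂ) := by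
    rw [Nat.ascFactorial_eq_prod_range, Nat.descFactorial_eq_prod_range, ← Finset.prod_mul_distrib,
      rise]
    push_cast
    refine Finset.prod_congr rfl fun t ht => ?_
    have ht := Finset.mem_range.1 ht
    rw [Nat.cast_sub (by omega), Nat.cast_sub (by omega), Nat.cast_sub (by omega)]
    push_cast
    ring
  rw [h1, Nat.ascFactorial_eq_factorial_mul_choose, Nat.descFactorial_eq_factorial_mul_choose]
  norm_cast
  ring

lemma raise_pow_apply (s : ℕ) (i k : Fin p) :
    (raise p ^ s) i k = if (k : ℕ) = i + s then rise p i s else 0 := by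
  induction s generalizing i with
  | zero => simp [rise, Matrix.one_apply, Fin.ext_iff, eq_comm]
  | succ s ih =>
    rw [pow_succ', Matrix.mul_apply]
    by_cases h : (i : ℕ) + 1 < p
    · rw [Finset.sum_eq_single ⟨i + 1, h⟩]
      · rw [ih, raise, Matrix.of_apply, if_pos rfl, rise_succ_left]
        simp only [mul_ite, mul_zero, add_assoc, add_comm s 1]
      · intro b _ hb
        rw [raise, Matrix.of_apply, if_neg (fun h' => hb (Fin.ext h')), zero_mul]
      · simp
    · rw [Finset.sum_eq_zero, if_neg (by omega)]
      intro b _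
      rw [raise, Matrix.of_apply, if_neg (by omega), zero_mul]

lemma lower_pow_apply (s : ℕ) (i k : Fin p) :
    (lower p ^ s) i k = if (i : ℕ) = k + s then 1 else 0 := by
  induction s generalizing k with
  | zero => simp [Matrix.one_apply, Fin.ext_iff]
  | succ s ih =>
    rw [pow_succ, Matrix.mul_apply]
    by_cases h : (k : ℕ) + 1 < p
    · rw [Finset.sum_eq_single ⟨k + 1, h⟩]
      · rw [ih, lower, Matrix.of_apply, if_pos rfl, mul_one]
        simp only [add_assoc, add_comm s 1]
      · intro b _ hb
        rw [lower, Matrix.of_apply, if_neg (fun h' => hb (Fin.ext h')), mul_zero]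
      · simp
    · rw [Finset.sum_eq_zero, if_neg (by omega)]
      intro b _
      rw [lower, Matrix.of_apply, if_neg (by omega), mul_zero]

variable (p) in
/-- Matrices supported on the diagonal of index `w`. -/
def HasWeight (w : ℤ) (A : Matrix (Fin p) (Fin p) ℂ) : Prop :=
  ∀ i k : Fin p, (k : ℤ) - i ≠ w → A i k = 0

lemma HasWeight.mul {v w : ℤ} {A B : Matrix (Fin p) (Fin p) ℂ} (hA : HasWeight p v A)
    (hB : HasWeight p w B) : HasWeight p (v + w) (A * B) := fun i k h => by
  rw [Matrix.mul_apply]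
  refine Finset.sum_eq_zero fun l _ => ?_
  by_cases h1 : (l : ℤ) - i = v
  · rw [hB l k (by omega), mul_zero]
  · rw [hA i l h1, zero_mul]

lemma HasWeight.trace_eq_zero {w : ℤ} {A : Matrix (Fin p) (Fin p) ℂ} (hA : HasWeight p w A)
    (hw : w ≠ 0) : A.trace = 0 :=
  Finset.sum_eq_zero fun i _ => hA i i (by omega)

lemma hasWeight_lower : HasWeight p (-1) (lower p) := fun i k h => by
  rw [lower, Matrix.of_apply, if_neg (by omega)]

lemma hasWeight_raise_pow (j : ℕ) : HasWeight p j (raise p ^ j) := fun i k h => by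
  rw [raise_pow_apply, if_neg (by omega)]

lemma hasWeight_multiplet {j : ℕ} {m : ℤ} (h : m ≤ j) : HasWeight p m (multiplet p j m) := by
  obtain ⟨n, rfl⟩ : ∃ n : ℕ, m = j - n := ⟨(j - m).toNat, by omega⟩
  clear h
  induction n with
  | zero => simpa [multiplet_top] using hasWeight_raise_pow j
  | succ n ih =>
    have : (j : ℤ) - (n + 1 : ℕ) = j - n - 1 := by push_cast; ring
    rw [this, multiplet_pred p (by omega), adLower_apply]
    intro i k hik
    rw [Matrix.sub_apply, (hasWeight_lower.mul ih) i k (by omega),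
      (ih.mul hasWeight_lower) i k (by omega), sub_zero]

lemma trace_adLower_mul (A B : Matrix (Fin p) (Fin p) ℂ) :
    (adLower p A * B).trace = -(A * adLower p B).trace := by
  simp only [adLower_apply, sub_mul, mul_sub, Matrix.trace_sub]
  rw [mul_assoc (lower p), Matrix.trace_mul_comm (lower p), mul_assoc, mul_assoc]
  ring

lemma trace_adLower_pow_mul (n : ℕ) (A B : Matrix (Fin p) (Fin p) ℂ) :
    ((adLower p ^ n) A * B).trace = (-1) ^ n * (A * (adLower p ^ n) B).trace := by
  induction n generalizing A with
  | zero => simp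
  | succ n ih =>
    have e : adLower p ((adLower p ^ n) B) = (adLower p ^ (n + 1)) B := by
      rw [pow_succ', Module.End.mul_apply]
    rw [pow_succ (adLower p), Module.End.mul_apply, ih, trace_adLower_mul, e,
      ← pow_succ (adLower p)]
    ring

/-- The first commutator is diagonal with entries `2i+1-p`. A second commutator multiplies the only
nonzero diagonal of `e_-` by the constant difference `-2` of neighbouring entries. -/
lemma adLower_sq_raise : adLower p (adLower p (raise p)) = (-2 : ℂ) • lower p := by
  have h1 : adLower p (raise p) =
      Matrix.diagonal fun i : Fin p => 2 * (i : ℂ) + 1 - p := by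
    ext i k
    have hl := lower_pow_apply (p := p) 1
    have hr := raise_pow_apply (p := p) 1
    rw [pow_one] at hl hr
    rw [adLower_apply, Matrix.sub_apply, Matrix.mul_apply, Matrix.mul_apply, Matrix.diagonal_apply]
    have e1 : ∑ l, lower p i l * raise p l k = if i = k then (i : ℂ) * (p - i) else 0 := by
      by_cases h : 1 ≤ (i : ℕ)
      · rw [Finset.sum_eq_single ⟨i - 1, by omega⟩]
        · rw [hl, hr, if_pos (by simp; omega), one_mul]
          simp only [Fin.ext_iff]
          by_cases hik : (i : ℕ) = k
          · rw [if_pos (by omega), if_pos hik]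
            have hc : ((i - 1 : ℕ) : ℂ) = (i : ℂ) - 1 := by rw [Nat.cast_sub h]; simp
            simp [rise, hc]
          · rw [if_neg (by omega), if_neg hik]
        · intro b _ hb
          rw [hl, if_neg (fun h' => hb (Fin.ext (by simp; omega))), zero_mul]
        · simp
      · have h0 : (i : ℕ) = 0 := by omega
        rw [Finset.sum_eq_zero fun b _ => by rw [hl, if_neg (by omega), zero_mul]]
        simp [h0]
    have e2 : ∑ l, raise p i l * lower p l k =
        if i = k then ((i : ℂ) + 1) * (p - 1 - i) else 0 := by
      by_cases h : (i : ℕ) + 1 < p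
      · rw [Finset.sum_eq_single ⟨i + 1, h⟩]
        · rw [hl, hr, if_pos rfl]
          simp [rise, Fin.ext_iff]
        · intro b _ hb
          rw [hr, if_neg (fun h' => hb (Fin.ext h')), zero_mul]
        · simp
      · have h0 : (p : ℂ) = i + 1 := by
          have : p = i + 1 := by omega
          exact_mod_cast this
        rw [Finset.sum_eq_zero fun b _ => by rw [hr, if_neg (by omega), zero_mul]]
        simp [h0]
    rw [e1, e2]
    split_ifs
    · ring
    · simp
  rw [h1, adLower_apply]
  ext i k
  rw [Matrix.sub_apply, Matrix.mul_diagonal, Matrix.diagonal_mul, Matrix.smul_apply, lower,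
    Matrix.of_apply]
  split_ifs with h
  · rw [h]
    push_cast
    simp only [smul_eq_mul]
    ring
  · simp

lemma adLower_cube_raise : adLower p (adLower p (adLower p (raise p))) = 0 := by
  rw [adLower_sq_raise, map_smul, adLower_apply, sub_self, smul_zero]

/-- The binomial Leibniz rule, which stops after three terms because the third commutator of `2e_+`
vanishes. -/
lemma adLower_pow_raise_mul (n : ℕ) (A : Matrix (Fin p) (Fin p) ℂ) :
    (adLower p ^ (n + 2)) (raise p * A) = raise p * (adLower p ^ (n + 2)) A +
      ((n + 2 : ℕ) : ℂ) • (adLower p (raise p) * (adLower p ^ (n + 1)) A) +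
      ((n + 2).choose 2 : ℂ) • (adLower p (adLower p (raise p)) * (adLower p ^ n) A) := by
  have hs : ∀ (k : ℕ) (B : Matrix (Fin p) (Fin p) ℂ),
      adLower p ((adLower p ^ k) B) = (adLower p ^ (k + 1)) B := fun k B => by
    rw [pow_succ', Module.End.mul_apply]
  induction n with
  | zero =>
    simp only [pow_succ', pow_zero, mul_one, Module.End.mul_apply, adLower_mul, map_add,
      Module.End.one_apply, zero_add, Nat.choose_self, Nat.cast_one, one_smul, Nat.cast_ofNat,
      two_smul]
    abel
  | succ n ih =>
    rw [← hs (n + 2), ih]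
    simp only [map_add, map_smul, adLower_mul, hs, adLower_cube_raise, zero_mul, zero_add]
    rw [show (n + 1 + 2).choose 2 = (n + 2) + (n + 2).choose 2 by
      rw [show n + 1 + 2 = (n + 2) + 1 by ring, Nat.choose_succ_succ]; simp]
    push_cast
    module

/-- The matrix `(2e_+)^k` is a highest weight vector of spin `k`: after `2k` steps it reaches the
lowest weight, one step later it dies. In the induction only the last term of the Leibniz rule
survives, and it contributes `-2 * (2k+2).choose 2 = -(2k+2)(2k+1)`. -/
lemma adLower_pow_raise_pow (k : ℕ) :
    (adLower p ^ (2 * k)) (raise p ^ k) = ((-1) ^ k * ((2 * k).factorial : ℂ)) • lower p ^ k ∧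
      (adLower p ^ (2 * k + 1)) (raise p ^ k) = 0 := by
  induction k with
  | zero => simp [adLower_apply]
  | succ k ih =>
    have h2 : ∀ n, 2 * k + 1 ≤ n → (adLower p ^ n) (raise p ^ k) = 0 := by
      intro n hn
      obtain ⟨r, rfl⟩ := Nat.exists_eq_add_of_le' hn
      rw [pow_add, Module.End.mul_apply, ih.2, map_zero]
    constructor
    · rw [show 2 * (k + 1) = 2 * k + 2 by ring, pow_succ' (raise p), adLower_pow_raise_mul,
        h2 _ (by omega), h2 _ (by omega), ih.1, adLower_sq_raise]
      simp only [mul_zero, smul_zero, zero_add, mul_smul_comm, smul_mul_assoc, smul_smul, pow_succ']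
      congr 1
      rw [Nat.factorial_succ, Nat.factorial_succ, Nat.cast_choose_two]
      push_cast
      ring
    · rw [show 2 * (k + 1) + 1 = (2 * k + 1) + 2 by ring, pow_succ' (raise p),
        adLower_pow_raise_mul, h2 _ (by omega), h2 _ (by omega), h2 _ (by omega)]
      simp

lemma adLower_pow_raise_pow_eq_zero {n k : ℕ} (h : 2 * k < n) :
    (adLower p ^ n) (raise p ^ k) = 0 := by
  obtain ⟨r, rfl⟩ := Nat.exists_eq_add_of_le' (Nat.succ_le_of_lt h)
  rw [pow_add, Module.End.mul_apply, (adLower_pow_raise_pow k).2, map_zero]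

/-- The trace is a sum of natural numbers, and the term `i = 0` is positive. -/
lemma trace_raise_mul_lower {j : ℕ} (hj : j < p) : (raise p ^ j * lower p ^ j).trace ≠ 0 := by
  have h : (raise p ^ j * lower p ^ j).trace = ((∑ i : Fin p, if (i : ℕ) + j < p then
      (j.factorial) ^ 2 * (((i : ℕ) + j).choose j * (p - 1 - i).choose j) else 0 : ℕ) : ℂ) := by
    rw [Matrix.trace]
    push_cast
    refine Finset.sum_congr rfl fun i _ => ?_
    rw [Matrix.diag_apply, Matrix.mul_apply]
    split_ifs with h
    · rw [Finset.sum_eq_single ⟨i + j, h⟩]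
      · rw [raise_pow_apply, lower_pow_apply, if_pos rfl, if_pos rfl, rise_eq_choose h]
        push_cast
        ring
      · intro b _ hb
        rw [raise_pow_apply, if_neg (fun h' => hb (Fin.ext h')), zero_mul]
      · simp
    · refine Finset.sum_eq_zero fun b _ => ?_
      rw [raise_pow_apply, if_neg (by omega), zero_mul]
  rw [h]
  refine Nat.cast_ne_zero.2 (Nat.pos_iff_ne_zero.1 ?_)
  refine Finset.sum_pos' (fun _ _ => Nat.zero_le _) ⟨⟨0, by omega⟩, Finset.mem_univ _, ?_⟩
  have h1 : 0 < (0 + j).choose j := Nat.choose_pos (by omega)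
  have h2 : 0 < (p - 1 - 0).choose j := Nat.choose_pos (by omega)
  simp only [zero_add, hj, if_true]
  have := Nat.factorial_pos j
  simp only [zero_add] at h1
  positivity

/-- If the weights do not cancel, the product has no diagonal. If they cancel and the spins differ,
the `j+k` commutators are all moved, by invariance of the trace form, onto the factor of smaller
spin, which is killed by more than twice its spin. -/
lemma trace_multiplet_mul_eq_zero {j k : ℕ} {m l : ℤ} (hm : m ≤ j) (hl : l ≤ k)
    (h : ¬(k = j ∧ l = -m)) : (multiplet p j m * multiplet p k l).trace = 0 := by
  by_cases hw : l = -m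
  · subst hw
    rw [multiplet_eq, multiplet_eq]
    have hjk : j ≠ k := fun e => h ⟨e.symm, rfl⟩
    rcases lt_or_gt_of_ne hjk with hlt | hlt
    · rw [Matrix.trace_mul_comm, trace_adLower_pow_mul, ← Module.End.mul_apply, ← pow_add,
        adLower_pow_raise_pow_eq_zero (by omega)]
      simp
    · rw [trace_adLower_pow_mul, ← Module.End.mul_apply, ← pow_add,
        adLower_pow_raise_pow_eq_zero (by omega)]
      simp
  · exact ((hasWeight_multiplet hm).mul (hasWeight_multiplet hl)).trace_eq_zero (by omega)

lemma trace_multiplet_mul_ne_zero {j : ℕ} {m : ℤ} (hj : j < p) (hm : m ≤ j) (hm' : -j ≤ m) :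
    (multiplet p j m * multiplet p j (-m)).trace ≠ 0 := by
  rw [multiplet_eq, multiplet_eq, trace_adLower_pow_mul, ← Module.End.mul_apply, ← pow_add,
    show ((j : ℤ) - m).toNat + ((j : ℤ) - -m).toNat = 2 * j by omega, (adLower_pow_raise_pow j).1,
    mul_smul_comm, Matrix.trace_smul]
  have h1 : ((2 * j).factorial : ℂ) ≠ 0 := Nat.cast_ne_zero.2 (Nat.factorial_ne_zero _)
  have h2 := trace_raise_mul_lower hj
  simp [h1, h2]

variable (p) in
/-- Indices of the basis `M_{jm}`, those with `m = j` listed apart. -/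
abbrev MIndex : Type := ((j : Fin p) × Finset.Ico (-((j : ℕ) : ℤ)) ((j : ℕ) : ℤ)) ⊕ Fin p

/-- The spin `j` of an index. -/
def MIndex.spin : MIndex p → Fin p
  | .inl c => c.1
  | .inr j => j

/-- The weight `m` of an index. -/
def MIndex.wt : MIndex p → ℤ
  | .inl c => c.2
  | .inr j => (j : ℕ)

lemma MIndex.wt_le (u : MIndex p) : u.wt ≤ (u.spin : ℕ) ∧ -((u.spin : ℕ) : ℤ) ≤ u.wt := by
  rcases u with ⟨j, m, hm⟩ | j
  · have := Finset.mem_Ico.1 hm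
    exact ⟨this.2.le, this.1⟩
  · simp [MIndex.spin, MIndex.wt]

lemma MIndex.ext {u v : MIndex p} (h1 : u.spin = v.spin) (h2 : u.wt = v.wt) : u = v := by
  rcases u with ⟨j, m, hm⟩ | j <;> rcases v with ⟨k, l, hl⟩ | k
  · simp only [MIndex.spin, MIndex.wt] at h1 h2
    subst h1 h2
    rfl
  · simp only [MIndex.spin, MIndex.wt] at h1 h2
    subst h1 h2
    simp at hm
  · simp only [MIndex.spin, MIndex.wt] at h1 h2
    subst h1 h2
    simp at hl
  · simp only [MIndex.spin] at h1
    rw [h1]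

lemma card_MIndex : Fintype.card (MIndex p) = Fintype.card (Fin p × Fin p) := by
  simp only [Fintype.card_sum, Fintype.card_sigma, Fintype.card_coe, Int.card_Ico, Fintype.card_fin,
    Fintype.card_prod]
  have : ∀ j : ℕ, ((j : ℤ) - -j).toNat = j * 2 := fun j => by omega
  simp only [this]
  rw [Fin.sum_univ_eq_sum_range (fun j => j * 2), ← Finset.sum_mul, Finset.sum_range_id_mul_two]
  rcases p with _ | p
  · rfl
  · simp; ring

variable (p) in
/-- The coefficients of the coordinate of index `(j,m)`. -/
def dualM (j : ℕ) (m : ℤ) : Matrix (Fin p) (Fin p) ℂ :=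
  ((multiplet p j m * multiplet p j (-m)).trace)⁻¹ • multiplet p j (-m)

lemma trace_dualM_mul (u v : MIndex p) :
    (multiplet p u.spin u.wt * dualM p v.spin v.wt).trace = if u = v then 1 else 0 := by
  rw [dualM, mul_smul_comm, Matrix.trace_smul]
  split_ifs with h
  · subst h
    exact inv_mul_cancel₀ (trace_multiplet_mul_ne_zero u.spin.2 u.wt_le.1 u.wt_le.2)
  · rw [trace_multiplet_mul_eq_zero u.wt_le.1 (by have := v.wt_le.2; omega), smul_zero]
    rintro ⟨h1, h2⟩
    exact h (MIndex.ext (Fin.ext h1.symm) (by omega))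

/-- Completeness follows from orthogonality: there are `p²` indices `(j,m)`, so a one-sided inverse
of the change of basis is two-sided. -/
lemma sum_multiplet_mul_dualM (i k i' k' : Fin p) :
    ∑ u : MIndex p, dualM p u.spin u.wt k i * multiplet p u.spin u.wt i' k' =
      if i = i' ∧ k = k' then 1 else 0 := by
  let P : Matrix (MIndex p) (Fin p × Fin p) ℂ :=
    Matrix.of fun u x => multiplet p u.spin u.wt x.1 x.2
  let Q : Matrix (Fin p × Fin p) (MIndex p) ℂ := Matrix.of fun x u => dualM p u.spin u.wt x.2 x.1
  have h : P * Q = 1 := by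
    ext u v
    rw [Matrix.one_apply, ← trace_dualM_mul, Matrix.mul_apply, Fintype.sum_prod_type, Matrix.trace]
    refine Finset.sum_congr rfl fun i _ => ?_
    rw [Matrix.diag_apply, Matrix.mul_apply]
    rfl
  have h' : Q * P = 1 := (Matrix.mul_eq_one_comm_of_card_eq _ _ _ card_MIndex).1 h
  have := congrFun (congrFun h' (i, k)) (i', k')
  rw [Matrix.mul_apply, Matrix.one_apply] at this
  simpa [P, Q, Prod.ext_iff] using this

section Coordinates

variable {B : Type} [Ring B] [Algebra ℂ B]

lemma coord_eq (j : ℕ) (m : ℤ) (A : Matrix (Fin p) (Fin p) B) :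
    coord p j m A = ∑ i, ∑ k, dualM p j m k i • A i k := by
  refine Finset.sum_congr rfl fun i _ => Finset.sum_congr rfl fun k _ => ?_
  rw [dualM, Matrix.smul_apply, smul_eq_mul, div_eq_inv_mul]

lemma coord_sub (j : ℕ) (m : ℤ) (A C : Matrix (Fin p) (Fin p) B) :
    coord p j m (A - C) = coord p j m A - coord p j m C := by
  simp only [coord_eq, Matrix.sub_apply, smul_sub, Finset.sum_sub_distrib]

lemma coord_map_algebraMap (j : ℕ) (m : ℤ) (A : Matrix (Fin p) (Fin p) ℂ) :
    coord p j m (A.map (algebraMap ℂ B)) = algebraMap ℂ B (A * dualM p j m).trace := by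
  rw [coord_eq, Matrix.trace, map_sum]
  refine Finset.sum_congr rfl fun i _ => ?_
  rw [Matrix.diag_apply, Matrix.mul_apply, map_sum]
  refine Finset.sum_congr rfl fun k _ => ?_
  rw [Matrix.map_apply, Algebra.smul_def, ← map_mul, mul_comm]

lemma sum_multiplet_smul_coord (A : Matrix (Fin p) (Fin p) B) (i k : Fin p) :
    ∑ u : MIndex p, multiplet p u.spin u.wt i k • coord p u.spin u.wt A = A i k := by
  simp only [coord_eq, Finset.smul_sum, smul_smul]
  rw [Finset.sum_comm]
  have : ∀ i', ∑ u : MIndex p, ∑ k', (multiplet p u.spin u.wt i k * dualM p u.spin u.wt k' i') •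
      A i' k' = ∑ k', (if i' = i ∧ k' = k then (1 : ℂ) else 0) • A i' k' := by
    intro i'
    rw [Finset.sum_comm]
    refine Finset.sum_congr rfl fun k' _ => ?_
    rw [← sum_multiplet_mul_dualM, Finset.sum_smul]
    simp only [mul_comm]
  simp only [this, ite_smul, one_smul, zero_smul, ite_and]
  simp

end Coordinates

lemma hasWeight_dualM {j : ℕ} {m : ℤ} (h : -m ≤ j) : HasWeight p (-m) (dualM p j m) :=
  fun i k hik => by
    rw [dualM, Matrix.smul_apply, hasWeight_multiplet h i k hik, smul_zero]

end PrincipalTheory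

/-! ### Inverting antitriangular matrices over a noncommutative ring -/

section AntiTriangular

variable {ι : Type} [Fintype ι] [DecidableEq ι] {B : Type} [Ring B]

/-- Each nonzero factor raises `f` by at least one. -/
lemma pow_apply_eq_zero_of_lt (f : ι → ℤ) (n : Matrix ι ι B) (hn : ∀ a b, f b ≤ f a → n a b = 0)
    (k : ℕ) (a b : ι) (h : f b < f a + k) : (n ^ k) a b = 0 := by
  induction k generalizing b with
  | zero => rw [pow_zero, Matrix.one_apply_ne]; rintro rfl; simp at h
  | succ k ih =>
    rw [pow_succ, Matrix.mul_apply]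
    refine Finset.sum_eq_zero fun c _ => ?_
    by_cases hc : f c < f a + k
    · rw [ih c hc, zero_mul]
    · rw [hn c b (by push_cast at h; omega), mul_zero]

lemma exists_pow_eq_zero (f : ι → ℤ) (n : Matrix ι ι B) (hn : ∀ a b, f b ≤ f a → n a b = 0) :
    ∃ k : ℕ, n ^ k = 0 := by
  -- This exponent exceeds every difference `f b - f a`.
  refine ⟨∑ a, (f a).natAbs + ∑ a, (f a).natAbs + 1, ?_⟩
  have hle : ∀ a, (f a).natAbs ≤ ∑ a, (f a).natAbs := fun a =>
    Finset.single_le_sum (f := fun a => (f a).natAbs) (fun _ _ => Nat.zero_le _) (Finset.mem_univ a)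
  ext a b
  have ha := hle a
  have hb := hle b
  rw [Matrix.zero_apply, pow_apply_eq_zero_of_lt f n hn _ a b]
  omega

/-- A matrix which is triangular with respect to an antidiagonal of units is invertible, and so is
triangular in the opposite sense its inverse. -/
lemma exists_inverse_of_antitriangular (f : ι → ℤ) (σ : ι → ι) (hσ : ∀ a, σ (σ a) = a)
    (hf : ∀ a, f (σ a) = -1 - f a) (D : Matrix ι ι B) (u : ι → Bˣ)
    (h1 : ∀ a b, f a + f b < -1 → D a b = 0)
    (h2 : ∀ a b, f a + f b = -1 → D a b = if b = σ a then (u a : B) else 0) :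
    ∃ V : Matrix ι ι B, D * V = 1 ∧ V * D = 1 ∧ ∀ a b, -1 < f a + f b → V a b = 0 := by
  -- `Q` is the antidiagonal part of `D` and `P` its inverse; multiplication by `P` turns
  -- antitriangular into unipotent triangular.
  let P : Matrix ι ι B := Matrix.of fun a b => if b = σ a then ((u b)⁻¹ : Bˣ) else 0
  let Q : Matrix ι ι B := Matrix.of fun a b => if b = σ a then (u a : B) else 0
  have hmulP : ∀ (C : Matrix ι ι B) a b, (P * C) a b = ((u (σ a))⁻¹ : Bˣ) * C (σ a) b := by
    intro C a b
    rw [Matrix.mul_apply, Finset.sum_eq_single (σ a)]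
    · simp [P]
    · intro c _ hc
      simp [P, hc]
    · simp
  have hmulQ : ∀ (C : Matrix ι ι B) a b, (Q * C) a b = (u a : B) * C (σ a) b := by
    intro C a b
    rw [Matrix.mul_apply, Finset.sum_eq_single (σ a)]
    · simp [Q]
    · intro c _ hc
      simp [Q, hc]
    · simp
  have hPQ : P * Q = 1 := by
    ext a b
    rw [hmulP, Matrix.one_apply]
    simp only [Q, Matrix.of_apply, hσ, eq_comm (a := b)]
    split_ifs <;> simp
  have hQP : Q * P = 1 := by
    ext a b
    rw [hmulQ, Matrix.one_apply]
    simp only [P, Matrix.of_apply, hσ, eq_comm (a := b)]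
    split_ifs with h
    · subst h; simp
    · simp
  -- This strictly raises `f`, hence is nilpotent, and a finite geometric series inverts `P * D`. No
  -- determinant is involved, as the entries need not commute.
  let n := P * D - 1
  have hn : ∀ a b, f b ≤ f a → n a b = 0 := by
    intro a b hab
    simp only [n, Matrix.sub_apply, hmulP]
    rcases hab.lt_or_eq with hlt | heq
    · rw [h1 _ _ (by rw [hf]; omega), Matrix.one_apply_ne (by rintro rfl; omega)]
      simp
    · rw [h2 _ _ (by rw [hf]; omega), hσ, Matrix.one_apply]
      simp only [eq_comm (a := b)]
      split_ifs <;> simp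
  obtain ⟨k, hk⟩ := exists_pow_eq_zero f n hn
  have hk' : (-n) ^ k = 0 := by rw [neg_pow, hk, mul_zero]
  let T := ∑ i ∈ Finset.range k, (-n) ^ i
  have hT1 : (P * D) * T = 1 := by
    have := mul_neg_geom_sum (-n) k
    rwa [hk', sub_zero, sub_neg_eq_add, show 1 + n = P * D by simp [n]] at this
  have hT2 : T * (P * D) = 1 := by
    have := geom_sum_mul_neg (-n) k
    rwa [hk', sub_zero, sub_neg_eq_add, show 1 + n = P * D by simp [n]] at this
  refine ⟨T * P, ?_, ?_, ?_⟩
  · calc D * (T * P) = (Q * P) * D * (T * P) := by rw [hQP, one_mul]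
      _ = Q * ((P * D) * T) * P := by noncomm_ring
      _ = 1 := by rw [hT1, mul_one, hQP]
  · rw [mul_assoc, hT2]
  -- The geometric series never lowers `f`, and `P` reflects `f` into `-1-f`; so the product is
  -- antitriangular in the opposite sense.
  · intro a b hab
    have hTa : ∀ a c, f c < f a → T a c = 0 := by
      intro a c hac
      simp only [T, Matrix.sum_apply]
      refine Finset.sum_eq_zero fun i _ => ?_
      refine pow_apply_eq_zero_of_lt f (-n) (fun a b h => ?_) i a c (by omega)
      rw [Matrix.neg_apply, hn a b h, neg_zero]
    rw [Matrix.mul_apply]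
    refine Finset.sum_eq_zero fun c _ => ?_
    by_cases hc : b = σ c
    · rw [hTa a c (by rw [hc, hf] at hab; omega), zero_mul]
    · simp [P, hc]

end AntiTriangular

/-! ### The constraint matrix `Δ` on the constraint surface -/

section Restriction

variable (M N p : ℕ)

lemma restrict_gen (x : JIndex M N p) :
    restrict M N p (gen (parJ M N p) x) = restrictGen M N p x := liftHom_gen _ _ _ _

lemma extend_gen (x : WIndex M N p) : extend M N p (gen (parW M N p) x) =
    coord p x.1 ((x.1 : ℕ) : ℤ) (blockJ M N p x.2.1 x.2.2) := liftHom_gen _ _ _ _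

/-- The bracket of the generators of `gl(Mp|Np)`, as a bilinear map. -/
def bracketJₗ : JAlg M N p →ₗ[ℂ] JAlg M N p →ₗ[ℂ] JAlg M N p :=
  poissonBracketₗ (parJ M N p) (glBracket M N p)

lemma bracketJₗ_apply (f g : JAlg M N p) : bracketJₗ M N p f g = bracketJ M N p f g := rfl

lemma bracketJ_gen (x y : JIndex M N p) :
    bracketJ M N p (gen _ x) (gen _ y) = glBracket M N p x y := poissonBracket_gen _ _ _ _

lemma homog_glBracket (x y : JIndex M N p) :
    Homog (parJ M N p) (parJ M N p x + parJ M N p y) (glBracket M N p x y) := by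
  refine Homog.sub ?_ (Homog.smul _ ?_)
  · split_ifs with h
    · refine (Homog.gen (x.1, y.2)).congr ?_
      simp only [parJ, h]
      omega
    · exact Homog.zero _
  · split_ifs with h
    · refine (Homog.gen (y.1, x.2)).congr ?_
      simp only [parJ, h]
      omega
    · exact Homog.zero _

lemma blockLower_congr {a b : Fin (M + N)} :
    blockLower M N p a b = (if a = b then (-1 : ℂ) ^ grade M N a else 0) • lower p := by
  rw [blockLower]
  split_ifs <;> simp

/-- The linear functional `A ↦ tr (C A)` on the block of index `(a,b)`, on the constraint
surface. -/
lemma sum_smul_restrictGen (C : Matrix (Fin p) (Fin p) ℂ) (a b : Fin (M + N)) :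
    ∑ i, ∑ k, C k i • restrictGen M N p ((a, i), (b, k)) =
      algebraMap ℂ _ ((if a = b then (-1 : ℂ) ^ grade M N a else 0) * (C * lower p).trace) +
      ∑ s : Fin p, (C * raise p ^ (s : ℕ)).trace • gen (parW M N p) (s, a, b) := by
  have h : ∀ A : Matrix (Fin p) (Fin p) ℂ, (C * A).trace = ∑ i, ∑ k, C k i * A i k := fun A => by
    rw [Finset.sum_comm]
    rfl
  simp only [restrictGen, smul_add, Finset.sum_add_distrib, blockLower_congr, Matrix.smul_apply,
    multiplet_top, Finset.smul_sum, smul_smul, h, Finset.sum_smul]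
  congr 1
  · simp only [Algebra.smul_def, ← map_mul, ← map_sum, Finset.mul_sum]
    simp only [mul_left_comm, Algebra.algebraMap_self, RingHom.id_apply]
  · rw [Finset.sum_comm]
    conv_rhs => rw [Finset.sum_comm]; enter [2, x]; rw [Finset.sum_comm]
    rw [Finset.sum_comm]

variable {M N p}

/-- The weight `m` of a constraint. -/
def CIndex.wt (α : CIndex M N p) : ℤ := α.1.2

/-- The coefficients of a constraint. -/
abbrev CIndex.mat (α : CIndex M N p) : Matrix (Fin p) (Fin p) ℂ := dualM p α.1.1 α.1.2

lemma CIndex.wt_bounds (α : CIndex M N p) :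
    -((α.1.1 : ℕ) : ℤ) ≤ α.wt ∧ α.wt < (α.1.1 : ℕ) := Finset.mem_Ico.1 α.1.2.2

lemma CIndex.hasWeight_mat (α : CIndex M N p) : HasWeight p (-α.wt) α.mat :=
  hasWeight_dualM (by have := α.wt_bounds; omega)

lemma CIndex.dual_mem (α : CIndex M N p) :
    -1 - α.wt ∈ Finset.Ico (-((α.1.1 : ℕ) : ℤ)) ((α.1.1 : ℕ) : ℤ) := by
  obtain ⟨h1, h2⟩ := α.wt_bounds
  exact Finset.mem_Ico.2 ⟨by linarith, by linarith⟩

/-- The index of the constraint paired with a given one by the matrix `Δ`. -/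
def CIndex.dual (α : CIndex M N p) : CIndex M N p :=
  (⟨α.1.1, -1 - α.wt, α.dual_mem⟩, α.2.2, α.2.1)

lemma CIndex.wt_dual (α : CIndex M N p) : α.dual.wt = -1 - α.wt := rfl

lemma CIndex.ext {α β : CIndex M N p} (h1 : α.1.1 = β.1.1) (h2 : α.wt = β.wt)
    (h3 : α.2.1 = β.2.1) (h4 : α.2.2 = β.2.2) : α = β := by
  obtain ⟨⟨j, m, hm⟩, a, b⟩ := α
  obtain ⟨⟨k, l, hl⟩, c, d⟩ := β
  simp only [CIndex.wt] at h1 h2 h3 h4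
  subst h1 h2 h3 h4
  rfl

lemma CIndex.dual_dual (α : CIndex M N p) : α.dual.dual = α :=
  CIndex.ext rfl (by simp only [CIndex.wt_dual]; ring) rfl rfl

lemma constraint_eq (α : CIndex M N p) : constraint M N p α =
    (∑ i, ∑ k, α.mat k i • gen (parJ M N p) ((α.2.1, i), (α.2.2, k))) -
      algebraMap ℂ _ (blockLower M N p α.2.1 α.2.2 * α.mat).trace := by
  rw [constraint, coord_sub, coord_map_algebraMap, coord_eq]
  rfl

lemma bracketJ_constraint_right (f : JAlg M N p) (α : CIndex M N p) :
    bracketJ M N p f (constraint M N p α) =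
      ∑ i, ∑ k, α.mat k i • bracketJ M N p f (gen (parJ M N p) ((α.2.1, i), (α.2.2, k))) := by
  have h : bracketJₗ M N p f (algebraMap ℂ _ (blockLower M N p α.2.1 α.2.2 * α.mat).trace) = 0 :=
    poissonBracket_algebraMap_right _ _ _
  rw [constraint_eq, ← bracketJₗ_apply, map_sub, h, sub_zero]
  simp only [map_sum, map_smul, bracketJₗ_apply]

lemma bracketJ_constraint_left (f : JAlg M N p) (α : CIndex M N p) :
    bracketJ M N p (constraint M N p α) f =
      ∑ i, ∑ k, α.mat k i • bracketJ M N p (gen (parJ M N p) ((α.2.1, i), (α.2.2, k))) f := by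
  have h : bracketJₗ M N p (algebraMap ℂ _ (blockLower M N p α.2.1 α.2.2 * α.mat).trace) f = 0 :=
    poissonBracket_algebraMap_left _ _ _
  rw [constraint_eq, ← bracketJₗ_apply, map_sub, LinearMap.sub_apply, h, sub_zero]
  simp only [map_sum, map_smul, LinearMap.sum_apply, LinearMap.smul_apply, bracketJₗ_apply]

lemma sum_smul_ite_left {B : Type} [AddCommMonoid B] [Module ℂ B] (F : Fin p → Fin p → B)
    (A C : Matrix (Fin p) (Fin p) ℂ) :
    ∑ i, ∑ k, A k i • ∑ i', ∑ k', C k' i' • (if i' = k then F i k' else 0) =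
      ∑ i, ∑ k, (C * A) k i • F i k := by
  refine Finset.sum_congr rfl fun i _ => ?_
  have h : ∀ k, ∑ i', ∑ k', C k' i' • (if i' = k then F i k' else 0) =
      ∑ k', C k' k • F i k' := fun k => by
    rw [Finset.sum_comm]
    simp
  simp only [h, Matrix.mul_apply, Finset.sum_smul, Finset.smul_sum, smul_smul]
  rw [Finset.sum_comm]
  simp only [mul_comm]

lemma sum_smul_ite_right {B : Type} [AddCommMonoid B] [Module ℂ B] (F : Fin p → Fin p → B)
    (A C : Matrix (Fin p) (Fin p) ℂ) :
    ∑ i, ∑ k, A k i • ∑ i', ∑ k', C k' i' • (if i = k' then F i' k else 0) =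
      ∑ i, ∑ k, (A * C) k i • F i k := by
  have h : ∀ i k, ∑ i', ∑ k', C k' i' • (if i = k' then F i' k else 0) =
      ∑ i', C i i' • F i' k := fun i k => by simp
  simp only [h, Matrix.mul_apply, Finset.sum_smul, Finset.smul_sum, smul_smul]
  conv_lhs =>
    rw [Finset.sum_comm]
    enter [2, k]
    rw [Finset.sum_comm]
  rw [Finset.sum_comm]

lemma constraintMatrix_apply (α β : CIndex M N p) : constraintMatrix M N p α β =
    (if β.2.1 = α.2.2 then ∑ i, ∑ k, (β.mat * α.mat) k i •
        restrictGen M N p ((α.2.1, i), (β.2.2, k)) else 0) -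
      (-1 : ℂ) ^ ((grade M N α.2.1 + grade M N α.2.2) * (grade M N β.2.1 + grade M N β.2.2)) •
        (if α.2.1 = β.2.2 then ∑ i, ∑ k, (α.mat * β.mat) k i •
          restrictGen M N p ((β.2.1, i), (α.2.2, k)) else 0) := by
  rw [constraintMatrix, Matrix.of_apply, bracketJ_constraint_left]
  simp only [bracketJ_constraint_right, bracketJ_gen, glBracket, map_sum, map_smul, map_sub,
    smul_sub, Finset.sum_sub_distrib, apply_ite (restrict M N p), restrict_gen, map_zero, parJ,
    Prod.mk.injEq, Finset.smul_sum]
  congr 1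
  · split_ifs with h
    · simp only [h, true_and, ← sum_smul_ite_left, Finset.smul_sum]
    · simp [h]
  · split_ifs with h
    · simp only [h, true_and, ← sum_smul_ite_right, Finset.smul_sum, smul_comm ((-1 : ℂ) ^ _)]
    · simp [h]

/-- The entry is a combination of traces of a matrix of weight greater than `1` with `e_-`, of
weight `-1`, and with the `(2e_+)^s`, of weight `s ≥ 0`. The weights never add up to zero. -/
lemma constraintMatrix_eq_zero {α β : CIndex M N p} (h : α.wt + β.wt < -1) :
    constraintMatrix M N p α β = 0 := by
  have h1 := β.hasWeight_mat.mul α.hasWeight_mat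
  have h2 := α.hasWeight_mat.mul β.hasWeight_mat
  have hz : ∀ {w : ℤ} {C : Matrix (Fin p) (Fin p) ℂ} (a b : Fin (M + N)), HasWeight p w C → 1 < w →
      ∑ i, ∑ k, C k i • restrictGen M N p ((a, i), (b, k)) = 0 := by
    intro w C a b hC hw
    rw [sum_smul_restrictGen, (hC.mul hasWeight_lower).trace_eq_zero (by omega), mul_zero, map_zero,
      zero_add]
    refine Finset.sum_eq_zero fun s _ => ?_
    rw [(hC.mul (hasWeight_raise_pow _)).trace_eq_zero (by omega), zero_smul]
  rw [constraintMatrix_apply, hz _ _ h1 (by omega), hz _ _ h2 (by omega)]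
  simp

/-- The coefficients of the coordinate `(j,m)` are proportional to `M_{j,-m}`, and one commutator
with `e_-` makes this `M_{j,-m-1}`. The trace form pairs it with `M_{j,m+1}` only, which belongs to
the coordinate of weight `-1-m`; the reflection `m ↦ -1-m` preserves the range `-j ≤ m < j` of the
constraints. -/
lemma trace_mat_mul_adLower (α β : CIndex M N p) :
    (β.mat * adLower p α.mat).trace ≠ 0 ↔ β.1 = α.dual.1 := by
  have hα := α.wt_bounds
  have hβ := β.wt_bounds
  have hwα : (α.1.2 : ℤ) = α.wt := rfl
  have hwβ : (β.1.2 : ℤ) = β.wt := rfl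
  have h0 : ∀ γ : CIndex M N p,
      (multiplet p γ.1.1 γ.wt * multiplet p γ.1.1 (-γ.wt)).trace ≠ 0 := fun γ =>
    trace_multiplet_mul_ne_zero γ.1.1.2 (by have := γ.wt_bounds; omega)
      (by have := γ.wt_bounds; omega)
  rw [CIndex.mat, CIndex.mat, dualM, dualM, map_smul, ← multiplet_pred p (by omega), hwα, hwβ,
    smul_mul_smul_comm, Matrix.trace_smul, smul_ne_zero_iff]
  have hne : ((multiplet p β.1.1 β.wt * multiplet p β.1.1 (-β.wt)).trace)⁻¹ *
      ((multiplet p α.1.1 α.wt * multiplet p α.1.1 (-α.wt)).trace)⁻¹ ≠ 0 :=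
    mul_ne_zero (inv_ne_zero (h0 β)) (inv_ne_zero (h0 α))
  simp only [hne, ne_eq, not_false_eq_true, true_and]
  constructor
  · intro h
    by_contra hne'
    refine h (trace_multiplet_mul_eq_zero (by omega) (by omega) ?_)
    rintro ⟨h1, h2⟩
    apply hne'
    have : β = (β.1, β.2) := rfl
    have e : (β.1, α.dual.2) = α.dual := CIndex.ext (Fin.ext h1.symm)
      (by simp only [CIndex.wt_dual]; change β.wt = _; omega) rfl rfl
    rw [← e]
  · intro h
    have hw : β.wt = -1 - α.wt := by
      rw [← CIndex.wt_dual, CIndex.wt, CIndex.wt, h]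
    have hj : β.1.1 = α.1.1 := by rw [h]; rfl
    have := h0 α.dual
    rw [CIndex.wt_dual] at this
    rw [Matrix.trace_mul_comm, hj, hw]
    have e : -α.wt - 1 = -1 - α.wt := by ring
    rw [e]
    exact this

/-- In total weight `1` only the constant part `e_-` of the slice contributes, so the entry is a
number. If both Kronecker deltas hold, the two terms combine into the trace of one matrix of
coefficients with the commutator of `e_-` with the other. If exactly one holds, the surviving block
is off the diagonal, where the constant part is zero. -/
lemma constraintMatrix_eq_ite {α β : CIndex M N p} (h : α.wt + β.wt = -1) :
    constraintMatrix M N p α β = algebraMap ℂ _ (if β = α.dual then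
      -((-1 : ℂ) ^ grade M N α.2.1 * (β.mat * adLower p α.mat).trace) else 0) := by
  have h1 := β.hasWeight_mat.mul α.hasWeight_mat
  have h2 := α.hasWeight_mat.mul β.hasWeight_mat
  have hz : ∀ {w : ℤ} {C : Matrix (Fin p) (Fin p) ℂ} (a b : Fin (M + N)), HasWeight p w C → w = 1 →
      ∑ i, ∑ k, C k i • restrictGen M N p ((a, i), (b, k)) = algebraMap ℂ _
        ((if a = b then (-1 : ℂ) ^ grade M N a else 0) * (C * lower p).trace) := by
    intro w C a b hC hw
    rw [sum_smul_restrictGen]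
    convert add_zero _
    refine Finset.sum_eq_zero fun s _ => ?_
    rw [(hC.mul (hasWeight_raise_pow _)).trace_eq_zero (by omega), zero_smul]
  rw [constraintMatrix_apply, hz _ _ h1 (by omega), hz _ _ h2 (by omega)]
  by_cases hb : β.2.1 = α.2.2
  · by_cases ha : α.2.1 = β.2.2
    · have ht : (β.mat * adLower p α.mat).trace =
          (α.mat * β.mat * lower p).trace - (β.mat * α.mat * lower p).trace := by
        rw [adLower_apply, mul_sub, Matrix.trace_sub, ← mul_assoc, ← mul_assoc,
          Matrix.trace_mul_cycle β.mat]
      have hs : (-1 : ℂ) ^ ((grade M N α.2.1 + grade M N α.2.2) *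
          (grade M N β.2.1 + grade M N β.2.2)) * (-1) ^ grade M N β.2.1 =
          (-1) ^ grade M N α.2.1 := by
        rw [hb, ← ha, ← pow_add]
        refine neg_one_pow_congr ?_
        rcases Nat.mod_two_eq_zero_or_one (grade M N α.2.1) with h | h <;>
          rcases Nat.mod_two_eq_zero_or_one (grade M N α.2.2) with h' | h' <;>
            simp [Nat.add_mod, Nat.mul_mod, h, h']
      have hd : (β = α.dual) ↔ β.1 = α.dual.1 :=
        ⟨fun h => by rw [h], fun h => Prod.ext h (Prod.ext hb ha.symm)⟩
      have hs' : (if β = α.dual then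
          -((-1 : ℂ) ^ grade M N α.2.1 * (β.mat * adLower p α.mat).trace) else 0) =
          -((-1 : ℂ) ^ grade M N α.2.1 * (β.mat * adLower p α.mat).trace) := by
        split_ifs with h0
        · rfl
        · rw [hd, ← trace_mat_mul_adLower, not_not] at h0
          simp [h0]
      rw [hs', if_pos hb, if_pos ha, if_pos ha, if_pos hb, Algebra.smul_def, ht, ← map_mul, ← mul_assoc,
        hs, ← map_sub]
      congr 1
      ring
    · have hβ : β ≠ α.dual := fun h => ha (by rw [h]; rfl)
      simp [ha, hβ]
  · have hβ : β ≠ α.dual := fun h => hb (by rw [h]; rfl)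
    simp [hb, hβ]

end Restriction

/-! ### Invertibility of `Δ` and the parity of its inverse -/

section SuperMatrices

variable {X : Type} {par : X → ℕ} {ι : Type} [Fintype ι] [DecidableEq ι]

/-- Twisting the entries of the inverse, with the expected signs divided out, gives another right
inverse; by uniqueness of inverses it is the same matrix. -/
lemma homog_inverse {g : ι → ℕ} {D V : Matrix ι ι (SuperPoly par)} (h1 : D * V = 1)
    (h2 : V * D = 1) (hD : ∀ a b, Homog par (g a + g b) (D a b)) (a b : ι) :
    Homog par (g a + g b) (V a b) := by
  intro m
  let V' : Matrix ι ι (SuperPoly par) :=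
    Matrix.of fun a b => (-1 : ℂ) ^ (m * (g a + g b)) • twist par m (V a b)
  have hV'_apply : ∀ a b, V' a b = (-1 : ℂ) ^ (m * (g a + g b)) • twist par m (V a b) :=
    fun _ _ => rfl
  have hV' : D * V' = 1 := by
    ext a b
    have h := congrFun (congrFun h1 a) b
    rw [Matrix.mul_apply] at h ⊢
    have hterm : ∀ c, D a c * V' c b =
        (-1 : ℂ) ^ (m * (g a + g b)) • twist par m (D a c * V c b) := by
      intro c
      rw [map_mul, hV'_apply, hD a c m, smul_mul_assoc, smul_smul, ← pow_add, mul_smul_comm]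
      congr 1
      refine neg_one_pow_congr ?_
      rw [show m * (g a + g b) + m * (g a + g c) =
        m * (g c + g b) + 2 * (m * g a) by ring]
      omega
    rw [Finset.sum_congr rfl fun c _ => hterm c, ← Finset.smul_sum, ← map_sum, h, Matrix.one_apply]
    split_ifs with hab
    · subst hab
      rw [map_one, (show Even (m * (g a + g a)) from (Even.add_self _).mul_left m).neg_one_pow,
        one_smul]
    · simp
  have : V' = V := by rw [← one_mul V', ← h2, mul_assoc, hV', mul_one]
  have h : V a b = (-1 : ℂ) ^ (m * (g a + g b)) • twist par m (V a b) := by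
    rw [← hV'_apply, this]
  conv_rhs => rw [h, smul_smul, neg_one_pow_mul_self, one_smul]

end SuperMatrices

section ConstraintMatrix

variable (M N p : ℕ)

lemma exists_inverse_constraintMatrix : ∃ V : Matrix (CIndex M N p) (CIndex M N p) (WAlg M N p),
    constraintMatrix M N p * V = 1 ∧ V * constraintMatrix M N p = 1 ∧
      ∀ α β, -1 < α.wt + β.wt → V α β = 0 := by
  have h0 : ∀ α : CIndex M N p, -((-1 : ℂ) ^ grade M N α.2.1 *
      (α.dual.mat * adLower p α.mat).trace) ≠ 0 := fun α =>
    neg_ne_zero.2 (mul_ne_zero (by simp) ((trace_mat_mul_adLower _ _).2 rfl))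
  refine exists_inverse_of_antitriangular CIndex.wt CIndex.dual CIndex.dual_dual CIndex.wt_dual _
    (fun α => Units.map (algebraMap ℂ (WAlg M N p)).toMonoidHom (Units.mk0 _ (h0 α)))
    (fun α β => constraintMatrix_eq_zero) fun α β h => ?_
  rw [constraintMatrix_eq_ite h]
  split_ifs with hβ
  · rw [hβ]; rfl
  · rw [map_zero]

theorem isUnit_constraintMatrix : IsUnit (constraintMatrix M N p) := by
  obtain ⟨V, h1, h2, -⟩ := exists_inverse_constraintMatrix M N p
  exact ⟨⟨_, V, h1, h2⟩, rfl⟩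

lemma constraintMatrix_mul_inverse :
    constraintMatrix M N p * Ring.inverse (constraintMatrix M N p) = 1 :=
  Ring.mul_inverse_cancel _ (isUnit_constraintMatrix M N p)

lemma inverse_mul_constraintMatrix :
    Ring.inverse (constraintMatrix M N p) * constraintMatrix M N p = 1 :=
  Ring.inverse_mul_cancel _ (isUnit_constraintMatrix M N p)

variable {M N p}

lemma inverse_constraintMatrix_eq_zero {α β : CIndex M N p} (h : -1 < α.wt + β.wt) :
    Ring.inverse (constraintMatrix M N p) α β = 0 := by
  obtain ⟨V, h1, h2, h3⟩ := exists_inverse_constraintMatrix M N p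
  have : Ring.inverse (constraintMatrix M N p) = V := by
    rw [← mul_one (Ring.inverse _), ← h1, ← mul_assoc, inverse_mul_constraintMatrix, one_mul]
  rw [this, h3 α β h]

lemma homog_algebraMap_ite (a b : Fin (M + N)) (r : ℂ) {X : Type} {par : X → ℕ}
    (h : a ≠ b → r = 0) : Homog par (grade M N a + grade M N b) (algebraMap ℂ _ r) := by
  by_cases hab : a = b
  · subst hab
    exact (Homog.algebraMap r).congr (by omega)
  · rw [h hab, map_zero]
    exact Homog.zero _

lemma homog_restrictGen (x : JIndex M N p) :
    Homog (parW M N p) (parJ M N p x) (restrictGen M N p x) := by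
  refine Homog.add (homog_algebraMap_ite _ _ _ fun h => ?_) (Homog.sum fun s _ => Homog.smul _ ?_)
  · simp [blockLower, h]
  · exact Homog.gen (par := parW M N p) (s, x.1.1, x.2.1)

lemma restrict_twist (m : ℕ) (f : JAlg M N p) :
    restrict M N p (twist _ m f) = twist _ m (restrict M N p f) := by
  refine superPoly_hom_ext _ (f := (restrict M N p).comp (twist _ m))
    (g := (twist _ m).comp (restrict M N p)) (fun x => ?_) f
  rw [AlgHom.comp_apply, AlgHom.comp_apply, twist_gen, map_smul, restrict_gen,
    homog_restrictGen x m]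

lemma Homog.restrict {n : ℕ} {f : JAlg M N p} (hf : Homog _ n f) :
    Homog (parW M N p) n (restrict M N p f) := fun m => by
  rw [← restrict_twist, hf m, map_smul]

lemma homog_coord_blockJ (j : ℕ) (m : ℤ) (a b : Fin (M + N)) :
    Homog (parJ M N p) (grade M N a + grade M N b) (coord p j m (blockJ M N p a b)) := by
  rw [coord_eq]
  exact Homog.sum fun i _ => Homog.sum fun k _ => Homog.smul _
    (Homog.gen (par := parJ M N p) ((a, i), (b, k)))

lemma Homog.extend {n : ℕ} {f : WAlg M N p} (hf : Homog _ n f) :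
    Homog (parJ M N p) n (extend M N p f) := by
  have h : ∀ (m : ℕ) (f : WAlg M N p),
      WSuper.extend M N p (twist _ m f) = twist _ m (WSuper.extend M N p f) := by
    intro m f
    refine superPoly_hom_ext _ (f := (WSuper.extend M N p).comp (twist _ m))
      (g := (twist _ m).comp (WSuper.extend M N p)) (fun x => ?_) f
    rw [AlgHom.comp_apply, AlgHom.comp_apply, twist_gen, map_smul, extend_gen,
      homog_coord_blockJ _ _ _ _ m]
    rfl
  intro m
  rw [← h, hf m, map_smul]

/-- The parity of a constraint. -/
abbrev CIndex.par (α : CIndex M N p) : ℕ := grade M N α.2.1 + grade M N α.2.2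

lemma homog_constraint (α : CIndex M N p) : Homog (parJ M N p) α.par (constraint M N p α) := by
  rw [constraint, coord_sub, coord_map_algebraMap]
  refine (homog_coord_blockJ _ _ _ _).sub (homog_algebraMap_ite _ _ _ fun h => ?_)
  simp [blockLower, h]

lemma Homog.bracketJ {m n : ℕ} {f g : JAlg M N p} (hf : Homog _ m f) (hg : Homog _ n g) :
    Homog _ (m + n) (bracketJ M N p f g) := hf.poissonBracket (homog_glBracket M N p) hg

lemma bracketJ_mul_left {k : ℕ} {h : JAlg M N p} (hh : Homog _ k h) (f g : JAlg M N p) :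
    bracketJ M N p (f * g) h =
      f * bracketJ M N p g h + bracketJ M N p f h * twist (parJ M N p) k g :=
  poissonBracket_mul_left (homog_glBracket M N p) hh f g

lemma bracketJ_mul_right {m : ℕ} {f : JAlg M N p} (hf : Homog _ m f) (g h : JAlg M N p) :
    bracketJ M N p f (g * h) =
      bracketJ M N p f g * h + twist (parJ M N p) m g * bracketJ M N p f h :=
  poissonBracket_mul_right (homog_glBracket M N p) hf g h

lemma homog_inverse_constraintMatrix (α β : CIndex M N p) :
    Homog (parW M N p) (α.par + β.par) (Ring.inverse (constraintMatrix M N p) α β) :=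
  homog_inverse (g := CIndex.par) (constraintMatrix_mul_inverse M N p)
    (inverse_mul_constraintMatrix M N p)
    (fun α β => ((homog_constraint α).bracketJ (homog_constraint β)).restrict) α β

end ConstraintMatrix

/-! ### The Dirac bracket and its independence of the extension off the surface -/

section Dirac

variable {M N p : ℕ}

variable (M N p) in
/-- The Dirac bracket of two functions of the generators of `gl(Mp|Np)`, on the constraint
surface. -/
def diracJ (f g : JAlg M N p) : WAlg M N p :=
  restrict M N p (bracketJ M N p f g) -
    ∑ α, ∑ β, restrict M N p (bracketJ M N p f (constraint M N p α)) *
      Ring.inverse (constraintMatrix M N p) α β *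
      restrict M N p (bracketJ M N p (constraint M N p β) g)

lemma diracBracket_eq (f g : WAlg M N p) :
    diracBracket M N p f g = diracJ M N p (extend M N p f) (extend M N p g) := rfl

variable (M N p) in
/-- The Dirac bracket as a bilinear map. -/
def diracJₗ : JAlg M N p →ₗ[ℂ] JAlg M N p →ₗ[ℂ] WAlg M N p :=
  LinearMap.mk₂ ℂ (diracJ M N p)
    (fun f g h => by
      simp only [diracJ, ← bracketJₗ_apply, map_add, LinearMap.add_apply, add_mul,
        Finset.sum_add_distrib]
      abel)
    (fun r f g => by
      simp only [diracJ, ← bracketJₗ_apply, map_smul, LinearMap.smul_apply, smul_mul_assoc,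
        ← Finset.smul_sum, smul_sub])
    (fun f g h => by
      simp only [diracJ, ← bracketJₗ_apply, map_add, mul_add, Finset.sum_add_distrib]
      abel)
    (fun r f g => by
      simp only [diracJ, ← bracketJₗ_apply, map_smul, mul_smul_comm, ← Finset.smul_sum, smul_sub])

lemma diracJₗ_apply (f g : JAlg M N p) : diracJₗ M N p f g = diracJ M N p f g := rfl

lemma diracJ_algebraMap_left (r : ℂ) (g : JAlg M N p) :
    diracJ M N p (algebraMap ℂ _ r) g = 0 := by
  simp [diracJ, bracketJ, poissonBracket_algebraMap_left]

lemma diracJ_algebraMap_right (r : ℂ) (f : JAlg M N p) :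
    diracJ M N p f (algebraMap ℂ _ r) = 0 := by
  simp [diracJ, bracketJ, poissonBracket_algebraMap_right]

/-- The first two factors of the correction term form the product of `Δ` with its inverse, so the
correction reproduces the Poisson bracket it is subtracted from. -/
lemma diracJ_constraint_left (α : CIndex M N p) (g : JAlg M N p) :
    diracJ M N p (constraint M N p α) g = 0 := by
  rw [diracJ, sub_eq_zero, Finset.sum_comm]
  have h : ∀ β, ∑ γ, restrict M N p (bracketJ M N p (constraint M N p α) (constraint M N p γ)) *
      Ring.inverse (constraintMatrix M N p) γ β = if α = β then 1 else 0 := fun β => by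
    rw [← Matrix.one_apply, ← constraintMatrix_mul_inverse, Matrix.mul_apply]
    rfl
  simp only [← Finset.sum_mul, h, ite_mul, one_mul, zero_mul, Finset.sum_ite_eq, Finset.mem_univ,
    if_true]

lemma diracJ_constraint_right (α : CIndex M N p) (f : JAlg M N p) :
    diracJ M N p f (constraint M N p α) = 0 := by
  rw [diracJ, sub_eq_zero]
  have h : ∀ γ, ∑ β, Ring.inverse (constraintMatrix M N p) γ β *
      restrict M N p (bracketJ M N p (constraint M N p β) (constraint M N p α)) =
      if γ = α then 1 else 0 := fun β => by
    rw [← Matrix.one_apply, ← inverse_mul_constraintMatrix, Matrix.mul_apply]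
    rfl
  simp only [mul_assoc, ← Finset.mul_sum, h, mul_ite, mul_one, mul_zero, Finset.sum_ite_eq',
    Finset.mem_univ, if_true]

/-- The correction term obeys the same Leibniz rule because the entries of `Δ⁻¹` are homogeneous:
the parities of the two constraints cancel in pairs when `g` is moved to the right. -/
lemma diracJ_mul_left {k : ℕ} {h : JAlg M N p} (hh : Homog _ k h) (f g : JAlg M N p) :
    diracJ M N p (f * g) h = restrict M N p f * diracJ M N p g h +
      diracJ M N p f h * twist _ k (restrict M N p g) := by
  simp only [diracJ]
  rw [bracketJ_mul_left hh, map_add, map_mul, map_mul,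
    restrict_twist, mul_sub, sub_mul, ← add_sub_add_comm]
  congr 1
  rw [Finset.mul_sum, Finset.sum_mul, ← Finset.sum_add_distrib]
  refine Finset.sum_congr rfl fun α _ => ?_
  rw [Finset.mul_sum, Finset.sum_mul, ← Finset.sum_add_distrib]
  refine Finset.sum_congr rfl fun β _ => ?_
  have hA := (homog_inverse_constraintMatrix α β).mul ((homog_constraint β).bracketJ hh).restrict
  rw [bracketJ_mul_left (homog_constraint α), map_add, map_mul,
    map_mul, restrict_twist, add_mul, add_mul, mul_assoc (_ * _) _ _, mul_assoc (_ * _) _ _,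
    mul_assoc _ (twist _ _ _), hA.mul_comm_twist (twist _ _ _), twist_twist,
    twist_congr _ (m := α.par + β.par + (β.par + k) + α.par) (n := k) (by omega)]
  simp only [mul_assoc]

lemma diracJ_mul_right {m : ℕ} {f : JAlg M N p} (hf : Homog _ m f) (g h : JAlg M N p) :
    diracJ M N p f (g * h) = diracJ M N p f g * restrict M N p h +
      twist _ m (restrict M N p g) * diracJ M N p f h := by
  simp only [diracJ]
  rw [bracketJ_mul_right hf, map_add, map_mul, map_mul,
    restrict_twist, mul_sub, sub_mul, ← add_sub_add_comm]
  congr 1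
  rw [Finset.mul_sum, Finset.sum_mul, ← Finset.sum_add_distrib]
  refine Finset.sum_congr rfl fun α _ => ?_
  rw [Finset.mul_sum, Finset.sum_mul, ← Finset.sum_add_distrib]
  refine Finset.sum_congr rfl fun β _ => ?_
  have hA := (hf.bracketJ (homog_constraint α)).restrict.mul (homog_inverse_constraintMatrix α β)
  rw [bracketJ_mul_right (homog_constraint β), map_add, map_mul,
    map_mul, restrict_twist, mul_add, ← mul_assoc, ← mul_assoc]
  rw [hA.comm_twist (twist _ _ _), twist_twist,
    twist_congr _ (m := m + α.par + (α.par + β.par) + β.par) (n := m) (by omega)]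
  simp only [mul_assoc]

lemma restrict_extend (f : WAlg M N p) : restrict M N p (extend M N p f) = f := by
  refine superPoly_hom_ext _ (f := (restrict M N p).comp (extend M N p)) (g := AlgHom.id ℂ _)
    (fun x => ?_) f
  obtain ⟨j, a, b⟩ := x
  have hw := hasWeight_dualM (p := p) (j := j) (m := (j : ℕ)) (by omega)
  have ht : ∀ s : Fin p, (dualM p j (j : ℕ) * raise p ^ (s : ℕ)).trace = if s = j then 1 else 0 := by
    intro s
    have := trace_dualM_mul (.inr s : MIndex p) (.inr j)
    rw [Matrix.trace_mul_comm, ← multiplet_top]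
    simpa [MIndex.spin, MIndex.wt] using this
  rw [AlgHom.comp_apply, extend_gen, coord_eq]
  simp only [map_sum, map_smul, blockJ, Matrix.of_apply, restrict_gen]
  rw [sum_smul_restrictGen, (hw.mul hasWeight_lower).trace_eq_zero (by omega)]
  simp [ht]

/-- Expand the block in the basis `M_{jm}`: the coordinates with `m = j` are the `W_j`, and all the
others are constraints up to a constant. -/
lemma gen_sub_extend_restrict (x : JIndex M N p) :
    ∃ (r : ℂ) (c : CIndex M N p → ℂ), gen (parJ M N p) x =
      extend M N p (restrict M N p (gen _ x)) + algebraMap ℂ _ r +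
        ∑ α, c α • constraint M N p α := by
  obtain ⟨⟨a, i⟩, ⟨b, k⟩⟩ := x
  have h := sum_multiplet_smul_coord (blockJ M N p a b) i k
  rw [Fintype.sum_sum_type] at h
  have hc : ∀ c, coord p (MIndex.spin (.inl c : MIndex p)) (MIndex.wt (.inl c : MIndex p))
      (blockJ M N p a b) = constraint M N p (c, a, b) +
        algebraMap ℂ _ (blockLower M N p a b * dualM p c.1 c.2).trace := by
    intro c
    rw [constraint, coord_sub, coord_map_algebraMap, sub_add_cancel]
    rfl
  refine ⟨(∑ c, multiplet p (MIndex.spin (.inl c : MIndex p)) (MIndex.wt (.inl c : MIndex p)) i k *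
      (blockLower M N p a b * dualM p c.1 c.2).trace) - blockLower M N p a b i k,
    fun α => if α.2 = (a, b) then multiplet p (MIndex.spin (.inl α.1 : MIndex p))
      (MIndex.wt (.inl α.1 : MIndex p)) i k else 0, ?_⟩
  have e : gen (parJ M N p) ((a, i), (b, k)) = blockJ M N p a b i k := rfl
  rw [restrict_gen, e, ← h, restrictGen, map_add, AlgHom.commutes, map_sum]
  simp only [hc, smul_add, Finset.sum_add_distrib, map_smul, extend_gen]
  have hs : ∑ α : CIndex M N p, (if α.2 = (a, b) then
      multiplet p (MIndex.spin (.inl α.1 : MIndex p)) (MIndex.wt (.inl α.1 : MIndex p)) i k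
      else 0) • constraint M N p α =
      ∑ c, multiplet p (MIndex.spin (.inl c : MIndex p)) (MIndex.wt (.inl c : MIndex p)) i k •
        constraint M N p (c, a, b) := by
    rw [Fintype.sum_prod_type]
    exact Finset.sum_congr rfl fun c _ => by simp
  rw [hs]
  simp only [Algebra.smul_def, ← map_mul, map_sub, map_sum, MIndex.spin, MIndex.wt]
  abel

/-- On generators the two arguments differ by a constant and constraints, all invisible to the Dirac
bracket; the Leibniz rule propagates this to products. Thus any function with the right restriction
may be used to compute Dirac brackets. -/
lemma diracJ_extend_restrict_left {k : ℕ} {h : JAlg M N p} (hh : Homog _ k h) (f : JAlg M N p) :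
    diracJ M N p (extend M N p (restrict M N p f)) h = diracJ M N p f h := by
  induction f using superPoly_induction with
  | hc r => rw [AlgHom.commutes, AlgHom.commutes]
  | hg x =>
    obtain ⟨r, c, hx⟩ := gen_sub_extend_restrict x
    conv_rhs => rw [hx, ← diracJₗ_apply, map_add, map_add, LinearMap.add_apply,
      LinearMap.add_apply, map_sum, LinearMap.sum_apply]
    simp [diracJₗ_apply, diracJ_algebraMap_left, diracJ_constraint_left]
  | hm f g hf hg => rw [map_mul, map_mul, diracJ_mul_left hh, diracJ_mul_left hh, hf, hg,
      restrict_extend, restrict_extend]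
  | ha f g hf hg =>
    simp only [← diracJₗ_apply, map_add, LinearMap.add_apply] at *
    rw [hf, hg]

lemma diracJ_extend_restrict_right {m : ℕ} {f : JAlg M N p} (hf : Homog _ m f) (g : JAlg M N p) :
    diracJ M N p f (extend M N p (restrict M N p g)) = diracJ M N p f g := by
  induction g using superPoly_induction with
  | hc r => rw [AlgHom.commutes, AlgHom.commutes]
  | hg x =>
    obtain ⟨r, c, hx⟩ := gen_sub_extend_restrict x
    conv_rhs => rw [hx, ← diracJₗ_apply, map_add, map_add, map_sum]
    simp [diracJₗ_apply, diracJ_algebraMap_right, diracJ_constraint_right]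
  | hm g h hg hh => rw [map_mul, map_mul, diracJ_mul_right hf, diracJ_mul_right hf, hg, hh,
      restrict_extend, restrict_extend]
  | ha g h hg hh =>
    simp only [← diracJₗ_apply, map_add] at *
    rw [hg, hh]

/-- The Dirac bracket of functions which commute with the constraints of negative weight. -/
theorem diracBracket_restrict {m n : ℕ} {f g : JAlg M N p} (hf : Homog _ m f) (hg : Homog _ n g)
    (hf' : ∀ α : CIndex M N p, α.wt < 0 → bracketJ M N p f (constraint M N p α) = 0)
    (hg' : ∀ α : CIndex M N p, α.wt < 0 → bracketJ M N p (constraint M N p α) g = 0) :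
    diracBracket M N p (restrict M N p f) (restrict M N p g) =
      restrict M N p (bracketJ M N p f g) := by
  rw [diracBracket_eq, diracJ_extend_restrict_left hg.restrict.extend,
    diracJ_extend_restrict_right hf, diracJ, sub_eq_self]
  -- A negative weight kills one of the outer brackets; two nonnegative weights add up to more than
  -- `-1`, where the inverse of `Δ` vanishes.
  refine Finset.sum_eq_zero fun α _ => Finset.sum_eq_zero fun β _ => ?_
  by_cases hα : α.wt < 0
  · rw [hf' α hα, map_zero, zero_mul, zero_mul]
  by_cases hβ : β.wt < 0
  · rw [hg' β hβ, map_zero, mul_zero]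
  rw [inverse_constraintMatrix_eq_zero (by omega), mul_zero, zero_mul]

variable (M N p) in
/-- The Dirac bracket on `W_p(M|N)` as a bilinear map. -/
def diracBracketₗ : WAlg M N p →ₗ[ℂ] WAlg M N p →ₗ[ℂ] WAlg M N p :=
  (diracJₗ M N p).compl₁₂ (extend M N p).toLinearMap (extend M N p).toLinearMap

lemma diracBracketₗ_apply (f g : WAlg M N p) :
    diracBracketₗ M N p f g = diracBracket M N p f g := rfl

lemma diracBracket_mul_left {k : ℕ} {h : WAlg M N p} (hh : Homog _ k h) (f g : WAlg M N p) :
    diracBracket M N p (f * g) h =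
      f * diracBracket M N p g h + diracBracket M N p f h * twist _ k g := by
  simp only [diracBracket_eq, map_mul]
  rw [diracJ_mul_left hh.extend, restrict_extend, restrict_extend]

lemma diracBracket_mul_right {m : ℕ} {f : WAlg M N p} (hf : Homog _ m f) (g h : WAlg M N p) :
    diracBracket M N p f (g * h) =
      diracBracket M N p f g * h + twist _ m g * diracBracket M N p f h := by
  simp only [diracBracket_eq, map_mul]
  rw [diracJ_mul_right hf.extend, restrict_extend, restrict_extend]

end Dirac

/-! ### Signs in the brackets of products of even matrices -/

section EvenMatrices

variable {X : Type} {par : X → ℕ} {ι : Type} (g : ι → ℕ)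

/-- Matrices whose entry of index `ab` has parity `[a] + [b]`. -/
def EvenMat (C : Matrix ι ι (SuperPoly par)) : Prop := ∀ a b, Homog par (g a + g b) (C a b)

variable {g}

lemma EvenMat.one [DecidableEq ι] : EvenMat g (1 : Matrix ι ι (SuperPoly par)) := fun a b => by
  by_cases h : a = b
  · subst h
    rw [Matrix.one_apply_eq]
    exact Homog.one.congr (by omega)
  · rw [Matrix.one_apply_ne h]
    exact Homog.zero _

lemma EvenMat.mul [Fintype ι] {C D : Matrix ι ι (SuperPoly par)} (hC : EvenMat g C)
    (hD : EvenMat g D) : EvenMat g (C * D) := fun a b => by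
  rw [Matrix.mul_apply]
  exact Homog.sum fun c _ => ((hC a c).mul (hD c b)).congr (by omega)

lemma EvenMat.pow [Fintype ι] [DecidableEq ι] {C : Matrix ι ι (SuperPoly par)} (hC : EvenMat g C)
    (n : ℕ) : EvenMat g (C ^ n) := by
  induction n with
  | zero => rw [pow_zero]; exact EvenMat.one
  | succ n ih => rw [pow_succ]; exact ih.mul hC

lemma EvenMat.smul {C : Matrix ι ι (SuperPoly par)} (r : ℂ) (hC : EvenMat g C) :
    EvenMat g (r • C) := fun a b => (hC a b).smul r

lemma EvenMat.zero : EvenMat g (0 : Matrix ι ι (SuperPoly par)) := fun _ _ => Homog.zero _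

lemma EvenMat.sub {C D : Matrix ι ι (SuperPoly par)} (hC : EvenMat g C) (hD : EvenMat g D) :
    EvenMat g (C - D) := fun a b => (hC a b).sub (hD a b)

lemma EvenMat.sum {κ : Type} {s : Finset κ} {C : κ → Matrix ι ι (SuperPoly par)}
    (hC : ∀ i ∈ s, EvenMat g (C i)) : EvenMat g (∑ i ∈ s, C i) := fun a b => by
  rw [Matrix.sum_apply]
  exact Homog.sum fun i hi => hC i hi a b

variable (g) in
/-- The sign `(-1)^{[c]([a]+[b])+[a][b]}`. -/
def pairSign (a b c : ι) : ℂ := (-1) ^ (g c * (g a + g b) + g a * g b)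

lemma pairSign_mul_self (a b c : ι) : pairSign g a b c * pairSign g a b c = 1 :=
  neg_one_pow_mul_self _

lemma pairSign_smul_smul {V : Type} [AddCommGroup V] [Module ℂ V] (a b c : ι) (v : V) :
    pairSign g a b c • pairSign g a b c • v = v := by
  rw [smul_smul, pairSign_mul_self, one_smul]

variable [Fintype ι]

/-- The bracket `{f,·}` with an element of parity `[a] + [b]` is, up to signs, a derivation on
even matrices. -/
lemma pairSign_smul_mul {F : SuperPoly par →ₗ[ℂ] SuperPoly par} {a b : ι}
    (hF : ∀ f h, F (f * h) = F f * h + twist par (g a + g b) f * F h)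
    {C : Matrix ι ι (SuperPoly par)} (hC : EvenMat g C) (D : Matrix ι ι (SuperPoly par)) (c d : ι) :
    pairSign g a b c • F ((C * D) c d) =
      ∑ e, (pairSign g a b c • F (C c e)) * D e d +
        ∑ e, C c e * (pairSign g a b e • F (D e d)) := by
  rw [Matrix.mul_apply, map_sum, Finset.smul_sum, ← Finset.sum_add_distrib]
  refine Finset.sum_congr rfl fun e _ => ?_
  rw [hF, hC c e, smul_add, smul_mul_assoc, smul_mul_assoc, smul_smul, mul_smul_comm]
  congr 2
  rw [pairSign, pairSign, ← pow_add]
  refine neg_one_pow_congr ?_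
  rw [show g c * (g a + g b) + g a * g b + (g a + g b) * (g c + g e) =
    g e * (g a + g b) + g a * g b + 2 * (g c * (g a + g b)) by ring]
  omega

variable [DecidableEq ι]

/-- Brackets of products, from the left. -/
lemma bracket_mul_left_formula {F : SuperPoly par →ₗ[ℂ] SuperPoly par} {c d : ι}
    (hF : ∀ f h, F (f * h) = f * F h + F f * twist par (g c + g d) h)
    {κ : Type} {I : Finset κ} {L K : κ → Matrix ι ι (SuperPoly par)}
    {P Q C : Matrix ι ι (SuperPoly par)} (hL : ∀ i, EvenMat g (L i)) (hK : ∀ i, EvenMat g (K i))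
    (hPe : EvenMat g P) (hQe : EvenMat g Q) (hC : EvenMat g C)
    (hP : ∀ a b, F (P a b) = pairSign g a b c • ∑ i ∈ I, (L i c b * K i a d - K i c b * L i a d))
    (hQ : ∀ a b, F (Q a b) = pairSign g a b c •
      ((1 : Matrix ι ι (SuperPoly par)) c b * C a d -
        C c b * (1 : Matrix ι ι (SuperPoly par)) a d)) (a b : ι) :
    F ((P * Q) a b) = pairSign g a b c •
      ((1 : Matrix ι ι (SuperPoly par)) c b * (P * C) a d - C c b * P a d +
        ∑ i ∈ I, ((L i * Q) c b * K i a d - (K i * Q) c b * L i a d)) := by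
  -- Commuting `P a e` past `U c b` costs exactly the sign that replaces `e` by `a` in `pairSign`,
  -- so the summation over `e` becomes a matrix product. In `h2` the same happens for `Q e b`, the
  -- sign of the twist included.
  have h1 : ∀ {U V : Matrix ι ι (SuperPoly par)}, EvenMat g U → ∀ e,
      P a e * (pairSign g e b c • (U c b * V e d)) =
        pairSign g a b c • (U c b * (P a e * V e d)) := by
    intro U V hU e
    rw [mul_smul_comm, ← mul_assoc, (hPe a e).comm (hU c b), smul_mul_assoc, smul_smul, mul_assoc]
    congr 1
    rw [pairSign, pairSign, ← pow_add]
    refine neg_one_pow_congr ?_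
    rw [show g c * (g e + g b) + g e * g b + (g a + g e) * (g c + g b) =
      g c * (g a + g b) + g a * g b + 2 * (g c * g e + g e * g b) by ring]
    omega
  have h2 : ∀ {U V : Matrix ι ι (SuperPoly par)}, EvenMat g V → ∀ e,
      (pairSign g a e c • (U c e * V a d)) * twist par (g c + g d) (Q e b) =
        pairSign g a b c • ((U c e * Q e b) * V a d) := by
    intro U V hV e
    rw [hQe e b, mul_smul_comm, smul_mul_assoc, smul_smul, mul_assoc, (hV a d).comm (hQe e b),
      mul_smul_comm, smul_smul, ← mul_assoc]
    congr 1
    rw [pairSign, pairSign, ← pow_add, ← pow_add]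
    refine neg_one_pow_congr ?_
    rw [show (g c + g d) * (g e + g b) + (g c * (g a + g e) + g a * g e) +
      (g a + g d) * (g e + g b) = g c * (g a + g b) + g a * g b +
        2 * (g c * g e + g d * (g e + g b) + g a * g e) by ring]
    omega
  rw [Matrix.mul_apply, map_sum]
  have h3 : ∀ e, F (P a e * Q e b) =
      pairSign g a b c • ((1 : Matrix ι ι (SuperPoly par)) c b * (P a e * C e d) -
        C c b * (P a e * (1 : Matrix ι ι (SuperPoly par)) e d) +
        ∑ i ∈ I, ((L i c e * Q e b) * K i a d - (K i c e * Q e b) * L i a d)) := by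
    intro e
    rw [hF, hQ, hP, smul_sub, mul_sub, h1 EvenMat.one, h1 hC, smul_add, smul_sub, Finset.smul_sum,
      Finset.sum_mul, Finset.smul_sum]
    congr 1
    refine Finset.sum_congr rfl fun i _ => ?_
    rw [smul_sub, sub_mul, h2 (hK i), h2 (hL i), smul_sub]
  simp only [h3, ← Finset.smul_sum, Finset.sum_add_distrib, Finset.sum_sub_distrib,
    ← Finset.mul_sum, ← Matrix.mul_apply, mul_one]
  congr 2
  rw [Finset.sum_comm, Finset.sum_comm (s := Finset.univ) (t := I)]
  simp only [← Finset.sum_mul, ← Matrix.mul_apply]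

end EvenMatrices

/-! ### Brackets of powers of the matrix of generators of `gl(Mp|Np)` -/

section BracketOfPowers

variable (M N p : ℕ)

/-- The parities of the indices of `gl(Mp|Np)`. -/
def gradeJ (A : Fin (M + N) × Fin p) : ℕ := grade M N A.1

/-- The matrix of the `(-1)^{[B]} J^{AB}`. -/
def matJ : Matrix (Fin (M + N) × Fin p) (Fin (M + N) × Fin p) (JAlg M N p) :=
  Matrix.of fun A B => (-1 : ℂ) ^ gradeJ M N p B • gen (parJ M N p) (A, B)

variable {M N p}

lemma matJ_apply (A B : Fin (M + N) × Fin p) :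
    matJ M N p A B = (-1 : ℂ) ^ gradeJ M N p B • gen (parJ M N p) (A, B) := rfl

lemma evenMat_matJ : EvenMat (gradeJ M N p) (matJ M N p) := fun A B =>
  (Homog.gen (par := parJ M N p) (A, B)).smul _

lemma bracketJ_matJ (A B C D : Fin (M + N) × Fin p) :
    bracketJ M N p (matJ M N p A B) (matJ M N p C D) = pairSign (gradeJ M N p) A B C •
      ((1 : Matrix _ _ (JAlg M N p)) C B * matJ M N p A D -
        matJ M N p C B * (1 : Matrix _ _ (JAlg M N p)) A D) := by
  rw [matJ_apply, matJ_apply, ← bracketJₗ_apply, map_smul, map_smul, LinearMap.smul_apply,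
    bracketJₗ_apply, bracketJ_gen, glBracket, Matrix.one_apply, Matrix.one_apply, matJ_apply,
    matJ_apply, pairSign, smul_sub, smul_sub, smul_sub]
  congr 1
  · split_ifs with h
    · subst h
      rw [one_mul, smul_smul, smul_smul]
      congr 1
      rw [← pow_add, ← pow_add]
      refine neg_one_pow_congr ?_
      dsimp only
      rcases Nat.mod_two_eq_zero_or_one (gradeJ M N p A) with h | h <;>
        rcases Nat.mod_two_eq_zero_or_one (gradeJ M N p C) with h' | h' <;>
          rcases Nat.mod_two_eq_zero_or_one (gradeJ M N p D) with h'' | h'' <;>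
            simp [Nat.add_mod, Nat.mul_mod, h, h', h'']
    · simp
  · split_ifs with h
    · subst h
      rw [mul_one, smul_smul, smul_smul, smul_smul]
      congr 1
      rw [← pow_add, ← pow_add, ← pow_add]
      refine neg_one_pow_congr ?_
      change (gradeJ M N p A + gradeJ M N p B + (gradeJ M N p A + gradeJ M N p B) *
        (gradeJ M N p C + gradeJ M N p A)) % 2 = _
      rcases Nat.mod_two_eq_zero_or_one (gradeJ M N p A) with h | h <;>
        rcases Nat.mod_two_eq_zero_or_one (gradeJ M N p B) with h' | h' <;>
          rcases Nat.mod_two_eq_zero_or_one (gradeJ M N p C) with h'' | h'' <;>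
            simp [Nat.add_mod, Nat.mul_mod, h, h', h'']
    · simp

lemma bracketJ_matJ_pow (l : ℕ) (A B C D : Fin (M + N) × Fin p) :
    bracketJ M N p (matJ M N p A B) ((matJ M N p ^ l) C D) = pairSign (gradeJ M N p) A B C •
      ((1 : Matrix _ _ (JAlg M N p)) C B * (matJ M N p ^ l) A D -
        (matJ M N p ^ l) C B * (1 : Matrix _ _ (JAlg M N p)) A D) := by
  have hF : ∀ f h, bracketJₗ M N p (matJ M N p A B) (f * h) =
      bracketJₗ M N p (matJ M N p A B) f * h + twist (parJ M N p)
        (gradeJ M N p A + gradeJ M N p B) f * bracketJₗ M N p (matJ M N p A B) h :=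
    bracketJ_mul_right (evenMat_matJ A B)
  -- Up to `pairSign`, the bracket with `matJ A B` is the commutator with this matrix unit. Both are
  -- derivations on even matrices, so agreement passes from the matrix to its powers.
  let e : Matrix (Fin (M + N) × Fin p) (Fin (M + N) × Fin p) (JAlg M N p) := Matrix.single B A 1
  have he : ∀ (K : Matrix _ _ (JAlg M N p)) C D,
      (1 : Matrix _ _ (JAlg M N p)) C B * K A D - K C B * (1 : Matrix _ _ (JAlg M N p)) A D =
        (e * K - K * e) C D := by
    intro K C D
    rw [Matrix.sub_apply, Matrix.mul_apply, Matrix.mul_apply]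
    simp [e, Matrix.single_apply, Matrix.one_apply, ite_and, eq_comm]
  have key : ∀ C D, pairSign (gradeJ M N p) A B C •
      bracketJₗ M N p (matJ M N p A B) ((matJ M N p ^ l) C D) =
        (e * matJ M N p ^ l - matJ M N p ^ l * e) C D := by
    induction l with
    | zero =>
      intro C D
      have h1 : bracketJₗ M N p (matJ M N p A B) 1 = 0 := by
        rw [← map_one (algebraMap ℂ _)]
        exact poissonBracket_algebraMap_right _ _ _
      rw [pow_zero, mul_one, one_mul, sub_self, Matrix.one_apply]
      split_ifs <;> simp [h1]
    | succ l ih =>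
      intro C D
      have h1 : ∀ C D, pairSign (gradeJ M N p) A B C •
          bracketJₗ M N p (matJ M N p A B) (matJ M N p C D) =
            (e * matJ M N p - matJ M N p * e) C D := fun C D => by
        rw [bracketJₗ_apply, bracketJ_matJ, pairSign_smul_smul, he]
      rw [pow_succ, pairSign_smul_mul hF (evenMat_matJ.pow l)]
      simp only [ih, h1]
      rw [← Matrix.mul_apply, ← Matrix.mul_apply, ← Matrix.add_apply]
      simp only [sub_mul, mul_sub, mul_assoc, sub_add_sub_cancel]
  rw [he, ← key, pairSign_smul_smul, bracketJₗ_apply]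

/-- Induction on `k`, peeling off the last factor. Right multiplication by this factor shifts the
first power in each product, and its own bracket with the power of index `l` supplies the two
boundary terms, `r = 0` of the first sum and `r = k` of the second. -/
theorem bracketJ_pow_pow (k l : ℕ) (A B C D : Fin (M + N) × Fin p) :
    bracketJ M N p ((matJ M N p ^ k) A B) ((matJ M N p ^ l) C D) =
      pairSign (gradeJ M N p) A B C • ∑ r ∈ Finset.range k,
        ((matJ M N p ^ r) C B * (matJ M N p ^ (k + l - 1 - r)) A D -
          (matJ M N p ^ (k + l - 1 - r)) C B * (matJ M N p ^ r) A D) := by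
  induction k generalizing A B with
  | zero =>
    have h1 : bracketJₗ M N p 1 ((matJ M N p ^ l) C D) = 0 := by
      rw [← map_one (algebraMap ℂ _)]
      exact poissonBracket_algebraMap_left _ _ _
    rw [pow_zero, Matrix.one_apply, ← bracketJₗ_apply]
    split_ifs <;> simp [h1]
  | succ k ih =>
    have h := bracket_mul_left_formula (F := (bracketJₗ M N p).flip ((matJ M N p ^ l) C D))
      (bracketJ_mul_left (evenMat_matJ.pow l C D)) (fun r => evenMat_matJ.pow r)
      (fun r => evenMat_matJ.pow (k + l - 1 - r)) (evenMat_matJ.pow k) evenMat_matJ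
      (evenMat_matJ.pow l) ih (bracketJ_matJ_pow l · · C D) A B
    rw [pow_succ]
    refine h.trans ?_
    congr 1
    simp only [← pow_succ, ← pow_add]
    rw [Finset.sum_sub_distrib, Finset.sum_sub_distrib, Finset.sum_range_succ',
      Finset.sum_range_succ (n := k), pow_zero]
    have e1 : ∀ r, k + 1 + l - 1 - (r + 1) = k + l - 1 - r := fun r => by omega
    have e2 : ∑ r ∈ Finset.range k, (matJ M N p ^ (k + l - 1 - r + 1)) C B * (matJ M N p ^ r) A D =
        ∑ r ∈ Finset.range k, (matJ M N p ^ (k + 1 + l - 1 - r)) C B * (matJ M N p ^ r) A D := by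
      refine Finset.sum_congr rfl fun r hr => ?_
      have := Finset.mem_range.1 hr
      rw [show k + l - 1 - r + 1 = k + 1 + l - 1 - r by omega]
    rw [e2, show k + 1 + l - 1 - 0 = k + l by omega, show k + 1 + l - 1 - k = l by omega]
    simp only [e1]
    abel

/-- For `l = 1`, reversing the order of one of the two sums makes everything cancel except the end
terms. -/
lemma bracketJ_pow_matJ (k : ℕ) (A B C D : Fin (M + N) × Fin p) :
    bracketJ M N p ((matJ M N p ^ k) A B) (matJ M N p C D) = pairSign (gradeJ M N p) A B C •
      ((1 : Matrix _ _ (JAlg M N p)) C B * (matJ M N p ^ k) A D -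
        (matJ M N p ^ k) C B * (1 : Matrix _ _ (JAlg M N p)) A D) := by
  have h := bracketJ_pow_pow k 1 A B C D
  rw [pow_one] at h
  rw [h]
  congr 1
  have h1 := Finset.sum_range_succ' (fun r => (matJ M N p ^ r) C B * (matJ M N p ^ (k - r)) A D) k
  rw [Finset.sum_range_succ] at h1
  rw [Finset.sum_sub_distrib, ← Finset.sum_range_reflect (fun r =>
    (matJ M N p ^ (k + 1 - 1 - r)) C B * (matJ M N p ^ r) A D)]
  have h2 : ∑ r ∈ Finset.range k, (matJ M N p ^ (k + 1 - 1 - (k - 1 - r))) C B *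
      (matJ M N p ^ (k - 1 - r)) A D =
      ∑ r ∈ Finset.range k, (matJ M N p ^ (r + 1)) C B * (matJ M N p ^ (k - (r + 1))) A D := by
    refine Finset.sum_congr rfl fun r hr => ?_
    have := Finset.mem_range.1 hr
    rw [show k + 1 - 1 - (k - 1 - r) = r + 1 by omega, show k - 1 - r = k - (r + 1) by omega]
  rw [h2, sub_eq_sub_iff_add_eq_add]
  simp only [Nat.add_sub_cancel, Nat.sub_self, pow_zero, Nat.sub_zero] at h1 ⊢
  rw [h1, add_comm]

end BracketOfPowers

/-! ### Noncommutative series in words, and the corner entries of powers of the slice -/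

section Words

open PowerSeries

variable {p : ℕ} {R : Type} [Ring R] [Algebra ℂ R]

/-- The component of degree `k` of the noncommutative series `∑ α(s₁ ⋯ s_n) U_{s₁} ⋯ U_{s_n}`, the
letter `s` having degree `s + 1`. -/
def wordSum (α : List (Fin p) → ℂ) (U : Fin p → R) (k : ℕ) : R :=
  ∑ n ∈ Finset.range (k + 1), ∑ s : Fin n → Fin p, if ∑ i, ((s i : ℕ) + 1) = k then
    α (List.ofFn s) • (List.ofFn fun i => U (s i)).prod else 0

/-- The generating series of the components of a noncommutative series. -/
def wordSeries (α : List (Fin p) → ℂ) (U : Fin p → R) : R⟦X⟧ := PowerSeries.mk (wordSum α U)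

lemma coeff_wordSeries (α : List (Fin p) → ℂ) (U : Fin p → R) (k : ℕ) :
    coeff k (wordSeries α U) = wordSum α U k := coeff_mk _ _

lemma le_sum_succ {n : ℕ} (s : Fin n → Fin p) : n ≤ ∑ i, ((s i : ℕ) + 1) := by
  rw [Finset.sum_add_distrib]
  simp

lemma wordSum_eq_of_lt (α : List (Fin p) → ℂ) (U : Fin p → R) {k K : ℕ} (h : k < K) :
    wordSum α U k = ∑ n ∈ Finset.range K, ∑ s : Fin n → Fin p, if ∑ i, ((s i : ℕ) + 1) = k then
      α (List.ofFn s) • (List.ofFn fun i => U (s i)).prod else 0 := by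
  refine Finset.sum_subset (Finset.range_subset_range.2 h) fun n _ hn => ?_
  refine Finset.sum_eq_zero fun s _ => ?_
  rw [if_neg]
  have := le_sum_succ s
  simp only [Finset.mem_range] at hn
  omega

lemma sum_fun_succ {B : Type} [AddCommMonoid B] {n : ℕ} (f : (Fin (n + 1) → Fin p) → B) :
    ∑ s, f s = ∑ a, ∑ s', f (Fin.cons a s') := by
  rw [← (Fin.consEquiv fun _ => Fin p).sum_comp, Fintype.sum_prod_type]
  rfl

lemma wordSum_rec (α : List (Fin p) → ℂ) (U : Fin p → R) (k : ℕ) :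
    wordSum α U k = (if k = 0 then algebraMap ℂ R (α []) else 0) +
      ∑ a : Fin p, if (a : ℕ) + 1 ≤ k then
        U a * wordSum (fun l => α (a :: l)) U (k - ((a : ℕ) + 1)) else 0 := by
  rw [wordSum, Finset.sum_range_succ', add_comm]
  congr 1
  · simp [Algebra.algebraMap_eq_smul_one, eq_comm]
  · simp only [sum_fun_succ]
    rw [Finset.sum_comm]
    refine Finset.sum_congr rfl fun a _ => ?_
    split_ifs with ha
    · rw [wordSum_eq_of_lt _ _ (show k - ((a : ℕ) + 1) < k by omega), Finset.mul_sum]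
      refine Finset.sum_congr rfl fun n _ => ?_
      rw [Finset.mul_sum]
      refine Finset.sum_congr rfl fun s _ => ?_
      rw [Fin.sum_univ_succ, mul_ite, mul_zero]
      simp only [Fin.cons_zero, Fin.cons_succ, List.ofFn_succ, List.prod_cons, mul_smul_comm]
      exact if_congr (by omega) rfl rfl
    · refine Finset.sum_eq_zero fun n _ => Finset.sum_eq_zero fun s _ => ?_
      rw [Fin.sum_univ_succ, if_neg]
      simp only [Fin.cons_zero]
      omega

lemma wordSeries_rec (α : List (Fin p) → ℂ) (U : Fin p → R) :
    wordSeries α U = C (algebraMap ℂ R (α [])) +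
      ∑ a : Fin p, X ^ ((a : ℕ) + 1) * (C (U a) * wordSeries (fun l => α (a :: l)) U) := by
  ext k
  rw [coeff_wordSeries, wordSum_rec, map_add, coeff_C, map_sum]
  simp only [coeff_X_pow_mul', coeff_C_mul, coeff_wordSeries]

/-- The degree of a word. -/
def wordDeg (l : List (Fin p)) : ℕ := (l.map fun a : Fin p => (a : ℕ) + 1).sum

lemma wordDeg_ofFn {n : ℕ} (s : Fin n → Fin p) :
    wordDeg (List.ofFn s) = ∑ i, ((s i : ℕ) + 1) := by
  rw [wordDeg, List.map_ofFn, List.sum_ofFn]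
  rfl

lemma wordSum_congr {α β : List (Fin p) → ℂ} (U : Fin p → R) (k : ℕ)
    (h : ∀ l : List (Fin p), wordDeg l = k → α l = β l) :
    wordSum α U k = wordSum β U k := by
  refine Finset.sum_congr rfl fun n _ => Finset.sum_congr rfl fun s _ => ?_
  split_ifs with hs
  · rw [h (List.ofFn s) (by rw [wordDeg_ofFn, hs])]
  · rfl

lemma wordSeries_add (α β : List (Fin p) → ℂ) (U : Fin p → R) :
    wordSeries (fun l => α l + β l) U = wordSeries α U + wordSeries β U := by
  ext k
  rw [map_add, coeff_wordSeries, coeff_wordSeries, coeff_wordSeries, wordSum, wordSum, wordSum,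
    ← Finset.sum_add_distrib]
  refine Finset.sum_congr rfl fun n _ => ?_
  rw [← Finset.sum_add_distrib]
  refine Finset.sum_congr rfl fun s _ => ?_
  split_ifs
  · rw [add_smul]
  · rw [add_zero]

lemma wordSeries_smul (r : ℂ) (α : List (Fin p) → ℂ) (U : Fin p → R) :
    wordSeries (fun l => r * α l) U = C (algebraMap ℂ R r) * wordSeries α U := by
  ext k
  rw [coeff_C_mul, coeff_wordSeries, coeff_wordSeries, wordSum, wordSum, Finset.mul_sum]
  refine Finset.sum_congr rfl fun n _ => ?_
  rw [Finset.mul_sum]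
  refine Finset.sum_congr rfl fun s _ => ?_
  split_ifs
  · rw [mul_smul, Algebra.smul_def r]
  · rw [mul_zero]

lemma wordSeries_zero (U : Fin p → R) : wordSeries (fun _ => 0) U = 0 := by
  ext k
  rw [coeff_wordSeries, wordSum]
  simp

lemma wordSeries_sum {κ : Type} (s : Finset κ) (c : κ → ℂ) (α : κ → List (Fin p) → ℂ)
    (U : Fin p → R) : wordSeries (fun l => ∑ i ∈ s, c i * α i l) U =
      ∑ i ∈ s, C (algebraMap ℂ R (c i)) * wordSeries (α i) U := by
  classical
  induction s using Finset.induction_on with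
  | empty => simp [wordSeries_zero]
  | insert i s hi ih => simp only [Finset.sum_insert hi, wordSeries_add, wordSeries_smul, ih]

section Plus

/-- The coefficient of a word in the power of index `K` of `e_- + ∑_s W_s (2e_+)^s`. -/
def powCoeff : ℕ → List (Fin p) → Matrix (Fin p) (Fin p) ℂ
  | 0, [] => 1
  | 0, _ :: _ => 0
  | K + 1, [] => lower p * powCoeff K []
  | K + 1, a :: l => lower p * powCoeff K (a :: l) + raise p ^ (a : ℕ) * powCoeff K l

/-- The matrix `e_- + ∑_s U_s (2e_+)^s`. -/
def slice (U : Fin p → R) : Matrix (Fin p) (Fin p) R :=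
  Matrix.of fun i k => algebraMap ℂ R (lower p i k) +
    ∑ s : Fin p, algebraMap ℂ R ((raise p ^ (s : ℕ)) i k) * U s

/-- The matrix `e_- + ∑_s t^{s+1} U_s (2e_+)^s`. -/
def sliceSeries (U : Fin p → R) : Matrix (Fin p) (Fin p) R⟦X⟧ :=
  Matrix.of fun i k => C (algebraMap ℂ R (lower p i k)) +
    ∑ s : Fin p, X ^ ((s : ℕ) + 1) * C (algebraMap ℂ R ((raise p ^ (s : ℕ)) i k) * U s)

lemma sliceSeries_pow_apply (U : Fin p → R) (K : ℕ) (i k : Fin p) :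
    (sliceSeries U ^ K) i k = wordSeries (fun l => powCoeff K l i k) U := by
  induction K generalizing i with
  | zero =>
    rw [wordSeries_rec]
    simp only [powCoeff, Matrix.zero_apply, wordSeries_zero, mul_zero, Finset.sum_const_zero,
      add_zero, pow_zero, Matrix.one_apply]
    split_ifs <;> simp
  | succ K ih =>
    -- The part of the coefficients in which the leftmost factor is a `W`-term: that term consumes
    -- the first letter, so the empty word gets `0`.
    let tl : List (Fin p) → ℂ := fun l => match l with
      | [] => 0
      | a :: l => ∑ m, (raise p ^ (a : ℕ)) i m * powCoeff K l m k
    have h : (fun l => powCoeff (K + 1) l i k) =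
        fun l => (∑ m, lower p i m * powCoeff K l m k) + tl l := by
      funext l
      cases l with
      | nil => simp [tl, powCoeff, Matrix.mul_apply]
      | cons a l => simp [tl, powCoeff, Matrix.mul_apply]
    rw [h, wordSeries_add, wordSeries_sum, wordSeries_rec tl]
    simp only [tl, wordSeries_sum, map_zero, zero_add]
    rw [pow_succ', Matrix.mul_apply]
    simp only [sliceSeries, Matrix.of_apply, add_mul, Finset.sum_add_distrib, Finset.sum_mul]
    congr 1
    · exact Finset.sum_congr rfl fun m _ => by rw [← ih]; rfl
    · rw [Finset.sum_comm]
      refine Finset.sum_congr rfl fun a _ => ?_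
      rw [Finset.mul_sum, Finset.mul_sum]
      refine Finset.sum_congr rfl fun m _ => ?_
      rw [← ih, Algebra.commutes, map_mul]
      simp only [mul_assoc]
      rfl

/-- The grading of `gl(p)` by diagonals: conjugation by the powers `t^i` multiplies `e_-` and every
`t^{s+1} U_s (2e_+)^s` at `t = 1` by the same power of `t`. Consequently each entry of a power of
the series matrix is homogeneous in `t`, and words of degree `n` reach the corner only in the power
`p-1+n`. -/
lemma X_pow_mul_sliceSeries_apply (U : Fin p → R) (i k : Fin p) :
    X ^ (i : ℕ) * sliceSeries U i k = X ^ ((k : ℕ) + 1) * C (slice U i k) := by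
  simp only [sliceSeries, slice, Matrix.of_apply, map_add, map_sum, mul_add, Finset.mul_sum]
  congr 1
  · by_cases h : (i : ℕ) = k + 1
    · rw [h]
    · simp [lower, h]
  · refine Finset.sum_congr rfl fun s _ => ?_
    by_cases h : (k : ℕ) = i + s
    · rw [← mul_assoc, ← pow_add, h, add_assoc]
    · simp [raise_pow_apply, h]

lemma X_pow_mul_sliceSeries_pow (U : Fin p → R) (K : ℕ) (i k : Fin p) :
    X ^ (i : ℕ) * (sliceSeries U ^ K) i k = X ^ ((k : ℕ) + K) * C ((slice U ^ K) i k) := by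
  induction K generalizing i with
  | zero =>
    rw [pow_zero, pow_zero, Matrix.one_apply, Matrix.one_apply]
    split_ifs with h
    · simp [h]
    · simp
  | succ K ih =>
    rw [pow_succ', pow_succ', Matrix.mul_apply, Matrix.mul_apply, map_sum, Finset.mul_sum,
      Finset.mul_sum]
    refine Finset.sum_congr rfl fun m _ => ?_
    rw [← mul_assoc, X_pow_mul_sliceSeries_apply, pow_succ', mul_assoc X, X_pow_mul, mul_assoc X,
      mul_assoc (C _), ih, map_mul, ← mul_assoc (C _), ← X_pow_mul, ← add_assoc, pow_succ']
    simp only [mul_assoc]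

variable (hp : 1 ≤ p)

/-- The first index of `gl(p)`. -/
abbrev firstIdx : Fin p := ⟨0, hp⟩

/-- The last index of `gl(p)`. -/
abbrev lastIdx : Fin p := ⟨p - 1, by omega⟩

/-- The coefficients of the words in the corner entries of the powers of
`e_- + ∑_s W_s (2e_+)^s`. -/
def plusCoeff (l : List (Fin p)) : ℂ :=
  powCoeff (p - 1 + wordDeg l) l (lastIdx hp) (firstIdx hp)

lemma coeff_sliceSeries_pow (U : Fin p → R) (K n : ℕ) :
    coeff n ((sliceSeries U ^ K) (lastIdx hp) (firstIdx hp)) =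
      if p - 1 + n = K then (slice U ^ K) (lastIdx hp) (firstIdx hp) else 0 := by
  have h := congrArg (coeff (n + (p - 1)))
    (X_pow_mul_sliceSeries_pow U K (lastIdx hp) (firstIdx hp))
  rw [coeff_X_pow_mul, coeff_X_pow_mul'] at h
  rw [h, coeff_C]
  dsimp only
  split_ifs <;> first | rfl | omega

/-- The components of the series of coefficients `plusCoeff` are the corner entries of the powers
of `e_- + ∑_s U_s (2e_+)^s`. -/
theorem wordSum_plusCoeff (U : Fin p → R) (n : ℕ) :
    wordSum (plusCoeff hp) U n = (slice U ^ (p - 1 + n)) (lastIdx hp) (firstIdx hp) := by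
  have h := coeff_sliceSeries_pow hp U (p - 1 + n) n
  rw [if_pos rfl, sliceSeries_pow_apply, coeff_wordSeries] at h
  rw [← h]
  refine wordSum_congr U n fun l hl => ?_
  rw [plusCoeff, hl]

lemma powCoeff_nil (K : ℕ) : powCoeff K ([] : List (Fin p)) = lower p ^ K := by
  induction K with
  | zero => rfl
  | succ K ih => rw [powCoeff, ih, pow_succ']

/-- The letter `0` goes with the unit matrix `(2e_+)^0`, which commutes with `e_-`; this is the
binomial formula. -/
lemma powCoeff_replicate (K n : ℕ) :
    powCoeff K (List.replicate n (firstIdx hp)) = (K.choose n : ℂ) • lower p ^ (K - n) := by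
  induction K generalizing n with
  | zero =>
    cases n with
    | zero => simp [powCoeff]
    | succ n => simp [powCoeff, List.replicate_succ]
  | succ K ih =>
    cases n with
    | zero => simp [powCoeff_nil]
    | succ n =>
      rw [List.replicate_succ, powCoeff, ← List.replicate_succ, ih, ih, pow_zero, one_mul,
        mul_smul_comm, Nat.add_sub_add_right, Nat.choose_succ_succ, Nat.cast_add, add_smul,
        add_comm]
      congr 1
      by_cases hn : n + 1 ≤ K
      · rw [← pow_succ', show K - (n + 1) + 1 = K - n by omega]
      · rw [Nat.choose_eq_zero_of_lt (by omega)]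
        simp

lemma wordDeg_replicate (n : ℕ) : wordDeg (List.replicate n (firstIdx hp)) = n := by
  simp [wordDeg]

lemma plusCoeff_replicate (n : ℕ) :
    plusCoeff hp (List.replicate n (firstIdx hp)) = ((p - 1 + n).choose n : ℂ) := by
  rw [plusCoeff, powCoeff_replicate, wordDeg_replicate, Matrix.smul_apply, lower_pow_apply, if_pos]
  · simp
  · simp

/-- With one letter, the product descends from row `i` to some row `i'`, rises by `a` with
coefficient `rise p i' a`, and descends to row `0`. Rows with `i' + a ≥ p` contribute zero, as does
`rise`. -/
lemma powCoeff_singleton (a i : Fin p) :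
    powCoeff ((i : ℕ) + a + 1) [a] i (firstIdx hp) =
      ∑ i' ∈ Finset.range ((i : ℕ) + 1), rise p i' a := by
  obtain ⟨i, hi⟩ := i
  dsimp only
  have hr : ∀ (i : ℕ) (hi : i < p),
      (raise p ^ (a : ℕ) * lower p ^ (i + (a : ℕ))) ⟨i, hi⟩ (firstIdx hp) = rise p i a := by
    intro i hi
    rw [Matrix.mul_apply]
    by_cases h : i + (a : ℕ) < p
    · rw [Finset.sum_eq_single ⟨i + a, h⟩]
      · simp [raise_pow_apply, lower_pow_apply]
      · intro b _ hb
        rw [raise_pow_apply, if_neg (fun h' => hb (Fin.ext h')), zero_mul]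
      · simp
    · rw [rise_eq_zero hi (by omega)]
      refine Finset.sum_eq_zero fun b _ => ?_
      rw [raise_pow_apply, if_neg (by dsimp only; omega), zero_mul]
  have hl : ∀ (i : ℕ) (hi : i < p) (A : Matrix (Fin p) (Fin p) ℂ),
      (lower p * A) ⟨i, hi⟩ (firstIdx hp) =
        if h : 1 ≤ i then A ⟨i - 1, by omega⟩ (firstIdx hp) else 0 := by
    intro i hi A
    rw [Matrix.mul_apply]
    split_ifs with h
    · rw [Finset.sum_eq_single ⟨i - 1, by omega⟩]
      · rw [lower, Matrix.of_apply, if_pos (by simp; omega), one_mul]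
      · intro b _ hb
        rw [lower, Matrix.of_apply, if_neg (fun h' => hb (Fin.ext (by simp at h' ⊢; omega))),
          zero_mul]
      · simp
    · refine Finset.sum_eq_zero fun b _ => ?_
      rw [lower, Matrix.of_apply, if_neg (by dsimp only; omega), zero_mul]
  induction i with
  | zero =>
    rw [powCoeff, Matrix.add_apply, powCoeff_nil, hr, hl]
    simp
  | succ i ih =>
    rw [powCoeff, Matrix.add_apply, powCoeff_nil, hr, hl, dif_pos (by omega),
      Finset.sum_range_succ]
    congr 1
    rw [show i + 1 + (a : ℕ) = i + a + 1 by ring]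
    exact ih (by omega) hl

/-- Compare coefficients of `x^{p-1-a}` in the square of `(1-x)^{-(a+1)}`, which is
`(1-x)^{-(2a+2)}`. -/
lemma sum_choose_mul_choose {a : ℕ} (ha : a < p) :
    ∑ i ∈ Finset.range (p - a), (i + a).choose a * (p - 1 - i).choose a =
      (p + a).choose (2 * a + 1) := by
  have h := PowerSeries.mk_one_pow_eq_mk_choose_add (S := ℤ) a
  have h2 := PowerSeries.mk_one_pow_eq_mk_choose_add (S := ℤ) (2 * a + 1)
  rw [show 2 * a + 1 + 1 = (a + 1) + (a + 1) by ring, pow_add, h] at h2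
  have h3 := congrArg (coeff (p - 1 - a)) h2
  rw [coeff_mul, coeff_mk, Finset.Nat.sum_antidiagonal_eq_sum_range_succ_mk,
    Nat.succ_eq_add_one, show p - 1 - a + 1 = p - a by omega] at h3
  rw [show p + a = 2 * a + 1 + (p - 1 - a) by omega]
  zify
  rw [← h3]
  refine Finset.sum_congr rfl fun i hi => ?_
  have := Finset.mem_range.1 hi
  rw [coeff_mk, coeff_mk, add_comm i a, show p - 1 - i = a + (p - 1 - a - i) by omega]

lemma sum_rise (a : Fin p) : ∑ i ∈ Finset.range p, rise p i a =
    ((a : ℕ).factorial : ℂ) ^ 2 * ((p + a).choose (2 * a + 1) : ℂ) := by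
  rw [← sum_choose_mul_choose a.2, ← Finset.sum_subset (Finset.range_subset_range.2
    (Nat.sub_le p a)) fun i hi hi' => rise_eq_zero (Finset.mem_range.1 hi)
      (by simp at hi'; omega)]
  push_cast
  rw [Finset.mul_sum]
  refine Finset.sum_congr rfl fun i hi => ?_
  rw [rise_eq_choose (by have := Finset.mem_range.1 hi; omega)]
  push_cast
  rfl

lemma plusCoeff_singleton (a : Fin p) : plusCoeff hp [a] =
    ((a : ℕ).factorial : ℂ) ^ 2 * ((p + a).choose (2 * a + 1) : ℂ) := by
  have h := powCoeff_singleton hp a (lastIdx hp)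
  rw [show ((lastIdx hp : Fin p) : ℕ) + 1 = p by simp; omega, sum_rise] at h
  rw [plusCoeff, ← h]
  simp [wordDeg, add_assoc]

end Plus

/-! ### The inverse series as solution of a triangular system -/

section Minus

/-- The coefficients of the words in the solution of the triangular system
`(1 - e_- - ∑_s W_s (2e_+)^s) v = D`, where only the first component of `D` is nonzero and the last
component of `v` is `1`; the component of index `r` is counted from the last one. -/
def detCoeff : List (Fin p) → ℕ → ℂ
  | [], _ => 1
  | a :: l, r => -∑ r' ∈ Finset.range r, rise p (p - r' - 1) a * detCoeff l (r' - a)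

/-- The series of coefficients `detCoeff`. -/
def detSeries (U : Fin p → R) (r : ℕ) : R⟦X⟧ := wordSeries (fun l => detCoeff l r) U

lemma detSeries_zero (U : Fin p → R) : detSeries U 0 = 1 := by
  rw [detSeries, wordSeries_rec]
  simp [detCoeff, wordSeries_zero]

lemma detSeries_succ (U : Fin p → R) (r : ℕ) : detSeries U (r + 1) = detSeries U r -
    ∑ a : Fin p, X ^ ((a : ℕ) + 1) * (C (algebraMap ℂ R (rise p (p - r - 1) a) * U a) *
      detSeries U (r - a)) := by
  rw [detSeries, detSeries, wordSeries_rec, wordSeries_rec (fun l => detCoeff l r),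
    add_sub_assoc, ← Finset.sum_sub_distrib]
  congr 1
  refine Finset.sum_congr rfl fun a _ => ?_
  have h : (fun l => detCoeff (a :: l) (r + 1)) = fun l => detCoeff (a :: l) r +
      -rise p (p - r - 1) a * detCoeff l (r - a) := by
    funext l
    rw [detCoeff, detCoeff, Finset.sum_range_succ]
    ring
  rw [h, wordSeries_add, wordSeries_smul, mul_add, mul_add, map_neg, map_neg, neg_mul, mul_neg,
    mul_neg, ← sub_eq_add_neg, Algebra.commutes, map_mul]
  simp only [mul_assoc]
  rfl

/-- By the recursion, the series of index `r+1` only involves `t^{a+1}` times the series of index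
`r-a`, so the degree in `t` is at most the index. At index `p` this is the reason why the family for
the sign `-` stops. -/
lemma coeff_detSeries_eq_zero (U : Fin p → R) {r n : ℕ} (h : r < n) :
    coeff n (detSeries U r) = 0 := by
  induction r using Nat.strong_induction_on generalizing n with
  | _ r ih =>
    cases r with
    | zero => rw [detSeries_zero, coeff_one, if_neg (by omega)]
    | succ r =>
      rw [detSeries_succ, map_sub, ih r (by omega) (by omega), zero_sub, neg_eq_zero, map_sum]
      refine Finset.sum_eq_zero fun a _ => ?_
      rw [coeff_X_pow_mul']
      split_ifs with ha
      · rw [coeff_C_mul]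
        by_cases har : (a : ℕ) ≤ r
        · rw [ih (r - a) (by omega) (by omega), mul_zero]
        · by_cases hpr : r < p
          · rw [rise_eq_zero (by omega) (by omega)]
            simp
          · omega
      · rfl

/-- The vector `v` of the triangular system. -/
def detVec (U : Fin p → R) (i : Fin p) : R⟦X⟧ := detSeries U (p - 1 - i)

/-- Row `i` of the system is the recursion `detSeries_succ` at `r = p-1-i`: for `i > 0` the entry of
`e_-` picks out the next series, of index `p-i`. The first row of `e_-` is zero, which leaves the
series of index `p` there. -/
lemma sliceSeries_mulVec_detVec (U : Fin p → R) (i : Fin p) :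
    detVec U i - ∑ k, sliceSeries U i k * detVec U k =
      if (i : ℕ) = 0 then detSeries U p else 0 := by
  simp only [sliceSeries, Matrix.of_apply, add_mul, Finset.sum_add_distrib, Finset.sum_mul]
  rw [Finset.sum_comm]
  have h1 : ∀ a : Fin p, ∑ k : Fin p, X ^ ((a : ℕ) + 1) *
      C (algebraMap ℂ R ((raise p ^ (a : ℕ)) i k) * U a) * detVec U k =
      X ^ ((a : ℕ) + 1) * (C (algebraMap ℂ R (rise p (p - (p - 1 - i) - 1) a) * U a) *
        detSeries U (p - 1 - i - a)) := by
    intro a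
    rw [show p - (p - 1 - i) - 1 = (i : ℕ) by omega]
    by_cases h : (i : ℕ) + a < p
    · rw [Finset.sum_eq_single ⟨i + a, h⟩]
      · rw [raise_pow_apply, if_pos rfl, detVec, mul_assoc, Nat.sub_sub _ (i : ℕ)]
      · intro b _ hb
        rw [raise_pow_apply, if_neg (fun h' => hb (Fin.ext h'))]
        simp
      · simp
    · rw [rise_eq_zero i.2 (by omega), Finset.sum_eq_zero]
      · simp
      · intro b _
        rw [raise_pow_apply, if_neg (by omega)]
        simp
  have h2 : ∑ k, C (algebraMap ℂ R (lower p i k)) * detVec U k =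
      if (i : ℕ) = 0 then 0 else detSeries U (p - 1 - i + 1) := by
    split_ifs with h
    · refine Finset.sum_eq_zero fun b _ => ?_
      rw [lower, Matrix.of_apply, if_neg (by omega)]
      simp
    · rw [Finset.sum_eq_single ⟨i - 1, by omega⟩]
      · rw [lower, Matrix.of_apply, if_pos (by simp; omega), detVec]
        simp only [map_one, one_mul]
        congr 1
        omega
      · intro b _ hb
        rw [lower, Matrix.of_apply, if_neg (fun h' => hb (Fin.ext (by simp at h' ⊢; omega)))]
        simp
      · simp
  simp only [h1]
  rw [h2, sub_add_eq_sub_sub_swap, detVec, ← detSeries_succ]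
  split_ifs with h
  · rw [sub_zero, show p - 1 - (i : ℕ) + 1 = p by omega]
  · rw [sub_self]

variable (hp : 1 ≤ p)

/-- With `S` the series matrix, `(1 - S) v` is concentrated in the first component, so multiplying
by the partial geometric sum of the `S^K` telescopes to `v - S^n v`, read in the last component. -/
lemma sum_sliceSeries_pow_mul (U : Fin p → R) (n : ℕ) :
    (∑ K ∈ Finset.range n, (sliceSeries U ^ K) (lastIdx hp) (firstIdx hp)) * detSeries U p =
      1 - ((sliceSeries U ^ n).mulVec (detVec U)) (lastIdx hp) := by
  induction n with
  | zero => simp [detVec, detSeries_zero]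
  | succ n ih =>
    have h : (sliceSeries U).mulVec (detVec U) =
        detVec U - Pi.single (firstIdx hp) (detSeries U p) := by
      funext i
      have := sliceSeries_mulVec_detVec U i
      rw [Pi.sub_apply, Pi.single_apply]
      rw [sub_eq_iff_eq_add] at this
      rw [this, Matrix.mulVec, dotProduct]
      simp only [Fin.ext_iff]
      abel
    rw [Finset.sum_range_succ, add_mul, ih, pow_succ, ← Matrix.mulVec_mulVec, h, Matrix.mulVec_sub,
      Pi.sub_apply, Matrix.mulVec_single]
    simp only [Pi.smul_apply, Matrix.col_apply, MulOpposite.smul_eq_mul_unop,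
      MulOpposite.unop_op]
    abel

/-- The series of coefficients `plusCoeff` and `detCoeff` are inverse to each other. -/
theorem plusSeries_mul_detSeries (U : Fin p → R) :
    wordSeries (plusCoeff hp) U * detSeries U p = 1 := by
  ext n
  have h := congrArg (coeff n) (sum_sliceSeries_pow_mul hp U (n + p))
  -- By homogeneity, the last row of the power `n+p` starts in degree at least `n+1`, so the
  -- remainder does not reach degree `n`.
  have h0 : coeff n (((sliceSeries U ^ (n + p)).mulVec (detVec U)) (lastIdx hp)) = 0 := by
    rw [Matrix.mulVec, dotProduct, map_sum]
    refine Finset.sum_eq_zero fun k _ => ?_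
    rw [coeff_mul]
    refine Finset.sum_eq_zero fun x hx => ?_
    have hx := Finset.HasAntidiagonal.mem_antidiagonal.1 hx
    have h := congrArg (coeff (x.1 + (p - 1)))
      (X_pow_mul_sliceSeries_pow U (n + p) (lastIdx hp) k)
    rw [coeff_X_pow_mul, coeff_X_pow_mul', if_neg (by omega)] at h
    rw [h, zero_mul]
  rw [map_sub, h0, sub_zero] at h
  rw [← h, coeff_mul, coeff_mul]
  refine Finset.sum_congr rfl fun x hx => ?_
  have hx := Finset.HasAntidiagonal.mem_antidiagonal.1 hx
  congr 1
  rw [map_sum, coeff_wordSeries, wordSum_plusCoeff]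
  simp only [coeff_sliceSeries_pow]
  rw [Finset.sum_ite_eq, if_pos (Finset.mem_range.2 (by omega))]

/-- A series with constant term `1` is a unit even over a noncommutative ring, so its left inverse
is two-sided. -/
lemma detSeries_mul_plusSeries (U : Fin p → R) :
    detSeries U p * wordSeries (plusCoeff hp) U = 1 := by
  have h1 := plusSeries_mul_detSeries hp U
  have hc : constantCoeff (detSeries U p) = ((1 : Rˣ) : R) := by
    rw [← coeff_zero_eq_constantCoeff_apply, detSeries, coeff_wordSeries, wordSum_rec]
    simp [detCoeff]
  have h2 := mul_invOfUnit _ _ hc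
  have : wordSeries (plusCoeff hp) U = invOfUnit (detSeries U p) 1 := by
    rw [← mul_one (wordSeries _ _), ← h2, ← mul_assoc, h1, one_mul]
  rw [this, h2]

lemma detCoeff_replicate (n r : ℕ) :
    detCoeff (List.replicate n (firstIdx hp)) r = (-1) ^ n * (r.choose n : ℂ) := by
  induction n generalizing r with
  | zero => simp [detCoeff]
  | succ n ih =>
    rw [List.replicate_succ, detCoeff]
    simp only [ih, rise, Finset.range_zero, Finset.prod_empty, one_mul, Nat.sub_zero]
    induction r with
    | zero => simp
    | succ r ihr =>
      rw [Finset.sum_range_succ, neg_add, ihr, Nat.choose_succ_succ]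
      push_cast
      ring

lemma detCoeff_singleton (a : Fin p) :
    detCoeff [a] p = -(((a : ℕ).factorial : ℂ) ^ 2 * ((p + a).choose (2 * a + 1) : ℂ)) := by
  rw [detCoeff, ← sum_rise, ← Finset.sum_range_reflect (fun i => rise p i a)]
  simp only [detCoeff, mul_one, Nat.sub_right_comm]

/-- The coefficients of the words for the sign `-`. -/
def minusCoeff (l : List (Fin p)) : ℂ := (-1) ^ wordDeg l * detCoeff l p

lemma wordSum_minusCoeff (U : Fin p → R) (n : ℕ) :
    wordSum minusCoeff U n = (-1 : ℂ) ^ n • coeff n (detSeries U p) := by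
  have h : (-1 : ℂ) ^ n • coeff n (detSeries U p) =
      wordSum (fun l => (-1) ^ n * detCoeff l p) U n := by
    rw [← coeff_wordSeries, wordSeries_smul, coeff_C_mul, Algebra.smul_def]
    rfl
  rw [h]
  refine wordSum_congr U n fun l hl => ?_
  rw [minusCoeff, hl]

end Minus

end Words

/-! ### Graded products as ordinary matrix products -/

section GradedProducts

variable (M N p : ℕ)

/-- Square matrices over `W_p(M|N)`. -/
abbrev WMat : Type := Matrix (Fin (M + N)) (Fin (M + N)) (WAlg M N p)

lemma signMatrix_mul_self : signMatrix M N p * signMatrix M N p = 1 := by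
  rw [signMatrix, Matrix.diagonal_mul_diagonal, ← Matrix.diagonal_one]
  congr 1
  funext a
  rw [← pow_add, (Even.add_self _).neg_one_pow]

variable {M N p}

lemma mul_neg_one_pow (n : ℕ) (f : WAlg M N p) : f * (-1) ^ n = (-1 : ℂ) ^ n • f := by
  rw [Algebra.smul_def, map_pow, map_neg, map_one]
  exact ((Commute.neg_one_right f).pow_right n).eq

lemma mul_signMatrix_apply (A : WMat M N p) (a b : Fin (M + N)) :
    (A * signMatrix M N p) a b = (-1 : ℂ) ^ grade M N b • A a b := by
  rw [signMatrix, Matrix.mul_diagonal, mul_neg_one_pow]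

lemma apply_eq_mul_signMatrix (A : WMat M N p) (a b : Fin (M + N)) :
    A a b = (-1 : ℂ) ^ grade M N b • (A * signMatrix M N p) a b := by
  rw [mul_signMatrix_apply, smul_smul, neg_one_pow_mul_self, one_smul]

/-- Absorbing one sign matrix into each factor removes all signs from the graded product; everything
afterwards is about ordinary words in the matrices `signedGen`. -/
lemma gradedProd_mul_signMatrix (L : List (WMat M N p)) :
    gradedProd M N p L * signMatrix M N p = (L.map (· * signMatrix M N p)).prod := by
  induction L with
  | nil => simp [gradedProd, signMatrix_mul_self]
  | cons A L ih =>
    cases L with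
    | nil => simp [gradedProd]
    | cons B L =>
      rw [gradedProd, mul_assoc, ih]
      simp only [List.map_cons, List.prod_cons]

variable (α : List (Fin p) → ℂ)

/-- The system of numbers attached to a function of words. -/
def toCoeffs : Coeffs p := fun _ s => α (List.ofFn s)

lemma sum_gradedProd_mul_signMatrix {q : ℕ} (α : List (Fin q) → ℂ) (A : ℕ → WMat M N p) (j : ℕ) :
    (∑ n ∈ Finset.range (j + 1), ∑ s : Fin (n + 1) → Fin q, if n + ∑ i, (s i : ℕ) = j then
      α (List.ofFn s) • gradedProd M N p (List.ofFn fun i => A (s i)) else 0) * signMatrix M N p =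
      wordSum α (fun s : Fin q => A s * signMatrix M N p) (j + 1) := by
  rw [wordSum, Finset.sum_range_succ' _ (j + 1), Finset.sum_mul]
  simp only [Finset.univ_eq_empty, Finset.sum_empty, (Nat.succ_ne_zero j).symm, if_false,
    Finset.sum_const_zero, add_zero, Finset.sum_mul, ite_mul, zero_mul, smul_mul_assoc,
    gradedProd_mul_signMatrix, List.map_ofFn]
  refine Finset.sum_congr rfl fun n _ => Finset.sum_congr rfl fun s _ => ?_
  rw [Finset.sum_add_distrib]
  refine if_congr ?_ rfl rfl
  simp
  omega

variable (M N p) in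
/-- The matrices `W_s` with the signs of graded products absorbed. -/
def signedGen (s : Fin p) : WMat M N p := Wgen M N p s * signMatrix M N p

lemma Wbar_mul_signMatrix (j : ℕ) :
    Wbar M N p (toCoeffs α) j * signMatrix M N p = wordSum α (signedGen M N p) (j + 1) :=
  sum_gradedProd_mul_signMatrix α (Wgen M N p) j

lemma Wbar_apply (j : ℕ) (a b : Fin (M + N)) : Wbar M N p (toCoeffs α) j a b =
    (-1 : ℂ) ^ grade M N b • wordSum α (signedGen M N p) (j + 1) a b := by
  rw [apply_eq_mul_signMatrix (Wbar M N p (toCoeffs α) j) a b, Wbar_mul_signMatrix]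

lemma Wgen_apply (s : Fin p) (a b : Fin (M + N)) :
    Wgen M N p s a b = gen (parW M N p) (s, a, b) := by
  rw [Wgen, Matrix.of_apply, dif_pos s.2]

lemma evenMat_Wgen (j : ℕ) : EvenMat (grade M N) (Wgen M N p j) := fun a b => by
  rw [Wgen, Matrix.of_apply]
  split_ifs with h
  · exact Homog.gen (par := parW M N p) (⟨j, h⟩, a, b)
  · exact Homog.zero _

lemma EvenMat.mul_signMatrix {A : WMat M N p} (hA : EvenMat (grade M N) A) :
    EvenMat (grade M N) (A * signMatrix M N p) := fun a b => by
  rw [mul_signMatrix_apply]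
  exact (hA a b).smul _

lemma EvenMat.wordSum {q : ℕ} {β : List (Fin q) → ℂ} {U : Fin q → WMat M N p}
    (hU : ∀ s, EvenMat (grade M N) (U s)) (k : ℕ) : EvenMat (grade M N) (wordSum β U k) := by
  refine EvenMat.sum fun n _ => EvenMat.sum fun s _ => ?_
  split_ifs
  · refine EvenMat.smul _ ?_
    have : ∀ L : List (WMat M N p), (∀ A ∈ L, EvenMat (grade M N) A) →
        EvenMat (grade M N) L.prod := by
      intro L hL
      induction L with
      | nil => exact EvenMat.one
      | cons A L ih =>
        rw [List.prod_cons]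
        exact (hL A (by simp)).mul (ih fun B hB => hL B (by simp [hB]))
    refine this _ fun A hA => ?_
    obtain ⟨i, rfl⟩ := List.mem_ofFn.1 hA
    exact hU _
  · exact EvenMat.zero

lemma evenMat_signedGen (s : Fin p) : EvenMat (grade M N) (signedGen M N p s) :=
  (evenMat_Wgen _).mul_signMatrix

end GradedProducts

/-! ### Yangian relations for the sign `+` -/

section YangianPlus

variable {M N p : ℕ}

/-- Read the big matrix as a `p × p` matrix over matrices of size `M + N`. The sign `(-1)^{[b]}` in
`matJ` cancels the one in `blockLower`, and turns `W_s` into `signedGen`. -/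
lemma restrict_matJ_pow (K : ℕ) (a b : Fin (M + N)) (i k : Fin p) :
    restrict M N p ((matJ M N p ^ K) (a, i) (b, k)) =
      ((slice (signedGen M N p) ^ K) i k) a b := by
  induction K generalizing a i with
  | zero =>
    rw [pow_zero, pow_zero, Matrix.one_apply, Matrix.one_apply]
    by_cases hi : i = k <;> by_cases ha : a = b <;> simp [hi, ha, Matrix.one_apply]
  | succ K ih =>
    have h1 : ∀ (c : Fin (M + N)) (m : Fin p), restrict M N p (matJ M N p (a, i) (c, m)) =
        (slice (signedGen M N p) i m) a c := by
      intro c m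
      rw [matJ_apply, map_smul, restrict_gen, slice, Matrix.of_apply, Matrix.add_apply,
        Matrix.sum_apply, restrictGen, smul_add, Finset.smul_sum, Matrix.algebraMap_matrix_apply]
      congr 1
      · rw [blockLower_congr, Matrix.smul_apply]
        dsimp only [gradeJ]
        split_ifs with h
        · rw [h, Algebra.smul_def, ← map_mul, smul_eq_mul, ← mul_assoc, neg_one_pow_mul_self,
            one_mul]
        · simp
      · refine Finset.sum_congr rfl fun s _ => ?_
        rw [Algebra.algebraMap_eq_smul_one, smul_mul_assoc, one_mul, Matrix.smul_apply, signedGen,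
          mul_signMatrix_apply, Wgen_apply, multiplet_top, smul_comm]
        rfl
    rw [pow_succ', pow_succ', Matrix.mul_apply, Matrix.mul_apply, map_sum, Fintype.sum_prod_type,
      Matrix.sum_apply, Finset.sum_comm]
    refine Finset.sum_congr rfl fun m _ => ?_
    rw [Matrix.mul_apply]
    refine Finset.sum_congr rfl fun c _ => ?_
    rw [map_mul, h1, ih]

variable (hp : 1 ≤ p)

/-- Only `e_-` leads from a row to a smaller column index, one step at a time, so going from the
last index to the first takes at least `p-1` factors. -/
lemma slice_pow_eq_zero {R : Type} [Ring R] [Algebra ℂ R] (U : Fin p → R) {K : ℕ}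
    (hK : K < p - 1) : (slice U ^ K) (lastIdx hp) (firstIdx hp) = 0 := by
  have h := congrArg (PowerSeries.coeff K)
    (X_pow_mul_sliceSeries_pow U K (lastIdx hp) (firstIdx hp))
  rw [PowerSeries.coeff_X_pow_mul', if_neg (by simp; omega), PowerSeries.coeff_X_pow_mul',
    if_pos (by simp), PowerSeries.coeff_C, if_pos (by simp)] at h
  exact h.symm

/-- A constraint of negative weight involves only generators whose row index `i` in `gl(p)` exceeds
the column index `k`. Then `i` is not the first index and `k` is not the last, so both Kronecker
deltas in the bracket with a corner entry vanish. -/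
lemma bracketJ_pow_constraint {K : ℕ} {α : CIndex M N p} (hα : α.wt < 0) (a b : Fin (M + N)) :
    bracketJ M N p ((matJ M N p ^ K) (a, lastIdx hp) (b, firstIdx hp)) (constraint M N p α) = 0 ∧
    bracketJ M N p (constraint M N p α)
      ((matJ M N p ^ K) (a, lastIdx hp) (b, firstIdx hp)) = 0 := by
  have hg : ∀ A B, gen (parJ M N p) (A, B) = (-1 : ℂ) ^ gradeJ M N p B • matJ M N p A B := by
    intro A B
    rw [matJ_apply, smul_smul, neg_one_pow_mul_self, one_smul]
  have hne : ∀ i k : Fin p, α.mat k i ≠ 0 → (k : ℕ) < i := by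
    intro i k h
    by_contra hk
    exact h (α.hasWeight_mat k i (by omega))
  constructor
  · rw [bracketJ_constraint_right]
    refine Finset.sum_eq_zero fun i _ => Finset.sum_eq_zero fun k _ => ?_
    by_cases h : α.mat k i = 0
    · rw [h, zero_smul]
    · have hki := hne i k h
      have hi := i.2
      rw [hg, ← bracketJₗ_apply, map_smul, bracketJₗ_apply, bracketJ_pow_matJ, Matrix.one_apply_ne,
        Matrix.one_apply_ne]
      · simp
      · simp [Fin.ext_iff]
        omega
      · simp [Fin.ext_iff]
        omega
  · rw [bracketJ_constraint_left]
    refine Finset.sum_eq_zero fun i _ => Finset.sum_eq_zero fun k _ => ?_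
    by_cases h : α.mat k i = 0
    · rw [h, zero_smul]
    · have hki := hne i k h
      have hi := i.2
      rw [hg, ← bracketJₗ_apply, map_smul, LinearMap.smul_apply, bracketJₗ_apply,
        bracketJ_matJ_pow, Matrix.one_apply_ne, Matrix.one_apply_ne]
      · simp
      · simp [Fin.ext_iff]
        omega
      · simp [Fin.ext_iff]
        omega

variable (M N) in
/-- The matrices of the generators for the sign `+`, the unit matrix being the one of index `0`. -/
def plusGen (n : ℕ) : WMat M N p := wordSum (plusCoeff hp) (signedGen M N p) n

lemma evenMat_plusGen (n : ℕ) : EvenMat (grade M N) (plusGen M N hp n) :=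
  EvenMat.wordSum evenMat_signedGen n

lemma plusGen_apply (n : ℕ) (a b : Fin (M + N)) : plusGen M N hp n a b =
    restrict M N p ((matJ M N p ^ (p - 1 + n)) (a, lastIdx hp) (b, firstIdx hp)) := by
  rw [restrict_matJ_pow, plusGen, wordSum_plusCoeff]

lemma plusGen_zero : plusGen M N hp 0 = 1 := by
  rw [plusGen, wordSum_rec]
  have := plusCoeff_replicate hp 0
  simp at this
  simp [this]

/-- The Yangian relations for the sign `+`. -/
theorem diracBracket_plusGen (k l : ℕ) (a b c d : Fin (M + N)) :
    diracBracket M N p (plusGen M N hp k a b) (plusGen M N hp l c d) =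
      pairSign (grade M N) a b c • ∑ r ∈ Finset.range k,
        (plusGen M N hp r c b * plusGen M N hp (k + l - 1 - r) a d -
          plusGen M N hp (k + l - 1 - r) c b * plusGen M N hp r a d) := by
  -- These low powers remove the terms `r < p-1` from the sum of length `p-1+k`; the remaining ones,
  -- shifted by `p-1`, are exactly the terms in the claim.
  have hz : ∀ r < p - 1, ∀ a b : Fin (M + N),
      restrict M N p ((matJ M N p ^ r) (a, lastIdx hp) (b, firstIdx hp)) = 0 := by
    intro r hr a b
    rw [restrict_matJ_pow, slice_pow_eq_zero hp _ hr, Matrix.zero_apply]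
  rw [plusGen_apply, plusGen_apply, diracBracket_restrict
    (evenMat_matJ.pow (p - 1 + k) (a, lastIdx hp) (b, firstIdx hp))
    (evenMat_matJ.pow (p - 1 + l) (c, lastIdx hp) (d, firstIdx hp))
    (fun α hα => (bracketJ_pow_constraint hp hα a b).1)
    (fun α hα => (bracketJ_pow_constraint hp hα c d).2), bracketJ_pow_pow, map_smul, map_sum,
    Finset.sum_range_add]
  rw [Finset.sum_eq_zero, zero_add]
  · change pairSign (grade M N) a b c • _ = _
    congr 1
    refine Finset.sum_congr rfl fun r hr => ?_
    have := Finset.mem_range.1 hr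
    rw [show p - 1 + k + (p - 1 + l) - 1 - (p - 1 + r) = p - 1 + (k + l - 1 - r) by omega]
    simp only [map_sub, map_mul, plusGen_apply]
  · intro r hr
    have := Finset.mem_range.1 hr
    simp only [map_sub, map_mul, hz r this]
    simp

end YangianPlus

/-! ### Brackets of the inverse series: the sign `-` -/

section YangianMinus

open PowerSeries

variable {M N p : ℕ}

/-- The map `C ↦ ±{f, C}` on matrices, with the signs for which it is a derivation if `f` is of
parity `[a] + [b]`. -/
def matDer (f : WAlg M N p) (a b : Fin (M + N)) : WMat M N p →ₗ[ℂ] WMat M N p where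
  toFun C := Matrix.of fun c d =>
    pairSign (grade M N) a b c • diracBracketₗ M N p f (C c d)
  map_add' C D := by
    ext c d
    simp
  map_smul' r C := by
    ext c d
    simp [smul_comm r]

lemma matDer_apply (f : WAlg M N p) (a b : Fin (M + N)) (C : WMat M N p) (c d : Fin (M + N)) :
    matDer f a b C c d = pairSign (grade M N) a b c • diracBracket M N p f (C c d) := rfl

lemma diracBracket_eq_matDer (f : WAlg M N p) (a b : Fin (M + N)) (C : WMat M N p)
    (c d : Fin (M + N)) :
    diracBracket M N p f (C c d) = pairSign (grade M N) a b c • matDer f a b C c d := by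
  rw [matDer_apply, pairSign_smul_smul]

lemma matDer_mul {f : WAlg M N p} {a b : Fin (M + N)}
    (hf : Homog (parW M N p) (grade M N a + grade M N b) f) {C : WMat M N p}
    (hC : EvenMat (grade M N) C) (D : WMat M N p) :
    matDer f a b (C * D) = matDer f a b C * D + C * matDer f a b D := by
  ext c d
  rw [Matrix.add_apply, Matrix.mul_apply, Matrix.mul_apply]
  exact pairSign_smul_mul (F := diracBracketₗ M N p f) (diracBracket_mul_right hf) hC D c d

/-- The coefficientwise extension of `matDer` to power series. -/
def serDer (f : WAlg M N p) (a b : Fin (M + N)) (S : (WMat M N p)⟦X⟧) : (WMat M N p)⟦X⟧ :=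
  PowerSeries.mk fun n => matDer f a b (coeff n S)

lemma serDer_mul {f : WAlg M N p} {a b : Fin (M + N)}
    (hf : Homog (parW M N p) (grade M N a + grade M N b) f) {S : (WMat M N p)⟦X⟧}
    (hS : ∀ n, EvenMat (grade M N) (coeff n S)) (S' : (WMat M N p)⟦X⟧) :
    serDer f a b (S * S') = serDer f a b S * S' + S * serDer f a b S' := by
  ext1 n
  rw [serDer, coeff_mk, coeff_mul, map_sum, map_add, coeff_mul, coeff_mul,
    ← Finset.sum_add_distrib]
  refine Finset.sum_congr rfl fun x _ => ?_
  rw [matDer_mul hf (hS _), serDer, serDer, coeff_mk, coeff_mk]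

lemma serDer_one {f : WAlg M N p} {a b : Fin (M + N)}
    (hf : Homog (parW M N p) (grade M N a + grade M N b) f) :
    serDer f a b (1 : (WMat M N p)⟦X⟧) = 0 := by
  have h := serDer_mul hf (S := 1) (fun n => by
    rw [coeff_one]
    split_ifs
    exacts [EvenMat.one, EvenMat.zero]) 1
  rw [mul_one, one_mul, mul_one] at h
  exact left_eq_add.1 h

/-- Differentiate `S * D = 1` and multiply by `D` on the left. -/
lemma serDer_inverse {f : WAlg M N p} {a b : Fin (M + N)}
    (hf : Homog (parW M N p) (grade M N a + grade M N b) f) {S D : (WMat M N p)⟦X⟧}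
    (hS : ∀ n, EvenMat (grade M N) (coeff n S)) (h1 : S * D = 1) (h2 : D * S = 1) :
    serDer f a b D = -(D * serDer f a b S * D) := by
  have h := serDer_mul hf hS D
  rw [h1, serDer_one hf] at h
  have h3 := congrArg (D * ·) h
  simp only [mul_zero, mul_add, ← mul_assoc, h2, one_mul] at h3
  rw [eq_neg_iff_add_eq_zero, add_comm]
  exact h3.symm

lemma mul_single_mul_apply (A B : WMat M N p) (a b c d : Fin (M + N)) :
    (A * Matrix.single b a 1 * B : WMat M N p) c d = A c b * B a d := by
  rw [Matrix.mul_apply, Finset.sum_eq_single a]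
  · simp
  · intro e _ he
    rw [Matrix.mul_single_apply_of_ne _ _ _ _ _ he, zero_mul]
  · simp

variable (hp : 1 ≤ p)

variable (M N) in
/-- The generating series of the generators for the sign `+`. -/
def plusSeries : (WMat M N p)⟦X⟧ := wordSeries (plusCoeff hp) (signedGen M N p)

lemma coeff_plusSeries (n : ℕ) : coeff n (plusSeries M N hp) = plusGen M N hp n :=
  coeff_wordSeries _ _ _

variable (M N p) in
/-- The coefficients of the inverse of the generating series for the sign `+`. -/
def invGen (n : ℕ) : WMat M N p := coeff n (detSeries (signedGen M N p) p)

lemma evenMat_invGen (n : ℕ) : EvenMat (grade M N) (invGen M N p n) := by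
  rw [invGen, detSeries, coeff_wordSeries]
  exact EvenMat.wordSum evenMat_signedGen n

lemma matDer_plusGen (k l : ℕ) (a b : Fin (M + N)) :
    matDer (plusGen M N hp k a b) a b (plusGen M N hp l) = ∑ r ∈ Finset.range k,
      (plusGen M N hp r * Matrix.single b a 1 * plusGen M N hp (k + l - 1 - r) -
        plusGen M N hp (k + l - 1 - r) * Matrix.single b a 1 * plusGen M N hp r) := by
  ext c d
  rw [matDer_apply, diracBracket_plusGen, pairSign_smul_smul, Matrix.sum_apply]
  simp only [Matrix.sub_apply, mul_single_mul_apply]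

lemma serDer_plusGen_one (a b : Fin (M + N)) :
    serDer (plusGen M N hp 1 a b) a b (plusSeries M N hp) =
      C (Matrix.single b a 1) * plusSeries M N hp - plusSeries M N hp * C (Matrix.single b a 1) := by
  ext1 n
  rw [serDer, coeff_mk, map_sub, coeff_C_mul, coeff_mul_C, coeff_plusSeries, matDer_plusGen,
    Finset.sum_range_one, plusGen_zero, one_mul, mul_one, show 1 + n - 1 - 0 = n by omega]

/-- The terms `r = 0` of the Yangian relation carry the index raised by one, hence the factor `X`.
No correction appears in degree `0`, since the generator of index `0` is the unit matrix and
commutes with the matrix unit. -/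
lemma X_mul_serDer_plusGen_two (a b : Fin (M + N)) :
    X * serDer (plusGen M N hp 2 a b) a b (plusSeries M N hp) =
      C (Matrix.single b a 1) * plusSeries M N hp - plusSeries M N hp * C (Matrix.single b a 1) +
        X * (C (plusGen M N hp 1 * Matrix.single b a 1) * plusSeries M N hp -
          plusSeries M N hp * C (Matrix.single b a 1 * plusGen M N hp 1)) := by
  ext1 n
  cases n with
  | zero =>
    rw [map_add, map_sub, coeff_zero_X_mul, coeff_zero_X_mul, coeff_C_mul, coeff_mul_C,
      coeff_plusSeries, plusGen_zero]
    simp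
  | succ n =>
    rw [map_add, map_sub, coeff_succ_X_mul, coeff_succ_X_mul, coeff_C_mul, coeff_mul_C, map_sub,
      coeff_C_mul, coeff_mul_C, serDer, coeff_mk, coeff_plusSeries, coeff_plusSeries,
      matDer_plusGen, Finset.sum_range_succ, Finset.sum_range_one, plusGen_zero, one_mul, mul_one,
      show 2 + n - 1 - 0 = n + 1 by omega, show 2 + n - 1 - 1 = n by omega, mul_assoc (plusGen _ _ _ n)]

lemma evenMat_coeff_plusSeries (n : ℕ) : EvenMat (grade M N) (coeff n (plusSeries M N hp)) := by
  rw [coeff_plusSeries]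
  exact evenMat_plusGen hp n

lemma matDer_plusGen_one_invGen (n : ℕ) (a b : Fin (M + N)) :
    matDer (plusGen M N hp 1 a b) a b (invGen M N p n) =
      Matrix.single b a 1 * invGen M N p n - invGen M N p n * Matrix.single b a 1 := by
  have h1 : plusSeries M N hp * detSeries (signedGen M N p) p = 1 := plusSeries_mul_detSeries hp _
  have h2 : detSeries (signedGen M N p) p * plusSeries M N hp = 1 := detSeries_mul_plusSeries hp _
  have h := serDer_inverse (evenMat_plusGen hp 1 a b) (evenMat_coeff_plusSeries hp) h1 h2
  rw [serDer_plusGen_one, mul_sub, sub_mul, ← mul_assoc, ← mul_assoc, h2, one_mul, mul_assoc _ _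
    (detSeries _ _), h1, mul_one, neg_sub] at h
  have h3 := congrArg (coeff n) h
  rwa [map_sub, coeff_C_mul, coeff_mul_C, serDer, coeff_mk] at h3

lemma matDer_plusGen_two_invGen (n : ℕ) (a b : Fin (M + N)) :
    matDer (plusGen M N hp 2 a b) a b (invGen M N p n) =
      Matrix.single b a 1 * invGen M N p (n + 1) - invGen M N p (n + 1) * Matrix.single b a 1 +
        (Matrix.single b a 1 * plusGen M N hp 1 * invGen M N p n -
          invGen M N p n * (plusGen M N hp 1 * Matrix.single b a 1)) := by
  have h1 : plusSeries M N hp * detSeries (signedGen M N p) p = 1 := plusSeries_mul_detSeries hp _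
  have h2 : detSeries (signedGen M N p) p * plusSeries M N hp = 1 := detSeries_mul_plusSeries hp _
  have h : X * serDer (plusGen M N hp 2 a b) a b (detSeries (signedGen M N p) p) =
      -(detSeries (signedGen M N p) p * (X * serDer (plusGen M N hp 2 a b) a b
        (plusSeries M N hp)) * detSeries (signedGen M N p) p) := by
    rw [serDer_inverse (evenMat_plusGen hp 2 a b) (evenMat_coeff_plusSeries hp) h1 h2, mul_neg,
      ← mul_assoc, ← mul_assoc, ← mul_assoc, X_mul]
  have hs : ∀ A B : (WMat M N p)⟦X⟧, detSeries (signedGen M N p) p *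
      (A * plusSeries M N hp - plusSeries M N hp * B) * detSeries (signedGen M N p) p =
        detSeries (signedGen M N p) p * A - B * detSeries (signedGen M N p) p := by
    intro A B
    rw [mul_sub, sub_mul, ← mul_assoc, ← mul_assoc, h2, one_mul, mul_assoc _ _
      (detSeries _ _), h1, mul_one]
  rw [X_mul_serDer_plusGen_two, mul_add, add_mul, hs, ← mul_assoc _ X, ← X_mul,
    mul_assoc X, mul_assoc X, hs] at h
  have h3 := congrArg (coeff (n + 1)) h
  rw [coeff_succ_X_mul, map_neg, map_add, coeff_succ_X_mul, map_sub, map_sub, coeff_C_mul,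
    coeff_C_mul, coeff_mul_C, coeff_mul_C, serDer, coeff_mk] at h3
  refine h3.trans ?_
  simp only [invGen]
  abel

lemma invGen_zero : invGen M N p 0 = 1 := by
  rw [invGen, detSeries, coeff_wordSeries, wordSum_rec]
  simp [detCoeff]

lemma invGen_one : invGen M N p 1 = -plusGen M N hp 1 := by
  have h1 : plusSeries M N hp * detSeries (signedGen M N p) p = 1 := plusSeries_mul_detSeries hp _
  have h := congrArg (coeff 1) h1
  rw [coeff_mul, Finset.Nat.sum_antidiagonal_eq_sum_range_succ_mk] at h
  have h0 : coeff 0 (detSeries (signedGen M N p) p) = 1 := invGen_zero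
  simp [Finset.sum_range_succ, -coeff_zero_eq_constantCoeff, coeff_plusSeries, coeff_one,
    plusGen_zero, h0] at h
  exact eq_neg_of_add_eq_zero_left h

lemma invGen_two : invGen M N p 2 = plusGen M N hp 1 * plusGen M N hp 1 - plusGen M N hp 2 := by
  have h1 : plusSeries M N hp * detSeries (signedGen M N p) p = 1 := plusSeries_mul_detSeries hp _
  have h := congrArg (coeff 2) h1
  rw [coeff_mul, Finset.Nat.sum_antidiagonal_eq_sum_range_succ_mk] at h
  have h0 : coeff 0 (detSeries (signedGen M N p) p) = 1 := invGen_zero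
  have h2 : coeff 1 (detSeries (signedGen M N p) p) = _ := invGen_one hp
  simp [Finset.sum_range_succ, -coeff_zero_eq_constantCoeff, coeff_plusSeries, coeff_one,
    plusGen_zero, h0, h2] at h
  rw [invGen, sub_eq_add_neg, ← sub_eq_zero, ← h]
  abel

variable (M N p) in
/-- The matrices of the generators for the sign `-`, the unit matrix being the one of index `0`. -/
def minusGen (n : ℕ) : WMat M N p := wordSum minusCoeff (signedGen M N p) n

lemma minusGen_eq (n : ℕ) : minusGen M N p n = (-1 : ℂ) ^ n • invGen M N p n :=
  wordSum_minusCoeff _ _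

lemma minusGen_one : minusGen M N p 1 = plusGen M N hp 1 := by
  rw [minusGen_eq, invGen_one hp]
  simp

lemma diracBracket_invGen_one (l : ℕ) (a b c d : Fin (M + N)) :
    diracBracket M N p (plusGen M N hp 1 a b) (invGen M N p l c d) =
      pairSign (grade M N) a b c • ((1 : WMat M N p) c b * invGen M N p l a d -
        invGen M N p l c b * (1 : WMat M N p) a d) := by
  rw [diracBracket_eq_matDer _ a b, matDer_plusGen_one_invGen]
  congr 1
  have h := mul_single_mul_apply (1 : WMat M N p) (invGen M N p l) a b c d
  have h2 := mul_single_mul_apply (invGen M N p l) (1 : WMat M N p) a b c d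
  rw [one_mul] at h
  rw [mul_one] at h2
  rw [Matrix.sub_apply, h, h2]

lemma diracBracket_plusGen_two_invGen (l : ℕ) (a b c d : Fin (M + N)) :
    diracBracket M N p (plusGen M N hp 2 a b) (invGen M N p l c d) =
      pairSign (grade M N) a b c • ((1 : WMat M N p) c b * invGen M N p (l + 1) a d -
        invGen M N p (l + 1) c b * (1 : WMat M N p) a d +
        ((1 : WMat M N p) c b * (plusGen M N hp 1 * invGen M N p l) a d -
          (invGen M N p l * plusGen M N hp 1) c b * (1 : WMat M N p) a d)) := by
  rw [diracBracket_eq_matDer _ a b, matDer_plusGen_two_invGen]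
  congr 1
  have h := mul_single_mul_apply (1 : WMat M N p) (invGen M N p (l + 1)) a b c d
  have h2 := mul_single_mul_apply (invGen M N p (l + 1)) (1 : WMat M N p) a b c d
  have h3 := mul_single_mul_apply (1 : WMat M N p) (plusGen M N hp 1 * invGen M N p l) a b c d
  have h4 := mul_single_mul_apply (invGen M N p l * plusGen M N hp 1) (1 : WMat M N p) a b c d
  rw [one_mul] at h h3
  rw [mul_one] at h2 h4
  rw [← mul_assoc] at h3
  rw [mul_assoc (invGen M N p l)] at h4
  rw [Matrix.add_apply, Matrix.sub_apply, Matrix.sub_apply, h, h2, h3, h4]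

/-- The coefficient of index `2` of the inverse is `T_1² - T_2`, with `T_n = plusGen n`. In the
difference of the two brackets the terms containing the matrix products of `T_1` with the
coefficient `l` cancel, and only the products of entries remain. The sign of the linear term is
absorbed by `(-1)^l` in `minusGen`. -/
lemma diracBracket_invGen_two (l : ℕ) (a b c d : Fin (M + N)) :
    diracBracket M N p (invGen M N p 2 a b) (invGen M N p l c d) =
      pairSign (grade M N) a b c • (-((1 : WMat M N p) c b * invGen M N p (l + 1) a d -
        invGen M N p (l + 1) c b * (1 : WMat M N p) a d) +
        (plusGen M N hp 1 c b * invGen M N p l a d -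
          invGen M N p l c b * plusGen M N hp 1 a d)) := by
  have h := bracket_mul_left_formula (F := (diracBracketₗ M N p).flip (invGen M N p l c d))
    (diracBracket_mul_left (evenMat_invGen l c d)) (I := Finset.range 1)
    (fun _ => EvenMat.one) (fun _ => evenMat_invGen l) (evenMat_plusGen hp 1)
    (evenMat_plusGen hp 1) (evenMat_invGen l)
    (fun a b => by rw [Finset.sum_range_one]; exact diracBracket_invGen_one hp l a b c d)
    (fun a b => diracBracket_invGen_one hp l a b c d) a b
  rw [Finset.sum_range_one, one_mul] at h
  rw [invGen_two hp, Matrix.sub_apply, ← diracBracketₗ_apply, map_sub, LinearMap.sub_apply,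
    diracBracketₗ_apply, diracBracketₗ_apply, diracBracket_plusGen_two_invGen]
  refine (congrArg (· - _) h).trans ?_
  rw [← smul_sub]
  congr 1
  abel

lemma diracBracket_minusGen_one (hp : 1 ≤ p) (l : ℕ) (a b c d : Fin (M + N)) :
    diracBracket M N p (minusGen M N p 1 a b) (minusGen M N p l c d) =
      pairSign (grade M N) a b c • ((1 : WMat M N p) c b * minusGen M N p l a d -
        minusGen M N p l c b * (1 : WMat M N p) a d) := by
  rw [minusGen_one hp, minusGen_eq, Matrix.smul_apply, ← diracBracketₗ_apply, map_smul,
    diracBracketₗ_apply, diracBracket_invGen_one, smul_comm]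
  simp only [Matrix.smul_apply, mul_smul_comm, smul_mul_assoc, smul_sub]

lemma diracBracket_minusGen_two (hp : 1 ≤ p) (l : ℕ) (a b c d : Fin (M + N)) :
    diracBracket M N p (minusGen M N p 2 a b) (minusGen M N p l c d) =
      pairSign (grade M N) a b c • ((1 : WMat M N p) c b * minusGen M N p (l + 1) a d -
        minusGen M N p (l + 1) c b * (1 : WMat M N p) a d +
        (minusGen M N p 1 c b * minusGen M N p l a d -
          minusGen M N p l c b * minusGen M N p 1 a d)) := by
  rw [minusGen_one hp, minusGen_eq 2, neg_one_sq, one_smul, minusGen_eq, minusGen_eq,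
    Matrix.smul_apply, ← diracBracketₗ_apply, map_smul, diracBracketₗ_apply,
    diracBracket_invGen_two hp, smul_comm]
  simp only [Matrix.smul_apply, pow_succ, mul_one, neg_smul, mul_neg, neg_mul,
    mul_smul_comm, smul_mul_assoc, smul_sub, smul_add, smul_neg]
  abel

end YangianMinus

/-! ### From matrix relations to the families of the statement -/

section YangianFamilies

variable {M N p : ℕ}

lemma wordSum_zero {q : ℕ} {R : Type} [Ring R] [Algebra ℂ R] (α : List (Fin q) → ℂ)
    (U : Fin q → R) : wordSum α U 0 = algebraMap ℂ R (α []) := by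
  rw [wordSum_rec]
  simp

lemma wordSum_one {R : Type} [Ring R] [Algebra ℂ R] (hp : 1 ≤ p) (α : List (Fin p) → ℂ)
    (U : Fin p → R) : wordSum α U 1 = α [firstIdx hp] • U (firstIdx hp) := by
  rw [wordSum_rec, if_neg one_ne_zero, zero_add, Finset.sum_eq_single (firstIdx hp)]
  · rw [if_pos le_rfl, show 1 - (((firstIdx hp : Fin p) : ℕ) + 1) = 0 by simp, wordSum_zero,
      Algebra.smul_def, Algebra.commutes]
  · intro a _ ha
    rw [if_neg]
    intro h
    exact ha (Fin.ext (by simp; omega))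
  · simp

lemma wordSum_two {R : Type} [Ring R] [Algebra ℂ R] (hp : 1 ≤ p) (α : List (Fin p) → ℂ)
    (U : Fin p → R) : wordSum α U 2 =
      α [firstIdx hp, firstIdx hp] • (U (firstIdx hp) * U (firstIdx hp)) +
        if h : 1 < p then α [⟨1, h⟩] • U ⟨1, h⟩ else 0 := by
  have h0 : (2 : ℕ) - (((firstIdx hp : Fin p) : ℕ) + 1) = 1 := by simp
  rw [wordSum_rec, if_neg two_ne_zero, zero_add, ← Finset.add_sum_erase _ _
    (Finset.mem_univ (firstIdx hp)), if_pos (by simp), h0, wordSum_one hp, mul_smul_comm]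
  congr 1
  split_ifs with h
  · rw [Finset.sum_eq_single ⟨1, h⟩]
    · rw [if_pos (by simp), show 2 - (((⟨1, h⟩ : Fin p) : ℕ) + 1) = 0 by simp, wordSum_zero,
        Algebra.smul_def, Algebra.commutes]
    · intro a ha ha'
      rw [if_neg]
      intro h'
      have h1 : (a : ℕ) ≠ 0 := fun h0 => (Finset.ne_of_mem_erase ha) (Fin.ext h0)
      exact ha' (Fin.ext (by dsimp only; omega))
    · intro h'
      exact absurd (Finset.mem_erase.2 ⟨by simp [Fin.ext_iff], Finset.mem_univ _⟩) h'
  · refine Finset.sum_eq_zero fun a ha => ?_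
    have h1 : (a : ℕ) ≠ 0 := fun h0 => (Finset.ne_of_mem_erase ha) (Fin.ext h0)
    have := a.2
    omega

lemma smul_pairSign_smul_one_sub (A : WMat M N p) (a b c d : Fin (M + N)) :
    (-1 : ℂ) ^ grade M N b • (-1 : ℂ) ^ grade M N d • pairSign (grade M N) a b c •
      ((1 : WMat M N p) c b * A a d - A c b * (1 : WMat M N p) a d) =
      (if c = b then (-1 : ℂ) ^ grade M N d • A a d else 0) -
        (-1 : ℂ) ^ ((grade M N a + grade M N b) * (grade M N c + grade M N d)) •
          (if a = d then (-1 : ℂ) ^ grade M N b • A c b else 0) := by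
  rw [Matrix.one_apply, Matrix.one_apply, smul_sub, smul_sub, smul_sub, pairSign]
  congr 1
  · split_ifs with h
    · subst h
      rw [one_mul, smul_smul, smul_smul]
      congr 1
      rw [← pow_add, ← pow_add]
      refine neg_one_pow_congr ?_
      rcases Nat.mod_two_eq_zero_or_one (grade M N a) with h | h <;>
        rcases Nat.mod_two_eq_zero_or_one (grade M N c) with h' | h' <;>
          rcases Nat.mod_two_eq_zero_or_one (grade M N d) with h'' | h'' <;>
            simp [Nat.add_mod, Nat.mul_mod, h, h', h'']
    · simp
  · split_ifs with h
    · subst h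
      rw [mul_one, smul_smul, smul_smul, smul_smul]
      congr 1
      rw [← pow_add, ← pow_add, ← pow_add]
      refine neg_one_pow_congr ?_
      rcases Nat.mod_two_eq_zero_or_one (grade M N a) with h | h <;>
        rcases Nat.mod_two_eq_zero_or_one (grade M N b) with h' | h' <;>
          rcases Nat.mod_two_eq_zero_or_one (grade M N c) with h'' | h'' <;>
            simp [Nat.add_mod, Nat.mul_mod, h, h', h'']
    · simp

/-- The family index is one less than the degree of words, so the brackets with `W̄_0` and `W̄_1`
are the relations in degrees `1` and `2`. Only the words `0`, `00` and `1` enter the initial values.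
-/
lemma isYangianFamily_of_relations (hp : 1 ≤ p) (ε : ℤˣ) (α : List (Fin p) → ℂ)
    (h0 : α [firstIdx hp] = p)
    (h00 : α [firstIdx hp, firstIdx hp] = (p : ℂ) * (p + ((ε : ℤ) : ℂ)) / 2)
    (h1 : ∀ h : 1 < p, α [⟨1, h⟩] = ((ε : ℤ) : ℂ) * (p * ((p : ℂ) ^ 2 - 1) / 6))
    (hone : ∀ l a b c d, diracBracket M N p (wordSum α (signedGen M N p) 1 a b)
      (wordSum α (signedGen M N p) l c d) = pairSign (grade M N) a b c •
        ((1 : WMat M N p) c b * wordSum α (signedGen M N p) l a d -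
          wordSum α (signedGen M N p) l c b * (1 : WMat M N p) a d))
    (htwo : ∀ l a b c d, diracBracket M N p (wordSum α (signedGen M N p) 2 a b)
      (wordSum α (signedGen M N p) l c d) = pairSign (grade M N) a b c •
        ((1 : WMat M N p) c b * wordSum α (signedGen M N p) (l + 1) a d -
          wordSum α (signedGen M N p) (l + 1) c b * (1 : WMat M N p) a d +
        (wordSum α (signedGen M N p) 1 c b * wordSum α (signedGen M N p) l a d -
          wordSum α (signedGen M N p) l c b * wordSum α (signedGen M N p) 1 a d))) :
    IsYangianFamily M N p ε (toCoeffs α) := by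
  have hs : ∀ s : Fin p, ∀ a b, (-1 : ℂ) ^ grade M N b • signedGen M N p s a b =
      Wgen M N p s a b := by
    intro s a b
    rw [signedGen, ← apply_eq_mul_signMatrix]
  refine ⟨fun a b => ?_, fun a b => ?_, fun j _ a b c d => ?_, fun j a b c d => ?_⟩
  · rw [Wbar_apply, wordSum_one hp, h0, Matrix.smul_apply, smul_comm, hs]
  · rw [Wbar_apply, wordSum_two hp, h00, Matrix.add_apply, smul_add, add_comm]
    congr 1
    · split_ifs with h
      · rw [h1 h, Matrix.smul_apply, smul_comm, hs]
      -- For `p = 1` there is no letter `1`, in agreement with the convention that `W_1` is then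
      -- zero.
      · rw [Wgen, Matrix.of_apply, dif_neg h]
        simp
    · rw [Matrix.smul_apply, smul_comm]
      congr 1
      rw [Matrix.mul_apply, Finset.smul_sum]
      refine Finset.sum_congr rfl fun e _ => ?_
      rw [← mul_smul_comm, hs, signedGen, mul_signMatrix_apply, smul_mul_assoc]
  · rw [Wbar_apply, Wbar_apply, ← diracBracketₗ_apply, map_smul, map_smul, LinearMap.smul_apply,
      diracBracketₗ_apply, htwo, smul_comm, smul_add, smul_add, smul_add,
      smul_pairSign_smul_one_sub]
    simp only [Wbar_apply, pairSign]
    congr 1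
    simp only [smul_mul_smul_comm, smul_sub, smul_smul]
    congr 2 <;> ring
  · rw [Wbar_apply, Wbar_apply, ← diracBracketₗ_apply, map_smul, map_smul, LinearMap.smul_apply,
      diracBracketₗ_apply, hone, smul_comm, smul_pairSign_smul_one_sub]
    simp only [Wbar_apply]

/-- The coefficients of the words for both signs. -/
def signCoeff (hp : 1 ≤ p) (ε : ℤˣ) : List (Fin p) → ℂ := if ε = 1 then plusCoeff hp else minusCoeff

lemma signCoeff_one (hp : 1 ≤ p) : signCoeff hp 1 = plusCoeff hp := if_pos rfl

lemma signCoeff_neg_one (hp : 1 ≤ p) : signCoeff hp (-1) = minusCoeff := if_neg (by decide)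

lemma signCoeff_singleton (hp : 1 ≤ p) (ε : ℤˣ) (j : Fin p) : signCoeff hp ε [j] =
    ((ε : ℤ) : ℂ) ^ (j : ℕ) * ((j : ℕ).factorial : ℂ) ^ 2 * ((p + j).choose (2 * j + 1) : ℂ) := by
  rcases Int.units_eq_one_or ε with rfl | rfl
  · rw [signCoeff_one, plusCoeff_singleton]
    simp
  · rw [signCoeff_neg_one, minusCoeff, detCoeff_singleton]
    simp [wordDeg, pow_succ]
    ring

lemma minusCoeff_replicate (hp : 1 ≤ p) (n : ℕ) :
    minusCoeff (List.replicate n (firstIdx hp)) = (p.choose n : ℂ) := by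
  rw [minusCoeff, detCoeff_replicate, wordDeg_replicate, ← mul_assoc, neg_one_pow_mul_self,
    one_mul]

theorem isYangianFamily_signCoeff (hp : 1 ≤ p) (ε : ℤˣ) :
    IsYangianFamily M N p ε (toCoeffs (signCoeff hp ε)) := by
  have hsing := signCoeff_singleton hp ε
  have h2 : ((2 : ℕ) : ℂ) = 2 := by norm_num
  refine isYangianFamily_of_relations hp ε _ ?_ ?_ ?_ ?_ ?_
  · rw [hsing]
    simp
  · rcases Int.units_eq_one_or ε with rfl | rfl
    · have h := plusCoeff_replicate hp 2
      rw [Nat.cast_choose_two, show p - 1 + 2 = p + 1 by omega] at h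
      rw [signCoeff_one]
      refine h.trans ?_
      push_cast
      ring
    · have h := minusCoeff_replicate hp 2
      rw [Nat.cast_choose_two] at h
      rw [signCoeff_neg_one]
      refine h.trans ?_
      push_cast
      ring
  · intro h
    rw [hsing]
    have h3 : (((p + 1).choose 3 : ℕ) : ℂ) = (p + 1) * p * (p - 1) / 6 := by
      have h4 := congrArg (Nat.cast (R := ℂ)) (Nat.add_one_mul_choose_eq p 2)
      push_cast at h4
      rw [Nat.cast_choose_two] at h4
      linear_combination -h4 / 3
    simp [h3]
    ring
  · rcases Int.units_eq_one_or ε with rfl | rfl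
    · intro l a b c d
      have h := diracBracket_plusGen hp 1 l a b c d
      rw [Finset.sum_range_one, plusGen_zero, show 1 + l - 1 - 0 = l by omega] at h
      rw [signCoeff_one]
      exact h
    · rw [signCoeff_neg_one]
      exact diracBracket_minusGen_one hp
  · rcases Int.units_eq_one_or ε with rfl | rfl
    · intro l a b c d
      have h := diracBracket_plusGen hp 2 l a b c d
      rw [Finset.sum_range_succ, Finset.sum_range_one, plusGen_zero,
        show 2 + l - 1 - 0 = l + 1 by omega, show 2 + l - 1 - 1 = l by omega] at h
      rw [signCoeff_one]
      exact h
    · rw [signCoeff_neg_one]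
      exact diracBracket_minusGen_two hp

end YangianFamilies

/-! ### Triangular systems and inversion in terms of words -/

section WordLemmas

variable {p : ℕ} {R : Type} [Ring R] [Algebra ℂ R]

lemma map_wordSum {R' : Type} [Ring R'] [Algebra ℂ R'] (f : R →ₐ[ℂ] R') (α : List (Fin p) → ℂ)
    (U : Fin p → R) (k : ℕ) : f (wordSum α U k) = wordSum α (fun s => f (U s)) k := by
  rw [wordSum, map_sum]
  refine Finset.sum_congr rfl fun n _ => ?_
  rw [map_sum]
  refine Finset.sum_congr rfl fun s _ => ?_
  rw [apply_ite f, map_zero, map_smul, map_list_prod, List.map_ofFn]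
  rfl

lemma wordSum_eq_of_eq_below (α : List (Fin p) → ℂ) {U V : Fin p → R} {k : ℕ}
    (h : ∀ s : Fin p, (s : ℕ) < k → U s = V s) : wordSum α U k = wordSum α V k := by
  refine Finset.sum_congr rfl fun n _ => Finset.sum_congr rfl fun s _ => ?_
  split_ifs with hs
  · congr 3
    funext i
    refine h _ ?_
    have := Finset.single_le_sum (f := fun i => (s i : ℕ) + 1) (fun _ _ => Nat.zero_le _)
      (Finset.mem_univ i)
    omega
  · rfl

lemma wordSum_of_eq_zero (hp : 1 ≤ p) (α : List (Fin p) → ℂ) {U : Fin p → R}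
    (hU : ∀ s, s ≠ firstIdx hp → U s = 0) (k : ℕ) :
    wordSum α U k = α (List.replicate k (firstIdx hp)) • U (firstIdx hp) ^ k := by
  induction k generalizing α with
  | zero => rw [wordSum_zero, Algebra.algebraMap_eq_smul_one, List.replicate_zero, pow_zero]
  | succ k ih =>
    rw [wordSum_rec, if_neg (Nat.succ_ne_zero k), zero_add, Finset.sum_eq_single (firstIdx hp)]
    · rw [if_pos (by simp), show k + 1 - (((firstIdx hp : Fin p) : ℕ) + 1) = k by simp, ih,
        mul_smul_comm, ← pow_succ', List.replicate_succ]
    · intro s _ hs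
      rw [hU s hs]
      simp
    · simp

/-- The contribution of the letter of highest degree. -/
lemma wordSum_succ_eq (α : List (Fin p) → ℂ) (U : Fin p → R) (j : Fin p) :
    wordSum α U (j + 1) = α [j] • U j +
      wordSum α (fun s => if s < j then U s else 0) (j + 1) := by
  rw [wordSum_rec, wordSum_rec α (fun s => if s < j then U s else 0), if_neg (Nat.succ_ne_zero _),
    zero_add, zero_add, ← Finset.add_sum_erase _ _ (Finset.mem_univ j),
    ← Finset.sum_erase Finset.univ (a := j) (by simp), if_pos le_rfl, Nat.sub_self, wordSum_zero,
    ← Algebra.commutes, ← Algebra.smul_def]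
  congr 1
  refine Finset.sum_congr rfl fun a ha => ?_
  have hne := Finset.ne_of_mem_erase ha
  split_ifs with h h'
  · congr 1
    refine wordSum_eq_of_eq_below _ fun s hs => ?_
    rw [if_pos]
    rw [Fin.lt_def]
    omega
  · exact absurd (lt_of_le_of_ne (Fin.le_def.2 (by omega)) hne) h'
  · rfl

/-- In degree `j+1` the letter `j` occurs only as a word by itself, with invertible coefficient, and
all other words use smaller letters. The system is triangular. -/
lemma eq_of_wordSum_eq {α : List (Fin p) → ℂ} (hα : ∀ j, α [j] ≠ 0) {U V : Fin p → R}
    (h : ∀ j : Fin p, wordSum α U (j + 1) = wordSum α V (j + 1)) : U = V := by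
  funext j
  induction j using WellFoundedLT.induction with
  | ind j ih =>
    have hj := h j
    rw [wordSum_succ_eq, wordSum_succ_eq α V] at hj
    have e : (fun s => if s < j then U s else 0) = fun s => if s < j then V s else 0 := by
      funext s
      split_ifs with hs
      exacts [ih s hs, rfl]
    rw [e, add_left_inj] at hj
    exact smul_right_injective R (hα j) hj

/-- The first `m` components `wordSum α V (j + 1)` can be prescribed. -/
lemma exists_wordSum_eq {α : List (Fin p) → ℂ} (hα : ∀ j, α [j] ≠ 0) {P : R → Prop} (h0 : P 0)
    (hP : ∀ V : Fin p → R, (∀ s, P (V s)) → ∀ u, P u → ∀ (r : ℂ) k, P (r • (u - wordSum α V k)))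
    {U : Fin p → R} (hU : ∀ s, P (U s)) :
    ∃ V : Fin p → R, (∀ s, P (V s)) ∧ ∀ j : Fin p, wordSum α V (j + 1) = U j := by
  have key : ∀ m : ℕ, ∃ V : Fin p → R, (∀ s, P (V s)) ∧
      ∀ j : Fin p, (j : ℕ) < m → wordSum α V (j + 1) = U j := by
    intro m
    induction m with
    | zero => exact ⟨0, fun _ => h0, fun _ hj => absurd hj (Nat.not_lt_zero _)⟩
    | succ m ih =>
      obtain ⟨V, hV, hVU⟩ := ih
      by_cases hm : m < p
      · let V₀ : Fin p → R := fun s => if s < ⟨m, hm⟩ then V s else 0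
        have hV₀ : ∀ s, P (V₀ s) := fun s => by
          dsimp only [V₀]
          split_ifs
          exacts [hV s, h0]
        -- The solution of the equation in degree `m+1`, which is linear in the new letter once the
        -- smaller ones are fixed.
        let v : R := (α [⟨m, hm⟩])⁻¹ • (U ⟨m, hm⟩ - wordSum α V₀ (m + 1))
        refine ⟨Function.update V₀ ⟨m, hm⟩ v, fun s => ?_, fun j hj => ?_⟩
        · by_cases hs : s = ⟨m, hm⟩
          · rw [hs, Function.update_self]
            exact hP V₀ hV₀ _ (hU _) _ _
          · rw [Function.update_of_ne hs]
            exact hV₀ s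
        · rcases Nat.lt_succ_iff_lt_or_eq.1 hj with hj' | hj'
          · rw [← hVU j hj']
            refine wordSum_eq_of_eq_below _ fun s hs => ?_
            have hsm : (s : ℕ) < m := by omega
            rw [Function.update_of_ne (fun h => by rw [h] at hsm; exact lt_irrefl _ hsm)]
            exact if_pos (Fin.lt_def.2 hsm)
          · obtain rfl : j = ⟨m, hm⟩ := Fin.ext hj'
            rw [wordSum_succ_eq, Function.update_self]
            have e : (fun s => if s < ⟨m, hm⟩ then Function.update V₀ ⟨m, hm⟩ v s else 0) = V₀ := by
              funext s
              dsimp only [V₀]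
              split_ifs with hs
              · rw [Function.update_of_ne hs.ne, if_pos hs]
              · rfl
            rw [e, smul_smul, mul_inv_cancel₀ (hα _), one_smul, sub_add_cancel]
      · exact ⟨V, hV, fun j _ => hVU j (by omega)⟩
  obtain ⟨V, hV, h⟩ := key p
  exact ⟨V, hV, fun j => h j j.2⟩

/-- A series as the inverse of its inverse, in terms of words in the coefficients. -/
lemma wordSum_alternating {V Z : ℕ → R} (hV : V 0 = 1)
    (h : ∀ k, ∑ i ∈ Finset.range (k + 1), (-1 : ℂ) ^ i • (V i * Z (k - i)) =
      if k = 0 then 1 else 0) {q k : ℕ} (hk : k ≤ q) :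
    wordSum (fun l : List (Fin q) => (-1) ^ (wordDeg l + l.length)) (fun s => V (s + 1)) k =
      Z k := by
  induction k using Nat.strong_induction_on with
  | _ k ih =>
    have h1 := h k
    rw [Finset.sum_range_succ', hV, pow_zero, one_smul, one_mul, Nat.sub_zero] at h1
    rw [add_comm, ← eq_sub_iff_add_eq] at h1
    rw [wordSum_rec, h1, sub_eq_add_neg]
    congr 1
    · split_ifs <;> simp [wordDeg]
    -- A first letter `a` adds `a+1` to the degree and `1` to the length, hence the sign `(-1)^a`.
    -- This is the sign of the term `i = a+1` when the relation is solved for `Z k`.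
    · have e : ∀ a : Fin q, (a : ℕ) + 1 ≤ k → wordSum (fun l : List (Fin q) =>
          (-1 : ℂ) ^ (wordDeg (a :: l) + (a :: l).length)) (fun s => V (s + 1)) (k - (a + 1)) =
            (-1 : ℂ) ^ (a : ℕ) • Z (k - (a + 1)) := by
        intro a ha
        rw [← ih (k - (a + 1)) (by omega) (by omega), ← coeff_wordSeries, Algebra.smul_def,
          ← coeff_wordSeries, ← PowerSeries.coeff_C_mul, ← wordSeries_smul, coeff_wordSeries,
          coeff_wordSeries]
        refine wordSum_congr _ _ fun l _ => ?_
        rw [← pow_add]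
        refine neg_one_pow_congr ?_
        simp only [wordDeg, List.map_cons, List.sum_cons, List.length_cons]
        omega
      have e2 : ∀ g : ℕ → R, ∑ i ∈ Finset.range k, g i =
          ∑ a : Fin q, if (a : ℕ) + 1 ≤ k then g a else 0 := by
        intro g
        rw [Fin.sum_univ_eq_sum_range (fun i => if i + 1 ≤ k then g i else 0) q,
          ← Finset.sum_filter]
        congr 1
        ext i
        simp
        omega
      rw [e2, ← Finset.sum_neg_distrib]
      refine Finset.sum_congr rfl fun a _ => ?_
      split_ifs with ha
      · rw [e a ha, mul_smul_comm, pow_succ, mul_neg_one, neg_smul, neg_neg]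
      · rw [neg_zero]

end WordLemmas

/-! ### The exact degree, detected over the dual numbers -/

section Degrees

variable {X : Type} {par : X → ℕ}

lemma degreeLE_mono {m n : ℕ} (h : m ≤ n) : degreeLE par m ≤ degreeLE par n :=
  Submodule.span_mono fun _ ⟨l, hl, hf⟩ => ⟨l, hl.trans h, hf⟩

lemma one_mem_degreeLE : (1 : SuperPoly par) ∈ degreeLE par 0 :=
  Submodule.subset_span ⟨[], le_rfl, rfl⟩

lemma gen_mem_degreeLE (x : X) : gen par x ∈ degreeLE par 1 :=
  Submodule.subset_span ⟨[x], le_rfl, by simp⟩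

lemma mul_mem_degreeLE {m n : ℕ} {f g : SuperPoly par} (hf : f ∈ degreeLE par m)
    (hg : g ∈ degreeLE par n) : f * g ∈ degreeLE par (m + n) := by
  have h := Submodule.mul_mem_mul hf hg
  rw [degreeLE, degreeLE, Submodule.span_mul_span] at h
  refine Submodule.span_mono ?_ h
  rintro _ ⟨_, ⟨l, hl, rfl⟩, _, ⟨l', hl', rfl⟩, rfl⟩
  exact ⟨l ++ l', by rw [List.length_append]; omega, by simp⟩

variable {M N p : ℕ}

lemma wordSum_mem_degreeLE {U : Fin p → WMat M N p}
    (hU : ∀ s a b, U s a b ∈ degreeLE (parW M N p) 1) (α : List (Fin p) → ℂ) (k : ℕ)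
    (a b : Fin (M + N)) : wordSum α U k a b ∈ degreeLE (parW M N p) k := by
  induction k using Nat.strong_induction_on generalizing α a with
  | _ k ih =>
    rw [wordSum_rec, Matrix.add_apply, Matrix.sum_apply]
    refine Submodule.add_mem _ ?_ (Submodule.sum_mem _ fun s _ => ?_)
    · split_ifs with h
      · rw [Algebra.algebraMap_eq_smul_one, Matrix.smul_apply, Matrix.one_apply]
        refine Submodule.smul_mem _ _ ?_
        split_ifs
        · exact degreeLE_mono (Nat.zero_le _) one_mem_degreeLE
        · exact Submodule.zero_mem _
      · exact Submodule.zero_mem _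
    · split_ifs with h
      · rw [Matrix.mul_apply]
        refine Submodule.sum_mem _ fun c _ => ?_
        exact degreeLE_mono (by omega) (mul_mem_degreeLE (hU s a c) (ih _ (by omega) _ c))
      · exact Submodule.zero_mem _

lemma signedGen_mem_degreeLE (s : Fin p) (a b : Fin (M + N)) :
    signedGen M N p s a b ∈ degreeLE (parW M N p) 1 := by
  rw [signedGen, mul_signMatrix_apply, Wgen_apply]
  exact Submodule.smul_mem _ _ (gen_mem_degreeLE _)

lemma Wbar_mem_degreeLE (α : List (Fin p) → ℂ) (j : ℕ) (a b : Fin (M + N)) :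
    Wbar M N p (toCoeffs α) j a b ∈ degreeLE (parW M N p) (j + 1) := by
  rw [Wbar_apply]
  exact Submodule.smul_mem _ _ (wordSum_mem_degreeLE signedGen_mem_degreeLE _ _ _ _)

variable {D : Type} [CommRing D] [Algebra ℂ D] {η : D} (hη : η * η = 0)

variable (η) in
/-- The values of the generators in the detection of the top degree. -/
def topValue (x : WIndex M N p) : D :=
  if (x.1 : ℕ) = 0 then
    (-1 : ℂ) ^ grade M N x.2.2 • (if x.2.1 = x.2.2 then 1 else η)
  else 0

variable (M N p) in
open Polynomial in
/-- A homomorphism to polynomials detecting the words of maximal length. -/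
def topHom : WAlg M N p →ₐ[ℂ] Polynomial D :=
  liftHom (parW M N p) (fun x => Polynomial.X * Polynomial.C (topValue η x)) (by
    intro x y
    -- The target is commutative, so only a pair of odd generators could cause trouble. An odd
    -- generator has `a ≠ b`, its value is a multiple of `η`, and the product of two such values is
    -- zero.
    by_cases h : parW M N p x * parW M N p y % 2 = 0
    · rw [neg_one_pow_congr (n := 0) h, pow_zero, one_smul]
      ring
    · have hx : parW M N p x % 2 = 1 := by
        rcases Nat.mod_two_eq_zero_or_one (parW M N p x) with h' | h'
        · simp [Nat.mul_mod, h'] at h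
        · exact h'
      have hy : parW M N p y % 2 = 1 := by
        rcases Nat.mod_two_eq_zero_or_one (parW M N p y) with h' | h'
        · simp [Nat.mul_mod, h'] at h
        · exact h'
      have key : ∀ z : WIndex M N p, parW M N p z % 2 = 1 → ∃ r : ℂ,
          topValue η z = r • η := by
        intro z hz
        rw [topValue]
        split_ifs with h1 h2
        · rw [parW, h2] at hz
          omega
        · exact ⟨_, rfl⟩
        · exact ⟨0, by simp⟩
      obtain ⟨r, hr⟩ := key x hx
      obtain ⟨t, ht⟩ := key y hy
      have h0 : topValue η x * topValue η y = 0 := by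
        rw [hr, ht, smul_mul_smul_comm, hη, smul_zero]
      have h1 : ∀ u v : D, (Polynomial.X * C u) * (Polynomial.X * C v) =
          Polynomial.X * Polynomial.X * C (u * v) := by
        intro u v
        rw [map_mul]
        ring
      rw [h1, h1, mul_comm (topValue η y), h0]
      simp)

lemma natDegree_topHom_le {d : ℕ} {f : WAlg M N p} (hf : f ∈ degreeLE (parW M N p) d) :
    (topHom M N p hη f).natDegree ≤ d := by
  have : degreeLE (parW M N p) d ≤
      ((Polynomial.degreeLE D d).restrictScalars ℂ).comap
        (topHom M N p hη).toLinearMap := by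
    rw [degreeLE, Submodule.span_le]
    rintro _ ⟨l, hl, rfl⟩
    change _ ∈ Polynomial.degreeLE D d
    rw [Polynomial.mem_degreeLE, AlgHom.toLinearMap_apply, map_list_prod, List.map_map]
    refine Polynomial.degree_le_of_natDegree_le ?_
    refine (Polynomial.natDegree_list_prod_le _).trans ?_
    rw [List.map_map]
    refine (List.sum_le_card_nsmul _ 1 ?_).trans (by simpa using hl)
    intro n hn
    obtain ⟨x, _, rfl⟩ := List.mem_map.1 hn
    dsimp only [Function.comp]
    rw [topHom, liftHom_gen]
    refine Polynomial.natDegree_mul_le.trans ?_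
    rw [Polynomial.natDegree_C]
    exact Polynomial.natDegree_X_le
  have h := this hf
  exact Polynomial.natDegree_le_of_degree_le (Polynomial.mem_degreeLE.1 h)

/-- The matrix is `1 + B` with `B² = 0`. The entries of its powers off the diagonal, `n η`, stay
nonzero over the dual numbers, so that odd entries of `W̄_j` are detected as well. -/
lemma topMatrix_pow (hη : η * η = 0) (n : ℕ) (a b : Fin (M + N)) :
    ((Matrix.of fun a b : Fin (M + N) => if a = b then (1 : D) else η) ^ n)
      a b = if a = b then 1 else (n : ℂ) • η := by
  let B : Matrix (Fin (M + N)) (Fin (M + N)) (D) :=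
    Matrix.of fun a b => if a = b then 0 else η
  have hB : B * B = 0 := by
    ext1 a b
    rw [Matrix.mul_apply]
    refine Finset.sum_eq_zero fun c _ => ?_
    simp only [B, Matrix.of_apply]
    split_ifs <;> simp [hη]
  have hA : (Matrix.of fun a b : Fin (M + N) => if a = b then (1 : D) else
      η) = 1 + B := by
    ext1 a b
    rw [Matrix.add_apply, Matrix.one_apply]
    simp only [B, Matrix.of_apply]
    split_ifs <;> simp
  have hpow : (1 + B) ^ n = 1 + (n : ℂ) • B := by
    induction n with
    | zero => simp
    | succ n ih =>
      rw [pow_succ, ih, mul_add, mul_one, add_mul, smul_mul_assoc, hB, smul_zero, add_zero,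
        one_mul, Nat.cast_succ, add_smul, one_smul, add_assoc]
  rw [hA, hpow, Matrix.add_apply, Matrix.one_apply, Matrix.smul_apply]
  simp only [B, Matrix.of_apply]
  split_ifs <;> simp

open Polynomial in
lemma topHom_wordSum (hp : 1 ≤ p) (α : List (Fin p) → ℂ) (n : ℕ) (a b : Fin (M + N)) :
    topHom M N p hη (wordSum α (signedGen M N p) n a b) =
      α (List.replicate n (firstIdx hp)) • (Polynomial.X ^ n * C (if a = b then 1 else
        (n : ℂ) • η)) := by
  have h := map_wordSum (AlgHom.mapMatrix (m := Fin (M + N)) (topHom M N p hη)) α (signedGen M N p) n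
  have hs : ∀ s, (AlgHom.mapMatrix (m := Fin (M + N)) (topHom M N p hη)) (signedGen M N p s) =
      if s = firstIdx hp then (Polynomial.X : Polynomial D) • (Matrix.of fun a b : Fin (M + N) =>
        if a = b then (1 : D) else η).map C else 0 := by
    intro s
    ext1 a b
    rw [AlgHom.mapMatrix_apply, Matrix.map_apply, signedGen, mul_signMatrix_apply, Wgen_apply,
      map_smul, topHom, liftHom_gen, topValue]
    by_cases hs : s = firstIdx hp
    · rw [if_pos hs, if_pos (by rw [hs]), ← mul_smul_comm, ← Polynomial.smul_C, smul_smul,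
        neg_one_pow_mul_self, one_smul]
      rfl
    · rw [if_neg hs, if_neg (fun h => hs (Fin.ext h))]
      simp
  rw [funext hs, wordSum_of_eq_zero hp _ (fun s hs => if_neg hs), if_pos rfl] at h
  have h2 := congrFun (congrFun h a) b
  refine h2.trans ?_
  rw [_root_.smul_pow, Matrix.smul_apply, Matrix.smul_apply, ← RingHom.mapMatrix_apply, ← map_pow,
    RingHom.mapMatrix_apply, Matrix.map_apply, topMatrix_pow hη, smul_eq_mul]

/-- Under `topHom` all letters but `0` go to zero, so the coefficient of `X^{j+1}` is, up to sign,
the coefficient of the word `0^{j+1}` times `1` or `(j+1)ε`. Elements of degree at most `j` have no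
such term. -/
lemma Wbar_notMem_degreeLE (hp : 1 ≤ p) {α : List (Fin p) → ℂ} {j : ℕ}
    (hα : α (List.replicate (j + 1) (firstIdx hp)) ≠ 0) (a b : Fin (M + N)) :
    Wbar M N p (toCoeffs α) j a b ∉ degreeLE (parW M N p) j := by
  intro h
  have h1 := Polynomial.coeff_eq_zero_of_natDegree_lt
    (Nat.lt_succ_of_le (natDegree_topHom_le (DualNumber.eps_mul_eps (R := ℂ)) h))
  rw [Wbar_apply, map_smul, topHom_wordSum _ hp, Polynomial.coeff_smul, Polynomial.coeff_smul,
    Polynomial.coeff_mul_C, Polynomial.coeff_X_pow_self, one_mul, smul_smul] at h1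
  have h2 := (smul_eq_zero.1 h1).resolve_left
    (mul_ne_zero (pow_ne_zero _ (neg_ne_zero.2 one_ne_zero)) hα)
  split_ifs at h2 with hab
  · exact one_ne_zero h2
  · have h3 := congrArg TrivSqZeroExt.snd h2
    simp at h3
    norm_cast at h3

end Degrees

/-! ### Uniqueness of the coefficients -/

section Uniqueness

variable {p : ℕ}

lemma exists_toCoeffs_eq (β : Coeffs p) : ∃ β' : List (Fin p) → ℂ, toCoeffs β' = β := by
  -- The value on the empty word is arbitrary: `Coeffs` has no sequence of length zero.
  let β' : List (Fin p) → ℂ := fun l => match l with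
    | [] => 0
    | a :: t => β t.length (a :: t).get
  refine ⟨β', ?_⟩
  have key : ∀ (l : List (Fin p)) (n : ℕ) (s : Fin (n + 1) → Fin p), List.ofFn s = l →
      β' l = β n s := by
    intro l n s h
    cases l with
    | nil => simp at h
    | cons a t =>
      have hn : n = t.length := by
        have := congrArg List.length h
        simpa using this
      subst hn
      have hs : s = (a :: t).get := by
        refine List.ofFn_injective ?_
        rw [h, List.ofFn_get]
      rw [hs]
  funext n s
  exact key _ n s rfl

/-- The values of the generators of `W_p(n+1|0)` for which only one word contributes to the entry
in the upper right corner. -/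
def wordValue (l : List (Fin p)) (s : Fin p) :
    Matrix (Fin (l.length + 1 + 0)) (Fin (l.length + 1 + 0)) ℂ :=
  Matrix.of fun a b => if (b : ℕ) = a + 1 ∧ l[(a : ℕ)]? = some s then 1 else 0

/-- Each letter moves one step to the right, and from position `a` only the letter of `l` at
position `a` may be used. So the only path from the first index to the last spells `l`. -/
lemma wordSum_wordValue (β : List (Fin p) → ℂ) (l : List (Fin p)) :
    wordSum β (wordValue l) (wordDeg l) 0 (Fin.last (l.length + 0)) = β l := by
  have key : ∀ (t r : List (Fin p)) (β : List (Fin p) → ℂ) (a : Fin (l.length + 1 + 0)),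
      r ++ t = l → (a : ℕ) = r.length →
        wordSum β (wordValue l) (wordDeg t) a (Fin.last (l.length + 0)) = β t := by
    intro t
    induction t with
    | nil =>
      intro r β a h ha
      obtain rfl : a = Fin.last (l.length + 0) := Fin.ext (by simp [ha, ← h])
      change wordSum β (wordValue l) 0 _ _ = _
      rw [wordSum_zero, Algebra.algebraMap_eq_smul_one, Matrix.smul_apply, Matrix.one_apply_eq,
        smul_eq_mul, mul_one]
    | cons s t ih =>
      intro r β a h ha
      have hl : (a : ℕ) < l.length := by rw [ha, ← h]; simp
      have hs : l[(a : ℕ)]? = some s := by simp [ha, ← h]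
      have hd : wordDeg (s :: t) = (s : ℕ) + 1 + wordDeg t := by simp [wordDeg]
      rw [wordSum_rec, if_neg (by omega), zero_add, Matrix.sum_apply,
        Finset.sum_eq_single s]
      · rw [if_pos (by omega), hd, Nat.add_sub_cancel_left, Matrix.mul_apply,
          Finset.sum_eq_single (⟨(a : ℕ) + 1, by omega⟩ : Fin (l.length + 1 + 0))]
        · rw [ih (r ++ [s]) _ _ (by simpa using h) (by simp [ha]), wordValue, Matrix.of_apply,
            if_pos ⟨rfl, hs⟩, one_mul]
        · intro b _ hb
          rw [wordValue, Matrix.of_apply, if_neg fun h' => hb (Fin.ext h'.1), zero_mul]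
        · simp
      · intro s' _ hs'
        split_ifs
        · rw [Matrix.mul_apply]
          refine Finset.sum_eq_zero fun b _ => ?_
          rw [wordValue, Matrix.of_apply, if_neg, zero_mul]
          rintro ⟨_, h'⟩
          rw [hs] at h'
          exact hs' (Option.some.inj h').symm
        · rfl
      · simp
  exact key l [] β 0 rfl rfl

lemma grade_zero_right (M : ℕ) (a : Fin (M + 0)) : grade M 0 a = 0 := if_pos a.2

/-- The homomorphism with values `wordValue`. -/
def wordHom (l : List (Fin p)) : WAlg (l.length + 1) 0 p →ₐ[ℂ] ℂ :=
  liftHom (parW (l.length + 1) 0 p) (fun x => wordValue l x.1 x.2.1 x.2.2) fun x y => by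
    simp only [parW, grade_zero_right]
    rw [mul_comm]
    simp

lemma wordHom_wordSum (β : List (Fin p) → ℂ) (l : List (Fin p)) :
    wordHom l (wordSum β (signedGen (l.length + 1) 0 p) (wordDeg l) 0
      (Fin.last (l.length + 0))) = β l := by
  have h := map_wordSum (AlgHom.mapMatrix (m := Fin (l.length + 1 + 0)) (wordHom l)) β
    (signedGen (l.length + 1) 0 p) (wordDeg l)
  have hs : ∀ s, (AlgHom.mapMatrix (m := Fin (l.length + 1 + 0)) (wordHom l))
      (signedGen (l.length + 1) 0 p s) = wordValue l s := by
    intro s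
    ext1 a b
    rw [AlgHom.mapMatrix_apply, Matrix.map_apply, signedGen, mul_signMatrix_apply, Wgen_apply,
      grade_zero_right, pow_zero, one_smul, wordHom, liftHom_gen]
  rw [funext hs] at h
  rw [← wordSum_wordValue β l, ← h]
  rfl

/-- A family is determined by its initial values and its brackets. -/
theorem IsYangianFamily.unique {ε : ℤˣ} {α β : Coeffs p}
    (hα : ∀ M N, IsYangianFamily M N p ε α) (hβ : ∀ M N, IsYangianFamily M N p ε β) : β = α := by
  obtain ⟨α, rfl⟩ := exists_toCoeffs_eq α
  obtain ⟨β, rfl⟩ := exists_toCoeffs_eq β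
  -- Agreement off the diagonal is all that the brackets provide, and it suffices: the corner entry
  -- used to read off the coefficient of a nonempty word is off the diagonal.
  have hcoeff : ∀ j, (∀ M N (a b : Fin (M + N)), a ≠ b →
      Wbar M N p (toCoeffs β) j a b = Wbar M N p (toCoeffs α) j a b) →
        ∀ l : List (Fin p), wordDeg l = j + 1 → β l = α l := by
    intro j h l hl
    have hne : l ≠ [] := by
      rintro rfl
      simp [wordDeg] at hl
    have h1 := congrArg (wordHom l) (h (l.length + 1) 0 0 (Fin.last (l.length + 0)) (by
      intro h0
      have := congrArg Fin.val h0
      simp at this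
      exact hne (List.length_eq_zero_iff.1 this.symm)))
    rw [Wbar_apply, Wbar_apply, grade_zero_right, pow_zero, one_smul, one_smul, ← hl,
      wordHom_wordSum, wordHom_wordSum] at h1
    exact h1
  have hW : ∀ j, (∀ l : List (Fin p), wordDeg l = j + 1 → β l = α l) → ∀ M N,
      Wbar M N p (toCoeffs β) j = Wbar M N p (toCoeffs α) j := by
    intro j h M N
    ext1 a b
    rw [Wbar_apply, Wbar_apply, wordSum_congr _ _ h]
  have main : ∀ j, ∀ l : List (Fin p), wordDeg l = j + 1 → β l = α l := by
    have h0 : ∀ l : List (Fin p), wordDeg l = 0 + 1 → β l = α l :=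
      hcoeff 0 fun M N a b _ => by rw [(hα M N).1, (hβ M N).1]
    have h1 : ∀ l : List (Fin p), wordDeg l = 1 + 1 → β l = α l :=
      hcoeff 1 fun M N a b _ => by rw [(hα M N).2.1, (hβ M N).2.1]
    intro j
    induction j with
    | zero => exact h0
    | succ j ih =>
      rcases Nat.eq_zero_or_pos j with rfl | hj
      · exact h1
      · refine hcoeff (j + 1) fun M N a d had => ?_
        -- With `a = b = c` and `d ≠ a` one Kronecker delta survives, and the bracket expresses the
        -- entry `(a,d)` of `W̄_{j+1}` through members of lower index.
        have e1 := (hα M N).2.2.1 j hj a a a d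
        have e2 := (hβ M N).2.2.1 j hj a a a d
        rw [hW 0 h0, hW 1 h1, hW j ih, e1, if_pos rfl, if_neg had, if_pos rfl, if_neg had] at e2
        simpa using e2.symm
  funext n s
  refine main (n + ∑ i, (s i : ℕ)) _ ?_
  rw [wordDeg_ofFn, Finset.sum_add_distrib]
  simp
  omega

end Uniqueness

/-! ### New generators and the relation between the two signs -/

section Generators

variable {M N p : ℕ} (hp : 1 ≤ p)

lemma signCoeff_singleton_ne_zero (ε : ℤˣ) (j : Fin p) : signCoeff hp ε [j] ≠ 0 := by
  rw [signCoeff_singleton]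
  refine mul_ne_zero (mul_ne_zero (pow_ne_zero _ ?_) (pow_ne_zero _ ?_)) ?_
  · exact_mod_cast ε.ne_zero
  · exact_mod_cast Nat.factorial_ne_zero _
  · exact_mod_cast (Nat.choose_pos (by omega)).ne'

lemma plusCoeff_replicate_succ (j : ℕ) :
    plusCoeff hp (List.replicate (j + 1) (firstIdx hp)) = ((p + j).choose (j + 1) : ℂ) := by
  rw [plusCoeff_replicate, show p - 1 + (j + 1) = p + j by omega]

lemma signCoeff_replicate_ne_zero {ε : ℤˣ} {j : ℕ} (h : ε = 1 ∨ j < p) :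
    signCoeff hp ε (List.replicate (j + 1) (firstIdx hp)) ≠ 0 := by
  rcases Int.units_eq_one_or ε with rfl | rfl
  · rw [signCoeff_one, plusCoeff_replicate_succ]
    exact_mod_cast (Nat.choose_pos (by omega)).ne'
  · rw [signCoeff_neg_one, minusCoeff_replicate]
    have hj : j < p := h.resolve_left (by decide)
    exact_mod_cast (Nat.choose_pos (by omega)).ne'

lemma Wbar_minusCoeff_eq_zero {j : ℕ} (h : p ≤ j) : Wbar M N p (toCoeffs minusCoeff) j = 0 := by
  ext1 a b
  rw [Wbar_apply, wordSum_minusCoeff, coeff_detSeries_eq_zero _ (by omega)]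
  simp

lemma evenMat_Wbar (α : List (Fin p) → ℂ) (j : ℕ) :
    EvenMat (grade M N) (Wbar M N p (toCoeffs α) j) := fun a b => by
  rw [Wbar_apply]
  exact (EvenMat.wordSum evenMat_signedGen _ a b).smul _

/-- The homomorphism of `W_p(M|N)` with prescribed matrices of values of the generators. -/
def evalHom (V : Fin p → WMat M N p) (hV : ∀ s, EvenMat (grade M N) (V s)) :
    WAlg M N p →ₐ[ℂ] WAlg M N p :=
  liftHom (parW M N p) (fun x => V x.1 x.2.1 x.2.2) fun x y =>
    (hV x.1 x.2.1 x.2.2).comm (hV y.1 y.2.1 y.2.2)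

lemma evalHom_gen (V : Fin p → WMat M N p) (hV : ∀ s, EvenMat (grade M N) (V s)) (s : Fin p)
    (a b : Fin (M + N)) : evalHom V hV (gen (parW M N p) (s, a, b)) = V s a b :=
  liftHom_gen _ _ _ _

lemma evalHom_signedGen (V : Fin p → WMat M N p) (hV : ∀ s, EvenMat (grade M N) (V s))
    (s : Fin p) : AlgHom.mapMatrix (m := Fin (M + N)) (evalHom V hV) (signedGen M N p s) =
      V s * signMatrix M N p := by
  ext1 a b
  rw [AlgHom.mapMatrix_apply, Matrix.map_apply, signedGen, mul_signMatrix_apply, Wgen_apply,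
    map_smul, evalHom_gen, mul_signMatrix_apply]

lemma evalHom_Wbar (V : Fin p → WMat M N p) (hV : ∀ s, EvenMat (grade M N) (V s))
    (α : List (Fin p) → ℂ) (j : ℕ) (a b : Fin (M + N)) :
    evalHom V hV (Wbar M N p (toCoeffs α) j a b) =
      (-1 : ℂ) ^ grade M N b • wordSum α (fun s => V s * signMatrix M N p) (j + 1) a b := by
  have h := map_wordSum (AlgHom.mapMatrix (m := Fin (M + N)) (evalHom V hV)) α (signedGen M N p)
    (j + 1)
  rw [funext (evalHom_signedGen V hV)] at h
  rw [Wbar_apply, map_smul, ← h]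
  rfl

/-- A family with nonzero coefficients of the linear terms generates `W_p(M|N)` freely. -/
theorem exists_algEquiv {α : List (Fin p) → ℂ} (hα : ∀ j, α [j] ≠ 0) :
    ∃ Φ : WAlg M N p ≃ₐ[ℂ] WAlg M N p, ∀ (j : Fin p) (a b : Fin (M + N)),
      Φ (gen (parW M N p) (j, a, b)) = Wbar M N p (toCoeffs α) j a b := by
  -- `V` expresses the old generators through the new ones: substituting `V` into the words gives
  -- back `signedGen`. Evenness is carried along so that `V` defines a homomorphism.
  obtain ⟨V, hV, hVU⟩ := exists_wordSum_eq hα (P := EvenMat (grade M N)) EvenMat.zero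
    (fun V hV u hu r k => EvenMat.smul r (hu.sub (EvenMat.wordSum hV k)))
    (U := signedGen M N p) evenMat_signedGen
  let φ := evalHom (fun s : Fin p => Wbar M N p (toCoeffs α) s) fun s => evenMat_Wbar α s
  let ψ := evalHom (fun s => V s * signMatrix M N p) fun s => (hV s).mul_signMatrix
  have hVS : (fun s => V s * signMatrix M N p * signMatrix M N p) = V := by
    funext s
    rw [mul_assoc, signMatrix_mul_self, mul_one]
  -- The images of the `V s` and the `signedGen s` have the same components in degrees `1` to `p`,
  -- so they coincide by triangularity.
  have hφ : ∀ s, AlgHom.mapMatrix (m := Fin (M + N)) φ (V s) = signedGen M N p s := by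
    refine congrFun (eq_of_wordSum_eq hα fun j => ?_)
    rw [← map_wordSum (AlgHom.mapMatrix (m := Fin (M + N)) φ), hVU, evalHom_signedGen,
      Wbar_mul_signMatrix]
  have hgen : ∀ s a b, (-1 : ℂ) ^ grade M N b • signedGen M N p s a b =
      gen (parW M N p) (s, a, b) := by
    intro s a b
    rw [signedGen, ← apply_eq_mul_signMatrix, Wgen_apply]
  refine ⟨AlgEquiv.ofAlgHom φ ψ ?_ ?_, fun j a b => evalHom_gen _ _ j a b⟩
  · refine AlgHom.ext (superPoly_hom_ext (parW M N p) fun x => ?_)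
    obtain ⟨s, a, b⟩ := x
    have h := congrFun (congrFun (hφ s) a) b
    rw [AlgHom.mapMatrix_apply, Matrix.map_apply] at h
    rw [AlgHom.comp_apply, evalHom_gen, mul_signMatrix_apply, map_smul, h, hgen]
    rfl
  · refine AlgHom.ext (superPoly_hom_ext (parW M N p) fun x => ?_)
    obtain ⟨s, a, b⟩ := x
    rw [AlgHom.comp_apply, evalHom_gen, evalHom_Wbar, hVS, hVU, hgen]
    rfl

lemma mem_adjoin_of_algEquiv {α : Coeffs p} {Φ : WAlg M N p ≃ₐ[ℂ] WAlg M N p}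
    (hΦ : ∀ (j : Fin p) (a b : Fin (M + N)),
      Φ (gen (parW M N p) (j, a, b)) = Wbar M N p α j a b) (f : WAlg M N p) :
    f ∈ Algebra.adjoin ℂ {x | ∃ (k : Fin p) (c d : Fin (M + N)), x = Wbar M N p α k c d} := by
  obtain ⟨g, rfl⟩ := Φ.surjective f
  induction g using superPoly_induction with
  | hc r =>
    rw [AlgEquiv.commutes]
    exact Subalgebra.algebraMap_mem _ r
  | hg x =>
    obtain ⟨s, a, b⟩ := x
    rw [hΦ]
    exact Algebra.subset_adjoin ⟨s, a, b, rfl⟩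
  | hm f g hf hg =>
    rw [map_mul]
    exact Subalgebra.mul_mem _ hf hg
  | ha f g hf hg =>
    rw [map_add]
    exact Subalgebra.add_mem _ hf hg

/-- The relation between the families for both signs. -/
theorem sum_signCoeff_mul (ε : ℤˣ) (k : ℕ) : ∑ i ∈ Finset.range (k + 1), (-1 : ℂ) ^ i •
    (wordSum (signCoeff hp (-ε)) (signedGen M N p) i *
      wordSum (signCoeff hp ε) (signedGen M N p) (k - i)) = if k = 0 then 1 else 0 := by
  have key : ∀ i, wordSum minusCoeff (signedGen M N p) i = (-1 : ℂ) ^ i • invGen M N p i :=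
    minusGen_eq
  have h1 : plusSeries M N hp * detSeries (signedGen M N p) p = 1 := plusSeries_mul_detSeries hp _
  have h2 : detSeries (signedGen M N p) p * plusSeries M N hp = 1 := detSeries_mul_plusSeries hp _
  rcases Int.units_eq_one_or ε with rfl | rfl
  · rw [signCoeff_one, signCoeff_neg_one]
    have h := congrArg (PowerSeries.coeff k) h2
    rw [PowerSeries.coeff_mul, Finset.Nat.sum_antidiagonal_eq_sum_range_succ_mk,
      PowerSeries.coeff_one] at h
    rw [← h]
    refine Finset.sum_congr rfl fun i _ => ?_
    rw [key, smul_mul_assoc, smul_smul, neg_one_pow_mul_self, one_smul, coeff_plusSeries]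
    rfl
  · rw [neg_neg, signCoeff_one, signCoeff_neg_one]
    -- The alternating sign now belongs to the other factor; multiplying by `(-1)^k` moves it, as
    -- `(-1)^k (-1)^{k-i} = (-1)^i`.
    have h := congrArg (fun f => (-1 : ℂ) ^ k • PowerSeries.coeff k f) h1
    simp only [PowerSeries.coeff_mul, Finset.Nat.sum_antidiagonal_eq_sum_range_succ_mk,
      PowerSeries.coeff_one] at h
    rw [Finset.smul_sum] at h
    refine Eq.trans (Finset.sum_congr rfl fun i hi => ?_) (h.trans ?_)
    · have hik : i ≤ k := by
        have := Finset.mem_range.1 hi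
        omega
      rw [key, mul_smul_comm, smul_smul, ← pow_add, Nat.add_sub_cancel' hik, coeff_plusSeries]
      rfl
    · split_ifs with h0
      · rw [h0, pow_zero, one_smul]
      · rw [smul_zero]

theorem Wbar_signCoeff_eq (ε : ℤˣ) (j : ℕ) : Wbar M N p (toCoeffs (signCoeff hp ε)) j =
    ∑ n ∈ Finset.range (j + 1), ∑ s : Fin (n + 1) → Fin (j + 1),
      if n + ∑ i, (s i : ℕ) = j then
        (-1 : ℂ) ^ (j + 1 + (n + 1)) • gradedProd M N p
          (List.ofFn fun i => Wbar M N p (toCoeffs (signCoeff hp (-ε))) (s i)) else 0 := by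
  have h := sum_gradedProd_mul_signMatrix
    (fun l : List (Fin (j + 1)) => (-1 : ℂ) ^ (wordDeg l + l.length))
    (fun s => Wbar M N p (toCoeffs (signCoeff hp (-ε))) s) j
  simp only [Wbar_mul_signMatrix] at h
  have h0 : wordSum (signCoeff hp (-ε)) (signedGen M N p) 0 = 1 := by
    rcases Int.units_eq_one_or ε with rfl | rfl
    · have h1 := minusGen_eq (M := M) (N := N) (p := p) 0
      rw [invGen_zero, pow_zero, one_smul] at h1
      rw [signCoeff_neg_one]
      exact h1
    · rw [neg_neg, signCoeff_one]
      exact plusGen_zero hp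
  rw [wordSum_alternating (Z := fun k => wordSum (signCoeff hp ε) (signedGen M N p) k) h0
    (sum_signCoeff_mul hp ε) le_rfl, ← Wbar_mul_signMatrix] at h
  have h2 := congrArg (· * signMatrix M N p) h
  simp only [mul_assoc, signMatrix_mul_self, mul_one] at h2
  rw [← h2]
  refine Finset.sum_congr rfl fun n _ => Finset.sum_congr rfl fun s _ => ?_
  split_ifs with hs
  · rw [wordDeg_ofFn, List.length_ofFn, Finset.sum_add_distrib]
    congr 2
    simp
    omega
  · rfl

end Generators

end

end WSuper

theorem mainTheorem8 (p : ℕ) (hp : 1 ≤ p) :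
    (∀ M N : ℕ, IsUnit (WSuper.constraintMatrix M N p)) ∧
    ∃ α : ℤˣ → WSuper.Coeffs p,
      (∀ ε : ℤˣ, (∀ M N : ℕ, WSuper.IsYangianFamily M N p ε (α ε)) ∧
        ∀ β : WSuper.Coeffs p,
          (∀ M N : ℕ, WSuper.IsYangianFamily M N p ε β) → β = α ε) ∧
      (∀ (ε : ℤˣ) (j : Fin p), α ε 0 (fun _ => j) =
        ((ε : ℤ) : ℂ) ^ (j : ℕ) * ((j : ℕ).factorial : ℂ) ^ 2 *
          ((p + j).choose (2 * j + 1) : ℂ)) ∧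
      (∀ j : ℕ, α (-1) j (fun _ => ⟨0, hp⟩) = (p.choose (j + 1) : ℂ)) ∧
      (∀ j : ℕ, α 1 j (fun _ => ⟨0, hp⟩) = ((p + j).choose (j + 1) : ℂ)) ∧
      ∀ M N : ℕ,
        (∀ (ε : ℤˣ) (j : ℕ) (a b : Fin (M + N)),
          WSuper.Wbar M N p (α ε) j a b ∈ WSuper.degreeLE (WSuper.parW M N p) (j + 1) ∧
          (ε = 1 ∨ j < p →
            WSuper.Wbar M N p (α ε) j a b ∉ WSuper.degreeLE (WSuper.parW M N p) j)) ∧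
        (∀ ε : ℤˣ, ∃ Φ : WSuper.WAlg M N p ≃ₐ[ℂ] WSuper.WAlg M N p,
          ∀ (j : Fin p) (a b : Fin (M + N)),
            Φ (WSuper.gen (WSuper.parW M N p) (j, a, b)) = WSuper.Wbar M N p (α ε) j a b) ∧
        (∀ (ε : ℤˣ) (j : ℕ), p ≤ j → ∀ a b : Fin (M + N),
          WSuper.Wbar M N p (α ε) j a b ∈ Algebra.adjoin ℂ
            {x | ∃ (k : Fin p) (c d : Fin (M + N)), x = WSuper.Wbar M N p (α ε) k c d}) ∧
        (∀ (ε : ℤˣ) (j : ℕ), WSuper.Wbar M N p (α ε) j =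
          ∑ n ∈ Finset.range (j + 1), ∑ s : Fin (n + 1) → Fin (j + 1),
            if n + ∑ i, (s i : ℕ) = j then
              (-1 : ℂ) ^ (j + 1 + (n + 1)) • WSuper.gradedProd M N p
                (List.ofFn fun i => WSuper.Wbar M N p (α (-ε)) (s i)) else 0) ∧
        (∀ j : ℕ, p ≤ j → WSuper.Wbar M N p (α (-1)) j = 0) ∧
        (∀ j : ℕ, p ≤ j → ∀ a b : Fin (M + N), WSuper.Wbar M N p (α 1) j a b ≠ 0) := by
  classical
  refine ⟨fun M N => WSuper.isUnit_constraintMatrix M N p,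
    fun ε => WSuper.toCoeffs (WSuper.signCoeff hp ε), ?_, ?_, ?_, ?_,
    fun M N => ⟨?_, ?_, ?_, ?_, ?_, ?_⟩⟩
  · exact fun ε => ⟨fun M N => WSuper.isYangianFamily_signCoeff hp ε, fun β hβ =>
      WSuper.IsYangianFamily.unique (fun M N => WSuper.isYangianFamily_signCoeff hp ε) hβ⟩
  · intro ε j
    rw [← WSuper.signCoeff_singleton hp]
    simp [WSuper.toCoeffs]
  · intro j
    rw [← WSuper.minusCoeff_replicate hp, ← WSuper.signCoeff_neg_one hp, ← List.ofFn_const]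
    rfl
  · intro j
    rw [← WSuper.plusCoeff_replicate_succ hp, ← WSuper.signCoeff_one hp, ← List.ofFn_const]
    rfl
  · exact fun ε j a b => ⟨WSuper.Wbar_mem_degreeLE _ j a b, fun h =>
      WSuper.Wbar_notMem_degreeLE hp (WSuper.signCoeff_replicate_ne_zero hp h) a b⟩
  · exact fun ε => WSuper.exists_algEquiv (WSuper.signCoeff_singleton_ne_zero hp ε)
  · intro ε j _ a b
    obtain ⟨Φ, hΦ⟩ := WSuper.exists_algEquiv (M := M) (N := N)
      (WSuper.signCoeff_singleton_ne_zero hp ε)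
    exact WSuper.mem_adjoin_of_algEquiv hΦ _
  · exact fun ε j => WSuper.Wbar_signCoeff_eq hp ε j
  · intro j hj
    dsimp only
    rw [WSuper.signCoeff_neg_one]
    exact WSuper.Wbar_minusCoeff_eq_zero hj
  · intro j _ a b h
    -- For the sign `+` nonvanishing is a consequence of the exact degree: zero has degree at most
    -- `j`.
    refine WSuper.Wbar_notMem_degreeLE hp
      (WSuper.signCoeff_replicate_ne_zero hp (Or.inl rfl : (1 : ℤˣ) = 1 ∨ j < p)) a b ?_
    rw [h]
    exact Submodule.zero_mem _
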